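/- **Setting.** Let $n\ge 1$, let $S^n\subset\mathbb R^{n+1}$ be the unit sphere, let $\sigma$ be its surface measure, and let $d\omega=c\,d\sigma$ with a constant $c>0$. For an even function $f\in C^\infty(S^n)$, $\xi\in S^n$ and $\operatorname{Re}\lambda>-1$ put $$(J_\lambda f)(\xi)=\int_{S^n} f(\omega)\,\frac{|\langle\xi,\omega\rangle|^{\lambda}}{\Gamma\left(\frac{\lambda+1}{2}\right)}\,d\omega ,$$ and for other $\lambda\in\mathbb C$ define $(J_\lambda f)(\xi)$ by analytic continuation in $\lambda$. Let $S$ be the algebra of smooth even functions on $S^n$ with the $C^\infty$ topology, and let $M$ be its dual with the weak-$*$ topology. **Generalized Fourier transform.** A transform $F f(\xi)=\int f(\omega)\,e(\omega,\xi)\,d\omega$ of even functions on $S^n$, whose kernel $e$ is a generalized function (for fixed $\xi$ or fixed $\omega$ it is an element of $M$, and both families of functionals come from one generalized function on $S^n\times S^n$), is called a *generalized Fourier transform* (GFT) with respect to $d\omega$ if the following hold. * $S$ is a locally convex space, consists of some but not all continuous even functions, is closed under products and complex conjugation, and is dense in $L^2_{\rm even}(S^n,d\omega)$; and $F$ is a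 linear bijection of $S$ onto $S$. * $F$ extends to an isometric isomorphism of $L^2_{\rm even}(S^n,d\omega)$ onto itself, and $\int f\,\overline g\,d\omega=\int Ff\,\overline{Fg}\,d\xi$ for $f,g\in S$. * The inversion formula $f(\omega)=\int (Ff)(\xi)\,\overline{e(\omega,\xi)}\,d\xi$ holds for all $f\in S$ and $\omega\in S^n$. * $F$ extends to an isomorphism of $M$ onto $M$ that takes $\delta_\omega$ to $e(\omega,\cdot)$ and $\overline{e(\cdot,\xi)}$ to $\delta_\xi$. **Statement.** 1. For every smooth even $f$ and every $\xi\in S^n$ the integral above converges for $\operatorname{Re}\lambda>-1$ and extends to an entire function of $\lambda$. 2. For every $n\ge1$ and $\rho\in\mathbb R$ there is a normalization $c>0$ of the invariant measure $d\omega=c\,d\sigma$ for which $J_\lambda$ with $\lambda=-\frac{n+1}{2}+i\rho$ is a GFT. 3. In particular, let $n=4k+1$ with $k\ge0$. Then $J_{-2k-1}$ is a GFT for a suitable normalization of $d\omega$. For every normalization and every smooth even $f$, $$(J_{-2k-1}f)(\xi)=\frac{(-1)^k\,k!}{(2k)!}\int_{S^n} f(\omega)\,\delta^{(2k)}(\langle\xi,\omega\rangle)\,d\omega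 ,$$ where $\delta^{(2k)}(\langle\xi,\omega\rangle)$ is the pull-back: the integral is $\varphi^{(2k)}(0)$, where $\varphi$ is the smooth density on $(-1,1)$ of the image of $f\,d\omega$ under $\omega\mapsto\langle\xi,\omega\rangle$, which exists. The transform with the kernel $\delta^{(2k)}(\langle\xi,\omega\rangle)$ is itself a GFT for a suitable normalization of $d\omega$. It is local: its value at $\xi$ is $0$ whenever $f$ vanishes in a neighbourhood of the hypersurface $\langle\xi,\omega\rangle=0$. -/

import Mathlib

open MeasureTheory Set Filter Topology
open scoped Manifold ContDiff NNReal ComplexConjugate RealInnerProductSpace UniformConvergence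

noncomputable section

/-! ### Generalized Fourier transforms -/

/-- A space `S` of continuous functions on `X`, closed under linear combinations, products and
complex conjugation, with a topology of its own (in general finer than the one of `C(X, ℂ)`).
That the topology is a locally convex vector space topology is part of `IsGFT`. -/
structure TestAlgebra (X : Type*) [TopologicalSpace X] where
  carrier : NonUnitalStarSubalgebra ℂ C(X, ℂ)
  top : TopologicalSpace carrier

namespace TestAlgebra

variable {X : Type*} [TopologicalSpace X]

/-- The functions of the test algebra, as a topological vector space with the topology `S.top`. -/
def Space (S : TestAlgebra X) : Type _ := S.carrier

instance (S : TestAlgebra X) : AddCommGroup S.Space :=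
  inferInstanceAs (AddCommGroup S.carrier)

instance (S : TestAlgebra X) : Module ℂ S.Space :=
  inferInstanceAs (Module ℂ S.carrier)

instance (S : TestAlgebra X) : TopologicalSpace S.Space := S.top

/-- Complex conjugation `f ↦ conj ∘ f` on the test algebra. -/
instance (S : TestAlgebra X) : Star S.Space :=
  inferInstanceAs (Star S.carrier)

/-- The underlying function of an element of the test algebra. -/
def fn {S : TestAlgebra X} (f : S.Space) : X → ℂ :=
  ⇑(Subtype.val (p := fun h : C(X, ℂ) => h ∈ S.carrier) f)

instance (S : TestAlgebra X) : CoeFun S.Space (fun _ => X → ℂ) := ⟨fn⟩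

theorem star_apply (S : TestAlgebra X) (f : S.Space) (x : X) : (star f) x = conj (f x) := rfl

theorem add_apply (S : TestAlgebra X) (f g : S.Space) (x : X) : (f + g) x = f x + g x := rfl

theorem smul_apply (S : TestAlgebra X) (a : ℂ) (f : S.Space) (x : X) :
    (a • f) x = a * f x := rfl

/-- `S` is a locally convex space and a dense subspace of the closed subspace `H` of `L²(X, μ)`.
It does not contain all the continuous functions whose classes lie in `H`. -/
structure IsDenseLineal [MeasurableSpace X] (μ : Measure X) (H : Submodule ℂ (Lp ℂ 2 μ))
    (S : TestAlgebra X) : Prop where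
  topologicalAddGroup : IsTopologicalAddGroup S.Space
  continuousSMul : ContinuousSMul ℂ S.Space
  locallyConvex : LocallyConvexSpace ℝ S.Space
  memLp : ∀ f : S.Space, MemLp (f : X → ℂ) 2 μ
  dense : closure {u : Lp ℂ 2 μ | ∃ f : S.Space, (u : X → ℂ) =ᵐ[μ] (f : X → ℂ)} = (H : Set _)
  proper : ∃ h : C(X, ℂ), (∃ u ∈ H, (u : X → ℂ) =ᵐ[μ] (h : X → ℂ)) ∧ h ∉ S.carrier

end TestAlgebra

/-- The notion of a generalized Fourier transform (GFT)
`f ↦ f̂`, `f̂ y = ∫ f x * e (x, y) dμ(x)`, with inversion formula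
`f x = ∫ f̂ y * conj (e (x, y)) dν(y)`.

`HX` and `HY` are the spaces of square integrable functions under consideration
(the whole `L²(X, μ)` and `L²(Y, ν)`, or the subspaces of, e.g., even functions); `S` and `T`
are the test algebras on `X` and `Y`; their duals `WeakDual ℂ S.Space` and `WeakDual ℂ T.Space`
are the spaces of generalized functions.  The kernel, a generalized function `e (x, y)`, is given by
its partial pairings
`eY y f = ∫ f x * e (x, y) dμ(x)` and `eX x g = ∫ g y * e (x, y) dν(y)`; these are two descriptions
of one generalized function on `X × Y` by `kernel_compat`.  The pairing of `g` with the complex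
conjugate kernel is `∫ g y * conj (e (x, y)) dν(y) = conj (eX x (star g))`. -/
structure IsGFT {X Y : Type*} [TopologicalSpace X] [MeasurableSpace X]
    [TopologicalSpace Y] [MeasurableSpace Y] (μ : Measure X) (ν : Measure Y)
    (HX : Submodule ℂ (Lp ℂ 2 μ)) (HY : Submodule ℂ (Lp ℂ 2 ν))
    (S : TestAlgebra X) (T : TestAlgebra Y)
    (eY : Y → S.Space → ℂ) (eX : X → T.Space → ℂ) : Prop where
  dense_left : S.IsDenseLineal μ HX
  dense_right : T.IsDenseLineal ν HY
  /-- `e (·, y)` is a generalized function on `X`. -/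
  kernel_left : ∀ y, ∃ m : WeakDual ℂ S.Space, ∀ f, m f = eY y f
  /-- `e (x, ·)` is a generalized function on `Y`. -/
  kernel_right : ∀ x, ∃ m : WeakDual ℂ T.Space, ∀ g, m g = eX x g
  /-- Both are restrictions of one generalized function on `X × Y`. -/
  kernel_compat : ∀ (f : S.Space) (g : T.Space),
    ∫ y, eY y f * g y ∂ν = ∫ x, f x * eX x g ∂μ
  transform : ∃ F : S.Space ≃ₗ[ℂ] T.Space,
    -- `F` is the transform with the kernel `e`
    (∀ f y, F f y = eY y f) ∧
    -- `F` extends to an isometric isomorphism of the spaces of square integrable functions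
    (∃ U : HX ≃ₗᵢ[ℂ] HY, ∀ (f : S.Space) (u : HX), (u : X → ℂ) =ᵐ[μ] (f : X → ℂ) →
      ((U u : Lp ℂ 2 ν) : Y → ℂ) =ᵐ[ν] (F f : Y → ℂ)) ∧
    -- the Plancherel formula
    (∀ f g : S.Space, ∫ x, f x * conj (g x) ∂μ = ∫ y, F f y * conj (F g y) ∂ν) ∧
    -- the inversion formula
    (∀ (f : S.Space) (x : X), f x = conj (eX x (star (F f)))) ∧
    -- `F` extends to an isomorphism of the spaces of generalized functions that takes
    -- `δ_x` to `e (x, ·)` and `conj (e (·, y))` to `δ_y`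
    (∃ G : WeakDual ℂ S.Space ≃L[ℂ] WeakDual ℂ T.Space,
      (∀ f : S.Space, ∃ m : WeakDual ℂ S.Space, (∀ h : S.Space, m h = ∫ x, h x * f x ∂μ) ∧
        ∀ g : T.Space, G m g = ∫ y, g y * F f y ∂ν) ∧
      (∀ x : X, ∃ m : WeakDual ℂ S.Space, (∀ h : S.Space, m h = h x) ∧
        ∀ g : T.Space, G m g = eX x g) ∧
      (∀ y : Y, ∃ m : WeakDual ℂ S.Space, (∀ h : S.Space, m h = conj (eY y (star h))) ∧
        ∀ g : T.Space, G m g = g y))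

/-! ### Even functions on the sphere -/

/-- The unit sphere `S^n` in `ℝ^(n+1)`. -/
abbrev Sph (n : ℕ) : Type := Metric.sphere (0 : EuclideanSpace ℝ (Fin (n + 1))) 1

/-- The rotation invariant surface measure of `S^n`. -/
def sphereMeasure (n : ℕ) : Measure (Sph n) :=
  (volume : Measure (EuclideanSpace ℝ (Fin (n + 1)))).toSphere

/-- The extension of a function on `S^n` to `ℝ^(n+1) ∖ {0}` that is constant on open rays from
the origin. -/
def radialExt {n : ℕ} (f : Sph n → ℂ) (x : EuclideanSpace ℝ (Fin (n + 1))) : ℂ :=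
  open Classical in
  if h : x ≠ 0 then f ⟨‖x‖⁻¹ • x, by simp [norm_smul, h]⟩ else 0

/-- The algebra of smooth even functions on `S^n`. -/
def evenSmooth (n : ℕ) : NonUnitalStarSubalgebra ℂ C(Sph n, ℂ) where
  carrier := {f | ContMDiff (𝓡 n) 𝓘(ℝ, ℂ) ∞ (f : Sph n → ℂ) ∧ ∀ w, f (-w) = f w}
  zero_mem' := ⟨contMDiff_const, fun _ => rfl⟩
  add_mem' {f g} hf hg := ⟨hf.1.add hg.1, fun w => by simp [hf.2 w, hg.2 w]⟩
  mul_mem' {f g} hf hg := ⟨(contDiff_mul (𝕜 := ℝ) (𝔸 := ℂ)).contMDiff.comp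
    (hf.1.prodMk_space hg.1), fun w => by simp [hf.2 w, hg.2 w]⟩
  smul_mem' c {f} hf := ⟨((contDiff_const (𝕜 := ℝ) (c := c)).mul contDiff_id).contMDiff.comp hf.1,
    fun w => by simp [hf.2 w]⟩
  star_mem' {f} hf := ⟨Complex.conjCLE.contDiff.contMDiff.comp hf.1,
    fun w => by simp [hf.2 w]⟩

/-- The smooth even functions on `S^n` with the `C^∞` topology: uniform convergence on the sphere
of all the derivatives (of the radial extensions). -/
def evenTest (n : ℕ) : TestAlgebra (Sph n) where
  carrier := evenSmooth n
  top := ⨅ k : ℕ, TopologicalSpace.induced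
    (fun f : evenSmooth n => UniformFun.ofFun
      (fun w : Sph n => iteratedFDeriv ℝ k (radialExt (f : C(Sph n, ℂ))) (w : _)))
    inferInstance

/-- The square integrable even functions on `S^n`. -/
def evenL2 (n : ℕ) (μ : Measure (Sph n)) : Submodule ℂ (Lp ℂ 2 μ) where
  carrier := {u | ∃ g : Sph n → ℂ, (∀ w, g (-w) = g w) ∧ (u : Sph n → ℂ) =ᵐ[μ] g}
  zero_mem' := ⟨0, fun _ => rfl, Lp.coeFn_zero ℂ 2 μ⟩
  add_mem' := by
    rintro u v ⟨g, hg, hu⟩ ⟨h, hh, hv⟩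
    exact ⟨g + h, fun w => by simp [hg w, hh w], (Lp.coeFn_add u v).trans (hu.add hv)⟩
  smul_mem' := by
    rintro c u ⟨g, hg, hu⟩
    exact ⟨c • g, fun w => by simp [hg w], (Lp.coeFn_smul c u).trans (hu.const_smul c)⟩

/-! ### The transforms -/

/-- The integrand `f w * |⟨ξ, w⟩| ^ z / Γ((z + 1) / 2)`. -/
def sphereIntegrand {n : ℕ} (f : Sph n → ℂ) (ξ : Sph n) (z : ℂ) (w : Sph n) : ℂ :=
  f w * (((|⟪(ξ : EuclideanSpace ℝ (Fin (n + 1))), w⟫| : ℝ) : ℂ) ^ z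
    / Complex.Gamma ((z + 1) / 2))

/-- `Φ` is the analytic continuation to the whole plane of the function
`z ↦ ∫ f w * |⟨ξ, w⟩| ^ z / Γ((z + 1) / 2) dμ(w)`, `Re z > -1`.  There is at most one. -/
def IsSphereContinuation {n : ℕ} (μ : Measure (Sph n)) (f : Sph n → ℂ) (ξ : Sph n)
    (Φ : ℂ → ℂ) : Prop :=
  Differentiable ℂ Φ ∧ ∀ z : ℂ, -1 < z.re → Φ z = ∫ w, sphereIntegrand f ξ z w ∂μ

/-- The sphere transform `(J_z f)(ξ)`: the value at `z` of the analytic continuation. -/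
def sphereTransform {n : ℕ} (μ : Measure (Sph n)) (z : ℂ) (f : Sph n → ℂ) (ξ : Sph n) : ℂ :=
  open Classical in
  if h : ∃ Φ : ℂ → ℂ, IsSphereContinuation μ f ξ Φ then h.choose z else 0

/-- `φ` is the smooth density on `(-1, 1)` of the image of `f μ` under `w ↦ ⟨ξ, w⟩`, i.e.
`φ t` is the integral of `f` over the slice `⟨ξ, w⟩ = t`.  It is unique on `(-1, 1)` if it exists. -/
def IsSliceDensity {n : ℕ} (μ : Measure (Sph n)) (f : Sph n → ℂ) (ξ : Sph n)
    (φ : ℝ → ℂ) : Prop :=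
  ContDiffOn ℝ ∞ φ (Ioo (-1) 1) ∧
  ∀ g : ℝ → ℂ, Continuous g → HasCompactSupport g → tsupport g ⊆ Ioo (-1) 1 →
    ∫ w : Sph n, f w * g ⟪(ξ : EuclideanSpace ℝ (Fin (n + 1))), w⟫ ∂μ = ∫ t, φ t * g t

/-- The transform `∫ f w * δ^(m)(⟨ξ, w⟩) dμ(w)` with the kernel `δ^(m)`, the `m`-th derivative
of the delta function on the line: it is the value `(-1)^m φ^(m)(0)` of `δ^(m)` on the slice
density `φ`. -/
def deltaTransform {n : ℕ} (μ : Measure (Sph n)) (m : ℕ) (f : Sph n → ℂ) (ξ : Sph n) : ℂ :=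
  open Classical in
  if h : ∃ φ : ℝ → ℂ, IsSliceDensity μ f ξ φ then (-1) ^ m * iteratedDeriv m h.choose 0 else 0

/-- The transform `f ↦ J f` of even functions on `S^n` whose kernel is symmetric in its two
arguments is a GFT with respect to the measure `μ`. -/
def IsSphereGFT (n : ℕ) (μ : Measure (Sph n)) (J : (Sph n → ℂ) → Sph n → ℂ) : Prop :=
  IsGFT μ μ (evenL2 n μ) (evenL2 n μ) (evenTest n) (evenTest n)
    (fun ξ f => J f ξ) (fun w g => J g w)

end

/-! Put N = n + 1. Extend an even function f on the sphere to a homogeneous function of degree -s,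
take its Fourier transform, which is homogeneous of degree s - N, and restrict that to the sphere.
This gives an operator H_s, called `homFourier`. For 0 < Re s < N it has three properties. (a) H_s
is symmetric for the bilinear pairing ∫ f g (`integral_homFourier_mul`). (b) H_{N-s} H_s = 1,
because the Fourier transform squares to the identity on even functions (`homFourier_homFourier`).
(c) conj (H_s f) = H_{conj s} (conj f) (`star_homFourier`). On the line Re s = N / 2 one has conj s
= N - s, so conjugation turns H_s into its inverse. Together with symmetry this gives the Plancherel
and inversion formulas. The extension to generalized functions is the transpose of H_s
(`isSphereGFT_of_eq`).

Distributions are avoided. With R_s ψ(x) = ∫ r^(s-1) ψ(r x) dr over r > 0, every test function f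
equals R_s ψ on the sphere for a Schwartz function ψ supported in an annulus, and H_s f is R_{N-s}
of the Fourier transform of ψ. The identity behind (a) and (b) is
`SchwartzMap.integral_rayMellin_fourier`, a Parseval formula on the sphere.

The link with J_z is that |⟨ξ,x⟩|^z is, up to Gamma factors, the Fourier transform of the density
|v|^(-z-1) on the line ℝξ. Hence J_z = c γ(z) H_{N+z} with γ = `transformFactor`. This is proved for
real z in (-1, 0) by means of Gaussians (`strip_identity`) and continued to Re z < 0
(`continuation_eq_homFourier`). For Re z = -N / 2 the parameter s = N + z lies on the critical line
and γ(z) ≠ 0, so a suitable c > 0 gives c γ(z) modulus 1.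

The continuation itself comes from slices. The image of f dω under ⟨ξ,·⟩ has a density φ that is
smooth on (-1, 1), and J_z f(ξ) = ∫ φ(t) |t|^z dt / Γ((z+1)/2). Taylor expansion of φ at 0 produces
simple poles at z = -1, -3, ..., which the zeros of 1/Γ cancel; at z = -2k - 1 only φ^(2k)(0)
survives. If n = 4k + 1, this point is -(n+1)/2, and the transform is both local and a GFT. -/

set_option linter.unusedSectionVars false

/-! ### Polar coordinates. -/

section Polar

variable {E : Type*} [NormedAddCommGroup E] [NormedSpace ℝ E] [FiniteDimensional ℝ E]
  [MeasurableSpace E] [BorelSpace E] [Nontrivial E]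

/-- The measure `r ^ m dr` on `(0, ∞)`. -/
noncomputable def radialMeasure (m : ℕ) : Measure ℝ :=
  (volume.restrict (Ioi 0)).withDensity fun r => ENNReal.ofReal (r ^ m)

theorem map_volumeIoiPow (m : ℕ) :
    (Measure.volumeIoiPow m).map ((↑) : Ioi (0 : ℝ) → ℝ) = radialMeasure m := by
  ext s hs
  rw [radialMeasure, Measure.map_apply measurable_subtype_coe hs, withDensity_apply _ hs,
    Measure.volumeIoiPow, withDensity_apply _ (measurable_subtype_coe hs),
    Measure.restrict_restrict hs]
  rw [setLIntegral_subtype measurableSet_Ioi _ (fun a : ℝ => ENNReal.ofReal (a ^ m))]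
  congr 2
  ext x
  simp [and_comm]

instance (m : ℕ) : SFinite (radialMeasure m) := by
  rw [radialMeasure]; infer_instance

/-- The origin is a null set, so the homeomorphism of its complement with sphere × (0, ∞) suffices.
The radial factor is moved from the subtype to a measure on ℝ, where ordinary Fubini statements
apply. -/
theorem measurePreserving_polar (μ : Measure E) [μ.IsAddHaarMeasure] :
    MeasurePreserving (fun p : Metric.sphere (0 : E) 1 × ℝ => p.2 • (p.1 : E))
      (μ.toSphere.prod (radialMeasure (Module.finrank ℝ E - 1))) μ := by
  have h1 := (μ.measurePreserving_homeomorphUnitSphereProd).symm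
    (homeomorphUnitSphereProd E).toMeasurableEquiv
  have h2 : MeasurePreserving ((↑) : ({0}ᶜ : Set E) → E) (μ.comap (↑)) μ := by
    have := MeasurePreserving.mk (μa := μ.comap ((↑) : ({0}ᶜ : Set E) → E))
      (measurable_subtype_coe) (map_comap_subtype_coe (measurableSet_singleton (0 : E)).compl μ)
    rwa [restrict_compl_singleton] at this
  have h3 := h2.comp h1
  have h4 : MeasurePreserving (Prod.map id ((↑) : Ioi (0 : ℝ) → ℝ))
      (μ.toSphere.prod (Measure.volumeIoiPow (Module.finrank ℝ E - 1)))
      (μ.toSphere.prod (radialMeasure (Module.finrank ℝ E - 1))) :=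
    (MeasurePreserving.id _).prod ⟨measurable_subtype_coe, map_volumeIoiPow _⟩
  refine ⟨by fun_prop, ?_⟩
  rw [← h4.map_eq, Measure.map_map (by fun_prop) h4.measurable]
  convert h3.map_eq using 2
  ext p
  exact (homeomorphUnitSphereProd_symm_apply_coe E p).symm

theorem lintegral_radialMeasure (m : ℕ) {f : ℝ → ENNReal} (hf : Measurable f) :
    ∫⁻ r, f r ∂(radialMeasure m) = ∫⁻ r in Ioi 0, ENNReal.ofReal (r ^ m) * f r := by
  rw [radialMeasure, lintegral_withDensity_eq_lintegral_mul _ (by fun_prop) hf]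
  rfl

theorem integral_radialMeasure {F : Type*} [NormedAddCommGroup F] [NormedSpace ℝ F]
    (m : ℕ) (f : ℝ → F) :
    ∫ r, f r ∂(radialMeasure m) = ∫ r in Ioi 0, r ^ m • f r := by
  rw [radialMeasure, integral_withDensity_eq_integral_toReal_smul (by fun_prop)
    (Eventually.of_forall fun _ => ENNReal.ofReal_lt_top)]
  refine setIntegral_congr_fun measurableSet_Ioi fun r hr => ?_
  rw [ENNReal.toReal_ofReal (pow_nonneg (le_of_lt hr) _)]

theorem integrable_radialMeasure {F : Type*} [NormedAddCommGroup F] [NormedSpace ℝ F]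
    (m : ℕ) {f : ℝ → F} :
    Integrable f (radialMeasure m) ↔ IntegrableOn (fun r => r ^ m • f r) (Ioi 0) := by
  rw [radialMeasure, integrable_withDensity_iff_integrable_smul' (by fun_prop)
    (Eventually.of_forall fun _ => ENNReal.ofReal_lt_top), IntegrableOn]
  refine integrable_congr ?_
  filter_upwards [ae_restrict_mem measurableSet_Ioi] with r hr
  rw [ENNReal.toReal_ofReal (pow_nonneg (le_of_lt hr) _)]

theorem lintegral_polar (μ : Measure E) [μ.IsAddHaarMeasure] {f : E → ENNReal}
    (hf : Measurable f) :
    ∫⁻ x, f x ∂μ = ∫⁻ w, (∫⁻ r in Ioi (0 : ℝ),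
      ENNReal.ofReal (r ^ (Module.finrank ℝ E - 1)) * f (r • (w : E))) ∂μ.toSphere := by
  rw [← (measurePreserving_polar μ).lintegral_comp hf, lintegral_prod _ (by fun_prop)]
  refine lintegral_congr fun w => ?_
  exact lintegral_radialMeasure _ (f := fun r => f (r • (w : E))) (by fun_prop)

theorem integral_polar {F : Type*} [NormedAddCommGroup F] [NormedSpace ℝ F] (μ : Measure E)
    [μ.IsAddHaarMeasure] {f : E → F} (hf : Integrable f μ) :
    ∫ x, f x ∂μ =
      ∫ w, (∫ r in Ioi (0 : ℝ), r ^ (Module.finrank ℝ E - 1) • f (r • (w : E))) ∂μ.toSphere := by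
  have h := measurePreserving_polar μ
  have hf' : Integrable (fun p : Metric.sphere (0 : E) 1 × ℝ => f (p.2 • (p.1 : E)))
      (μ.toSphere.prod (radialMeasure (Module.finrank ℝ E - 1))) :=
    h.integrable_comp_of_integrable hf
  have : ∫ x, f x ∂μ = ∫ p : Metric.sphere (0 : E) 1 × ℝ, f (p.2 • (p.1 : E))
      ∂(μ.toSphere.prod (radialMeasure (Module.finrank ℝ E - 1))) := by
    conv_lhs => rw [← h.map_eq]
    exact integral_map h.aemeasurable (by rw [h.map_eq]; exact hf.1)
  rw [this, integral_prod _ hf']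
  exact integral_congr_ae (Eventually.of_forall fun w => integral_radialMeasure _ _)

end Polar

/-! ### Mellin transforms of Schwartz functions along rays. -/

section RayMellin
open SchwartzMap

universe u

variable {E : Type u} [NormedAddCommGroup E] [NormedSpace ℝ E]
  {V : Type*} [NormedAddCommGroup V] [NormedSpace ℂ V]
  [NormedSpace ℝ V]

/-- The Mellin transform of `g` along the open rays from the origin. -/
noncomputable def rayMellin (s : ℂ) (g : E → V) (x : E) : V :=
  ∫ r : ℝ in Ioi 0, (r : ℂ) ^ (s - 1) • g (r • x)

theorem rayMellin_eq_mellin (s : ℂ) (g : E → ℂ) (x : E) :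
    rayMellin s g x = mellin (fun r : ℝ => g (r • x)) s := rfl

/-- Homogeneity of degree -s: this is what makes `rayMellin s g` a homogeneous extension of its
values on the sphere. -/
theorem rayMellin_smul (s : ℂ) (g : E → ℂ) {a : ℝ} (ha : 0 < a) (x : E) :
    rayMellin s g (a • x) = (a : ℂ) ^ (-s) * rayMellin s g x := by
  rw [rayMellin_eq_mellin, rayMellin_eq_mellin, ← smul_eq_mul, ← mellin_comp_mul_right _ _ ha]
  simp only [smul_smul]

theorem integrableOn_rpow_mul_inv_one_add_pow {σ δ : ℝ} {K : ℕ} (hσ : 0 < σ) (hK : σ < K)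
    (hδ : 0 < δ) :
    IntegrableOn (fun r : ℝ => r ^ (σ - 1) * ((1 + δ * r) ^ K)⁻¹) (Ioi 0) := by
  have hpos : ∀ r : ℝ, 0 < r → 0 < 1 + δ * r := fun r hr => by positivity
  refine mellin_convergent_of_isBigO_scalar (a := K) (b := 0) ?_ ?_ hK ?_ hσ
  · refine ContinuousOn.locallyIntegrableOn ?_ measurableSet_Ioi
    exact ContinuousOn.inv₀ (by fun_prop) fun r hr => (pow_pos (hpos r hr) K).ne'
  · refine Asymptotics.IsBigO.of_bound ((δ ^ K)⁻¹) ?_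
    filter_upwards [eventually_gt_atTop 0] with r hr
    rw [Real.norm_of_nonneg (by positivity), Real.norm_of_nonneg (by positivity),
      Real.rpow_neg hr.le, Real.rpow_natCast, ← mul_inv, ← mul_pow]
    gcongr
    linarith
  · refine Asymptotics.IsBigO.of_bound 1 ?_
    filter_upwards [self_mem_nhdsWithin] with r hr
    have hr' : (0 : ℝ) < r := hr
    rw [Real.norm_of_nonneg (by positivity)]
    simp only [neg_zero, Real.rpow_zero, norm_one, mul_one]
    exact inv_le_one_of_one_le₀ (one_le_pow₀ (by nlinarith))

theorem SchwartzMap.norm_le_inv_one_add_pow (K : ℕ) (g : 𝓢(E, V)) (x : E) :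
    ‖g x‖ ≤ (2 ^ K * (Finset.Iic (K, 0)).sup (fun m => SchwartzMap.seminorm ℝ m.1 m.2) g) *
      ((1 + ‖x‖) ^ K)⁻¹ := by
  have := one_add_le_sup_seminorm_apply (𝕜 := ℝ) (m := (K, 0)) le_rfl le_rfl g x
  rw [← div_eq_mul_inv, le_div_iff₀ (by positivity), mul_comm]
  simpa using this

theorem SchwartzMap.isBigO_ray_atTop (g : 𝓢(E, V)) {x : E} (hx : x ≠ 0) (a : ℝ) :
    (fun r : ℝ => g (r • x)) =O[atTop] (· ^ (-a)) := by
  obtain ⟨K, hK⟩ := exists_nat_ge a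
  refine Asymptotics.IsBigO.of_bound
    ((2 ^ K * (Finset.Iic (K, 0)).sup (fun m => SchwartzMap.seminorm ℝ m.1 m.2) g) *
      (‖x‖ ^ K)⁻¹) ?_
  filter_upwards [eventually_ge_atTop 1] with r hr
  refine (norm_le_inv_one_add_pow K g _).trans ?_
  have hr0 : 0 < r := by linarith
  have hx0 : 0 < ‖x‖ := norm_pos_iff.2 hx
  rw [mul_assoc _ (‖x‖ ^ K)⁻¹]
  refine mul_le_mul_of_nonneg_left ?_ (mul_nonneg
    (pow_nonneg two_pos.le K) (apply_nonneg ((Finset.Iic (K, 0)).sup (fun m => SchwartzMap.seminorm ℝ m.1 m.2)) g))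
  rw [Real.norm_of_nonneg (by positivity)]
  calc ((1 + ‖r • x‖) ^ K)⁻¹ ≤ ((r * ‖x‖) ^ K)⁻¹ := by
        gcongr
        rw [norm_smul, Real.norm_of_nonneg hr0.le]
        linarith
    _ = (‖x‖ ^ K)⁻¹ * r ^ (-(K : ℝ)) := by
        rw [mul_pow, mul_inv, mul_comm, Real.rpow_neg hr0.le, Real.rpow_natCast]
    _ ≤ _ := by
        gcongr

theorem SchwartzMap.isBigO_ray_zero (g : 𝓢(E, V)) (x : E) :
    (fun r : ℝ => g (r • x)) =O[𝓝[>] 0] (· ^ (-(0 : ℝ))) := by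
  simp only [neg_zero, Real.rpow_zero]
  refine ((Continuous.tendsto ?_ 0).isBigO_one ℝ).mono nhdsWithin_le_nhds
  have := g.continuous
  fun_prop

theorem SchwartzMap.locallyIntegrableOn_ray (g : 𝓢(E, V)) (x : E) :
    LocallyIntegrableOn (fun r : ℝ => g (r • x)) (Ioi 0) := by
  have := g.continuous
  exact (by fun_prop : Continuous fun r : ℝ => g (r • x)).locallyIntegrable.locallyIntegrableOn _

theorem SchwartzMap.mellinConvergent_ray (g : 𝓢(E, V)) {x : E} (hx : x ≠ 0) {s : ℂ}
    (hs : 0 < s.re) : MellinConvergent (fun r : ℝ => g (r • x)) s :=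
  mellinConvergent_of_isBigO_rpow (g.locallyIntegrableOn_ray x)
    (g.isBigO_ray_atTop hx (s.re + 1)) (by linarith) (g.isBigO_ray_zero x) hs

theorem SchwartzMap.differentiableAt_rayMellin (g : 𝓢(E, ℂ)) {x : E} (hx : x ≠ 0) {s : ℂ}
    (hs : 0 < s.re) : DifferentiableAt ℂ (fun s => rayMellin s g x) s :=
  mellin_differentiableAt_of_isBigO_rpow (g.locallyIntegrableOn_ray x)
    (g.isBigO_ray_atTop hx (s.re + 1)) (by linarith) (g.isBigO_ray_zero x) hs

theorem SchwartzMap.rayMellin_add (g h : 𝓢(E, V)) {x : E} (hx : x ≠ 0) {s : ℂ}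
    (hs : 0 < s.re) : rayMellin s (g + h) x = rayMellin s g x + rayMellin s h x := by
  have h1 := g.mellinConvergent_ray hx hs
  have h2 := h.mellinConvergent_ray hx hs
  rw [rayMellin, rayMellin, rayMellin, ← integral_add h1 h2]
  exact integral_congr_ae (Eventually.of_forall fun r => smul_add _ _ _)

theorem SchwartzMap.norm_rayMellin_le (K : ℕ) {s : ℂ} (hs : 0 < s.re) (hK : s.re < K)
    (g : 𝓢(E, V)) {x : E} (hx : ‖x‖ = 1) :
    ‖rayMellin s g x‖ ≤ (2 ^ K * ∫ r : ℝ in Ioi 0, r ^ (s.re - 1) * ((1 + 1 * r) ^ K)⁻¹) *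
      (Finset.Iic (K, 0)).sup (fun m => SchwartzMap.seminorm ℝ m.1 m.2) g := by
  rw [mul_right_comm, ← integral_const_mul]
  refine norm_integral_le_of_norm_le
    ((integrableOn_rpow_mul_inv_one_add_pow hs hK one_pos).const_mul _) ?_
  filter_upwards [ae_restrict_mem measurableSet_Ioi] with r hr
  have hr' : (0 : ℝ) < r := hr
  rw [norm_smul, Complex.norm_cpow_eq_rpow_re_of_pos hr', Complex.sub_re, Complex.one_re,
    mul_left_comm]
  gcongr
  refine (norm_le_inv_one_add_pow K g _).trans (le_of_eq ?_)
  rw [norm_smul, hx, Real.norm_of_nonneg hr'.le, mul_one, one_mul]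

/-- Differentiating g(r x) in x produces a factor r, which raises the exponent from s to s + 1.
Derivatives are thus again ray Mellin transforms, with values in a space of linear maps; this is the
reason for a general target V. -/
theorem SchwartzMap.hasFDerivAt_rayMellin [SMulCommClass ℝ ℂ V] [IsScalarTower ℝ ℂ V]
    (g : 𝓢(E, V)) {x : E} (hx : x ≠ 0) {s : ℂ} (hs : 0 < s.re) :
    HasFDerivAt (rayMellin s g) (rayMellin (s + 1) (fderivCLM ℝ E V g) x) x := by
  have hx0 : 0 < ‖x‖ := norm_pos_iff.2 hx
  obtain ⟨K, hK⟩ := exists_nat_gt (s + 1).re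
  have hs1 : 0 < (s + 1).re := by simp; linarith
  set C := 2 ^ K * (Finset.Iic (K, 0)).sup (fun m => SchwartzMap.seminorm ℝ m.1 m.2)
    (fderivCLM ℝ E V g)
  -- The ball stays away from the origin, so the Schwartz decay along the rays through its points is
  -- uniform and gives one integrable majorant.
  have key : ∀ y ∈ Metric.ball x (‖x‖ / 2), ‖x‖ / 2 ≤ ‖y‖ := fun y hy => by
    have h1 : ‖x - y‖ < ‖x‖ / 2 := by rw [← dist_eq_norm, dist_comm]; exact hy
    have h2 := norm_sub_norm_le x y
    linarith
  have hg := g.continuous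
  have hg' := (fderivCLM ℝ E V g).continuous
  have hmeas : AEStronglyMeasurable (fun r : ℝ => (r : ℂ) ^ (s - 1)) (volume.restrict (Ioi 0)) := by
    refine (continuousOn_of_forall_continuousAt fun t ht => ?_).aestronglyMeasurable
      measurableSet_Ioi
    exact Complex.continuousAt_ofReal_cpow_const _ _ (Or.inr (ne_of_gt ht))
  have hmeas' : AEStronglyMeasurable (fun r : ℝ => (r : ℂ) ^ (s + 1 - 1))
      (volume.restrict (Ioi 0)) := by
    refine (continuousOn_of_forall_continuousAt fun t ht => ?_).aestronglyMeasurable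
      measurableSet_Ioi
    exact Complex.continuousAt_ofReal_cpow_const _ _ (Or.inr (ne_of_gt ht))
  refine hasFDerivAt_integral_of_dominated_of_fderiv_le (𝕜 := ℝ)
    (F := fun y (r : ℝ) => (r : ℂ) ^ (s - 1) • g (r • y))
    (F' := fun y (r : ℝ) => (r : ℂ) ^ (s + 1 - 1) • fderivCLM ℝ E V g (r • y))
    (bound := fun r => C * (r ^ ((s + 1).re - 1) * ((1 + (‖x‖ / 2) * r) ^ K)⁻¹))
    (s := Metric.ball x (‖x‖ / 2)) (Metric.ball_mem_nhds _ (by positivity))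
    ?_ (g.mellinConvergent_ray hx hs) ?_ ?_
    ((integrableOn_rpow_mul_inv_one_add_pow hs1 hK (by positivity)).const_mul _) ?_
  · filter_upwards with y
    exact hmeas.smul (by fun_prop : Continuous fun r : ℝ => g (r • y)).aestronglyMeasurable
  · exact hmeas'.smul
      (by fun_prop : Continuous fun r : ℝ => fderivCLM ℝ E V g (r • x)).aestronglyMeasurable
  · filter_upwards [ae_restrict_mem measurableSet_Ioi] with r hr y hy
    have hr' : (0 : ℝ) < r := hr
    rw [norm_smul, Complex.norm_cpow_eq_rpow_re_of_pos hr', Complex.sub_re, Complex.one_re,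
      mul_left_comm]
    gcongr
    refine (norm_le_inv_one_add_pow K _ _).trans ?_
    rw [norm_smul, Real.norm_of_nonneg hr'.le]
    change C * _ ≤ _
    rw [mul_comm (‖x‖ / 2)]
    gcongr
    exact key y hy
  · filter_upwards [ae_restrict_mem measurableSet_Ioi] with r hr y hy
    have hr' : (0 : ℝ) < r := hr
    have h1 : HasFDerivAt (fun y : E => g (r • y)) (r • fderiv ℝ g (r • y)) y := by
      have h3 : HasFDerivAt (fun y : E => r • y) (r • ContinuousLinearMap.id ℝ E) y :=
        (hasFDerivAt_id y).const_smul r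
      have h2 := (g.hasFDerivAt (r • y)).comp y h3
      rw [ContinuousLinearMap.comp_smul, ContinuousLinearMap.comp_id] at h2
      exact h2
    have h2 := h1.const_smul ((r : ℂ) ^ (s - 1))
    refine h2.congr_fderiv ?_
    rw [fderivCLM_apply, add_sub_cancel_right]
    have : (r : ℂ) ^ s = (r : ℂ) ^ (s - 1) * r := by
      conv_lhs => rw [← sub_add_cancel s 1,
        Complex.cpow_add _ _ (Complex.ofReal_ne_zero.2 hr'.ne'), Complex.cpow_one]
    rw [this, mul_smul, ← algebraMap_smul ℂ r (fderiv ℝ (⇑g) (r • y))]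
    rfl

/-- The target is quantified inside the induction because each derivative replaces V by `E →L[ℝ] V`;
E and V share a universe so that the new target stays in it. -/
theorem SchwartzMap.contDiffOn_rayMellin_nat (m : ℕ) :
    ∀ {V : Type u} [NormedAddCommGroup V] [NormedSpace ℂ V] [NormedSpace ℝ V]
      [SMulCommClass ℝ ℂ V] [IsScalarTower ℝ ℂ V] (g : 𝓢(E, V)) {s : ℂ}, 0 < s.re →
      ContDiffOn ℝ m (rayMellin s g) {0}ᶜ := by
  induction m with
  | zero =>
    intro V _ _ _ _ _ g s hs
    refine contDiffOn_zero.2 fun x hx => ?_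
    exact (g.hasFDerivAt_rayMellin hx hs).continuousAt.continuousWithinAt
  | succ m ih =>
    intro V _ _ _ _ _ g s hs
    push_cast
    rw [contDiffOn_succ_iff_fderiv_of_isOpen isOpen_compl_singleton]
    refine ⟨fun x hx => (g.hasFDerivAt_rayMellin hx hs).differentiableAt.differentiableWithinAt,
      by simp, ?_⟩
    refine (ih (fderivCLM ℝ E V g) (s := s + 1) (by simp; linarith)).congr fun x hx => ?_
    exact (g.hasFDerivAt_rayMellin hx hs).fderiv

theorem SchwartzMap.contDiffOn_rayMellin {V : Type u} [NormedAddCommGroup V] [NormedSpace ℂ V]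
    [NormedSpace ℝ V] [SMulCommClass ℝ ℂ V] [IsScalarTower ℝ ℂ V] (g : 𝓢(E, V)) {s : ℂ}
    (hs : 0 < s.re) : ContDiffOn ℝ ∞ (rayMellin s g) {0}ᶜ :=
  contDiffOn_infty.2 fun m => contDiffOn_rayMellin_nat m g hs

/-- The derivatives of `rayMellin s g` on the unit sphere are bounded by Schwartz seminorms. -/
theorem SchwartzMap.exists_norm_iteratedFDeriv_rayMellin_le (m : ℕ) :
    ∀ (V : Type u) [NormedAddCommGroup V] [NormedSpace ℂ V] [NormedSpace ℝ V]
      [SMulCommClass ℝ ℂ V] [IsScalarTower ℝ ℂ V] {s : ℂ}, 0 < s.re →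
      ∃ q : Seminorm ℝ 𝓢(E, V), Continuous q ∧ ∀ (g : 𝓢(E, V)) (x : E), ‖x‖ = 1 →
        ‖iteratedFDeriv ℝ m (rayMellin s g) x‖ ≤ q g := by
  induction m with
  | zero =>
    intro V _ _ _ _ _ s hs
    obtain ⟨K, hK⟩ := exists_nat_gt s.re
    have h0 : 0 ≤ (2 ^ K * ∫ r : ℝ in Ioi 0, r ^ (s.re - 1) * ((1 + 1 * r) ^ K)⁻¹) := by
      refine mul_nonneg (by positivity) (setIntegral_nonneg measurableSet_Ioi fun r hr => ?_)
      have hr' : (0 : ℝ) < r := hr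
      positivity
    refine ⟨(Real.toNNReal (2 ^ K * ∫ r : ℝ in Ioi 0, r ^ (s.re - 1) * ((1 + 1 * r) ^ K)⁻¹)) • (Finset.Iic (K, 0)).sup (schwartzSeminormFamily ℝ E V), ?_, ?_⟩
    · exact Continuous.const_smul (Seminorm.continuous_finsetSup
        fun i _ => (schwartz_withSeminorms ℝ E V).continuous_seminorm i) _
    · intro g x hx
      rw [norm_iteratedFDeriv_zero]
      rw [smul_apply, NNReal.smul_def, Real.coe_toNNReal _ h0]
      exact g.norm_rayMellin_le K hs hK hx
  | succ m ih =>
    intro V _ _ _ _ _ s hs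
    obtain ⟨q, hq, hb⟩ := ih (E →L[ℝ] V) (s := s + 1) (by simp; linarith)
    refine ⟨q.comp (fderivCLM ℝ E V).toLinearMap, hq.comp (fderivCLM ℝ E V).continuous, ?_⟩
    intro g x hx
    rw [← norm_iteratedFDeriv_fderiv]
    have hx0 : x ≠ 0 := by rintro rfl; simp at hx
    have : fderiv ℝ (rayMellin s g) =ᶠ[𝓝 x] rayMellin (s + 1) (fderivCLM ℝ E V g) := by
      filter_upwards [isOpen_compl_singleton.mem_nhds (show x ∈ ({0}ᶜ : Set E) from hx0)] with y hy
      exact (g.hasFDerivAt_rayMellin hy hs).fderiv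
    rw [(this.iteratedFDeriv ℝ m).eq_of_nhds]
    exact hb _ x hx

end RayMellin

/-! ### A Parseval formula on the sphere. -/

section Pairing
open SchwartzMap

variable {E : Type*} [NormedAddCommGroup E]

theorem integral_rpow_mul_inv_one_add_mul_pow {σ δ : ℝ} (K : ℕ) (hδ : 0 < δ) :
    ∫ r : ℝ in Ioi 0, r ^ (σ - 1) * ((1 + δ * r) ^ K)⁻¹ =
      δ ^ (-σ) * ∫ r : ℝ in Ioi 0, r ^ (σ - 1) * ((1 + 1 * r) ^ K)⁻¹ := by
  have h := integral_comp_mul_left_Ioi (fun r : ℝ => r ^ (σ - 1) * ((1 + 1 * r) ^ K)⁻¹) 0 hδ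
  rw [mul_zero, smul_eq_mul, eq_inv_mul_iff_mul_eq₀ hδ.ne'] at h
  rw [← h, ← integral_const_mul, ← integral_const_mul]
  refine setIntegral_congr_fun measurableSet_Ioi fun r hr => ?_
  have hr' : (0 : ℝ) < r := hr
  rw [Real.mul_rpow hδ.le hr'.le, one_mul, Real.rpow_sub_one hδ.ne', Real.rpow_neg hδ.le]
  have : δ ^ σ ≠ 0 := (Real.rpow_pos_of_pos hδ σ).ne'
  field_simp

theorem measurable_ofReal_cpow (s : ℂ) : Measurable fun r : ℝ => (r : ℂ) ^ s :=
  Complex.measurable_ofReal.pow_const s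

section NormedSpace
variable [NormedSpace ℝ E]

/-- The Schwartz majorant (1 + r‖x‖)^(-K) rescales in r to an exact power of ‖x‖. The bound supplies
the domination for the interchanges of a Mellin transform with an integral, here and on the line ℝξ.
-/
theorem SchwartzMap.exists_integral_norm_ray_le (ψ : 𝓢(E, ℂ)) {s : ℂ} (hs : 0 < s.re) :
    ∃ D, 0 ≤ D ∧ ∀ x : E, x ≠ 0 →
      ∫ r : ℝ in Ioi 0, ‖(r : ℂ) ^ (s - 1) * ψ (r • x)‖ ≤ D * ‖x‖ ^ (-s.re) := by
  obtain ⟨K, hK⟩ := exists_nat_gt s.re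
  set C := 2 ^ K * (Finset.Iic (K, 0)).sup (fun m => SchwartzMap.seminorm ℝ m.1 m.2) ψ with hC
  have hC0 : 0 ≤ C := mul_nonneg (pow_nonneg two_pos.le K)
    (apply_nonneg ((Finset.Iic (K, 0)).sup (fun m => SchwartzMap.seminorm ℝ m.1 m.2)) ψ)
  refine ⟨C * ∫ r : ℝ in Ioi 0, r ^ (s.re - 1) * ((1 + 1 * r) ^ K)⁻¹, ?_, fun x hx => ?_⟩
  · refine mul_nonneg hC0 (setIntegral_nonneg measurableSet_Ioi fun r hr => ?_)
    have hr' : (0 : ℝ) < r := hr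
    positivity
  · have hx0 : 0 < ‖x‖ := norm_pos_iff.2 hx
    rw [mul_assoc, mul_comm _ (‖x‖ ^ (-s.re)), ← integral_rpow_mul_inv_one_add_mul_pow K hx0,
      ← integral_const_mul]
    refine integral_mono_ae (ψ.mellinConvergent_ray hx hs).norm
      ((integrableOn_rpow_mul_inv_one_add_pow hs hK hx0).const_mul _) ?_
    filter_upwards [ae_restrict_mem measurableSet_Ioi] with r hr
    have hr' : (0 : ℝ) < r := hr
    rw [norm_mul, Complex.norm_cpow_eq_rpow_re_of_pos hr', Complex.sub_re, Complex.one_re,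
      mul_left_comm]
    gcongr
    refine (norm_le_inv_one_add_pow K _ _).trans ?_
    rw [norm_smul, Real.norm_of_nonneg hr'.le, ← hC, mul_comm r]

end NormedSpace

variable [InnerProductSpace ℝ E] [FiniteDimensional ℝ E] [MeasurableSpace E] [BorelSpace E]
  [Nontrivial E]

theorem SchwartzMap.integrable_norm_rpow_mul (κ : 𝓢(E, ℂ)) {σ : ℝ}
    (hσ : σ < Module.finrank ℝ E) :
    Integrable (fun x => ‖x‖ ^ (-σ) * ‖κ x‖) := by
  have hN : 0 < Module.finrank ℝ E := Module.finrank_pos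
  obtain ⟨K, hK⟩ := exists_nat_gt (Module.finrank ℝ E - σ)
  set C := 2 ^ K * (Finset.Iic (K, 0)).sup (fun m => SchwartzMap.seminorm ℝ m.1 m.2) κ
  have h1 : Integrable (fun x : E => ‖x‖ ^ (-σ) * ((1 + 1 * ‖x‖) ^ K)⁻¹) := by
    rw [integrable_fun_norm_addHaar volume (f := fun y => y ^ (-σ) * ((1 + 1 * y) ^ K)⁻¹)]
    refine (integrableOn_rpow_mul_inv_one_add_pow (sub_pos.2 hσ) hK one_pos).congr_fun ?_
      measurableSet_Ioi
    intro r hr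
    have hr' : (0 : ℝ) < r := hr
    simp only [smul_eq_mul]
    rw [← mul_assoc, ← Real.rpow_natCast r (_ - 1), ← Real.rpow_add hr', Nat.cast_sub hN]
    congr 2
    push_cast; ring
  refine (h1.const_mul C).mono' ?_ (Eventually.of_forall fun x => ?_)
  · have := κ.continuous
    exact (Measurable.mul (by fun_prop) (by fun_prop)).aestronglyMeasurable
  · rw [Real.norm_of_nonneg (by positivity), mul_left_comm]
    gcongr
    simpa only [one_mul] using norm_le_inv_one_add_pow K κ x

/-- Convergence along each ray needs Re s > 0; after integration in r there remains ‖x‖^(-Re s) ‖κ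
x‖, which is integrable at the origin because Re s is less than the dimension. -/
theorem SchwartzMap.integrable_mellin_prod (ψ κ : 𝓢(E, ℂ)) {s : ℂ} (hs : 0 < s.re)
    (hs' : s.re < Module.finrank ℝ E) :
    Integrable (fun p : ℝ × E => (p.1 : ℂ) ^ (s - 1) * (ψ (p.1 • p.2) * κ p.2))
      ((volume.restrict (Ioi 0)).prod volume) := by
  have hψ := ψ.continuous
  have hκ := κ.continuous
  have hm : Measurable (fun p : ℝ × E => (p.1 : ℂ) ^ (s - 1) * (ψ (p.1 • p.2) * κ p.2)) :=
    ((measurable_ofReal_cpow (s - 1)).comp measurable_fst).mul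
      (by fun_prop : Continuous fun p : ℝ × E => ψ (p.1 • p.2) * κ p.2).measurable
  obtain ⟨D, hD, hb⟩ := ψ.exists_integral_norm_ray_le hs
  have hne : ∀ᵐ x : E, x ≠ 0 := by simp [ae_iff]
  rw [integrable_prod_iff' hm.aestronglyMeasurable]
  refine ⟨?_, ?_⟩
  · filter_upwards [hne] with x hx
    simpa only [smul_eq_mul, mul_assoc] using (ψ.mellinConvergent_ray hx hs).mul_const (κ x)
  · refine ((κ.integrable_norm_rpow_mul hs').const_mul D).mono' ?_ ?_
    · exact (hm.norm.aestronglyMeasurable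
        (μ := (volume.restrict (Ioi 0)).prod volume)).prod_swap.integral_prod_right'
    · filter_upwards [hne] with x hx
      rw [Real.norm_of_nonneg (by positivity)]
      simp only [← mul_assoc, norm_mul _ (κ x)]
      rw [integral_mul_const]
      exact mul_le_mul_of_nonneg_right (hb x hx) (norm_nonneg _)

/-- Both sides equal ∫ R_s ψ(x) κ(x) dx over the whole space: the right side by Fubini, the left
side by polar coordinates, where the homogeneity of R_s ψ leaves the exponent N - s for κ. -/
theorem SchwartzMap.integral_rayMellin_mul_rayMellin (ψ κ : 𝓢(E, ℂ)) {s : ℂ} (hs : 0 < s.re)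
    (hs' : s.re < Module.finrank ℝ E) :
    ∫ w : Metric.sphere (0 : E) 1, rayMellin s ψ w * rayMellin (Module.finrank ℝ E - s) κ w
      ∂(volume : Measure E).toSphere = mellin (fun p : ℝ => ∫ x, ψ (p • x) * κ x) s := by
  have hN : 0 < Module.finrank ℝ E := Module.finrank_pos
  have h := ψ.integrable_mellin_prod κ hs hs'
  have h1 : mellin (fun p : ℝ => ∫ x, ψ (p • x) * κ x) s = ∫ x, rayMellin s ψ x * κ x := by
    simp only [mellin, smul_eq_mul, ← integral_const_mul]
    rw [integral_integral_swap h]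
    refine integral_congr_ae (Eventually.of_forall fun x => ?_)
    simp only [rayMellin, ← mul_assoc, integral_mul_const, smul_eq_mul]
  have h2 : Integrable (fun x => rayMellin s ψ x * κ x) := by
    refine h.swap.integral_prod_left.congr (Eventually.of_forall fun x => ?_)
    simp only [rayMellin, ← mul_assoc, integral_mul_const, smul_eq_mul, Function.comp_apply,
      Prod.swap]
  rw [h1, integral_polar _ h2]
  refine integral_congr_ae (Eventually.of_forall fun w => ?_)
  simp only
  rw [rayMellin.eq_def (Module.finrank ℝ E - s), ← integral_const_mul]
  refine setIntegral_congr_fun measurableSet_Ioi fun r hr => ?_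
  have hr' : (0 : ℝ) < r := hr
  rw [rayMellin_smul s ψ hr', Complex.real_smul, smul_eq_mul]
  have : (r : ℂ) ^ ((Module.finrank ℝ E : ℂ) - s - 1) =
      ((r ^ (Module.finrank ℝ E - 1) : ℝ) : ℂ) * (r : ℂ) ^ (-s) := by
    rw [Complex.ofReal_pow, ← Complex.cpow_natCast,
      ← Complex.cpow_add _ _ (Complex.ofReal_ne_zero.2 hr'.ne'), Nat.cast_sub hN]
    congr 1
    push_cast; ring
  rw [this]
  ring

/-- The Fourier transform is symmetric under ∫ ψ κ and turns dilation by p into dilation by 1/p with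
the factor p^(-N). -/
theorem SchwartzMap.integral_smul_mul_fourier (ψ κ : 𝓢(E, ℂ)) {p : ℝ} (hp : 0 < p) :
    ∫ x, ψ (p • x) * (FourierTransform.fourier κ) x = ((p : ℂ) ^ (-(Module.finrank ℝ E : ℂ))) *
      ∫ x, (FourierTransform.fourier ψ) (p⁻¹ • x) * κ x := by
  set L : E ≃L[ℝ] E := ContinuousLinearEquiv.smulLeft (Units.mk0 p hp.ne')
  have hL : ∀ x, L x = p • x := fun x => rfl
  set ψp : 𝓢(E, ℂ) := compCLMOfContinuousLinearEquiv ℂ L ψ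
  have hψp : ∀ x, ψp x = ψ (p • x) := fun x => rfl
  have h1 : ∫ x, ψ (p • x) * (FourierTransform.fourier κ) x
      = ∫ x, (FourierTransform.fourier ψp) x * κ x :=
    (integral_fourier_mul_eq ψp κ).symm
  rw [h1, ← integral_const_mul]
  refine integral_congr_ae (Eventually.of_forall fun w => ?_)
  simp only
  rw [← mul_assoc]
  congr 1
  rw [fourier_coe, fourier_coe, Real.fourier_eq', Real.fourier_eq']
  have := Measure.integral_comp_smul_of_nonneg (volume : Measure E)
    (fun v => Complex.exp (((-2 * Real.pi * inner ℝ v (p⁻¹ • w) : ℝ) : ℂ) * Complex.I) • ψ v) p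
    (hR := hp.le)
  rw [Complex.real_smul] at this
  rw [Complex.cpow_neg, Complex.cpow_natCast, ← Complex.ofReal_pow, ← Complex.ofReal_inv, ← this]
  refine integral_congr_ae (Eventually.of_forall fun v => ?_)
  simp only [hψp]
  rw [inner_smul_left, inner_smul_right]
  simp only [RCLike.conj_to_real]
  rw [mul_inv_cancel_left₀ hp.ne']

/-- By the two preceding lemmas both sides are Mellin transforms of functions of p related by p ↦
1/p and the factor p^(-N), and this exchanges the exponents s and N - s. It is the symmetry of the
Fourier transform on homogeneous functions, without distributions. -/
theorem SchwartzMap.integral_rayMellin_fourier (ψ κ : 𝓢(E, ℂ)) {s : ℂ} (hs : 0 < s.re)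
    (hs' : s.re < Module.finrank ℝ E) :
    ∫ w : Metric.sphere (0 : E) 1, rayMellin s ψ w *
      rayMellin (Module.finrank ℝ E - s) (FourierTransform.fourier κ) w
      ∂(volume : Measure E).toSphere =
    ∫ w : Metric.sphere (0 : E) 1, rayMellin (Module.finrank ℝ E - s)
      (FourierTransform.fourier ψ) w * rayMellin s κ w ∂(volume : Measure E).toSphere := by
  have h1 := ψ.integral_rayMellin_mul_rayMellin (FourierTransform.fourier κ) hs hs'
  have h2 := (FourierTransform.fourier ψ).integral_rayMellin_mul_rayMellin κ
    (s := Module.finrank ℝ E - s) (by simpa using hs') (by simpa using hs)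
  rw [sub_sub_cancel] at h2
  rw [h1, h2]
  set Q : ℝ → ℂ := fun p => ∫ x, (FourierTransform.fourier ψ) (p • x) * κ x
  have h3 : mellin (fun p : ℝ => ∫ x, ψ (p • x) * (FourierTransform.fourier κ) x) s =
      mellin (fun p : ℝ => (p : ℂ) ^ (-(Module.finrank ℝ E : ℂ)) • Q p⁻¹) s := by
    refine setIntegral_congr_fun measurableSet_Ioi fun p hp => ?_
    simp only
    rw [ψ.integral_smul_mul_fourier κ hp, smul_eq_mul (_ ^ (-(Module.finrank ℝ E : ℂ)))]
  rw [h3, mellin_cpow_smul, mellin_comp_inv]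
  congr 1
  ring

end Pairing

/-! ### Radial extensions and the C^∞ topology of the test space. -/

section Radial
open SchwartzMap

variable {n : ℕ}

/-- The euclidean space `ℝ^(n+1)`. -/
abbrev Eucl (n : ℕ) : Type := EuclideanSpace ℝ (Fin (n + 1))

theorem finrank_eucl (n : ℕ) : Module.finrank ℝ (Eucl n) = n + 1 := by simp

instance : Fact (Module.finrank ℝ (Eucl n) = n + 1) := ⟨finrank_eucl n⟩

/-- The central projection to the unit sphere. -/
noncomputable def sphereProj (x : Eucl n) (hx : x ≠ 0) : Sph n :=
  ⟨‖x‖⁻¹ • x, by simp [norm_smul, hx]⟩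

theorem radialExt_of_ne (f : Sph n → ℂ) {x : Eucl n} (hx : x ≠ 0) :
    radialExt f x = f (sphereProj x hx) := by
  rw [radialExt, dif_pos hx]; rfl

theorem radialExt_smul (f : Sph n → ℂ) {a : ℝ} (ha : 0 < a) (x : Eucl n) :
    radialExt f (a • x) = radialExt f x := by
  by_cases hx : x = 0
  · simp [hx]
  have hax : a • x ≠ 0 := smul_ne_zero ha.ne' hx
  rw [radialExt_of_ne f hx, radialExt_of_ne f hax]
  congr 1
  ext1
  simp only [sphereProj, norm_smul, Real.norm_of_nonneg ha.le, smul_smul, mul_inv]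
  congr 1
  field_simp

theorem sphere_ne_zero (w : Sph n) : (w : Eucl n) ≠ 0 := by
  intro h
  have := norm_eq_of_mem_sphere w
  simp [h] at this

@[simp] theorem norm_sphere (w : Sph n) : ‖(w : Eucl n)‖ = 1 := norm_eq_of_mem_sphere w

@[simp] theorem radialExt_coe (f : Sph n → ℂ) (w : Sph n) : radialExt f w = f w := by
  rw [radialExt_of_ne f (sphere_ne_zero w)]
  congr 1
  ext1
  simp [sphereProj]

theorem radialExt_neg {f : Sph n → ℂ} (hf : ∀ w, f (-w) = f w) (x : Eucl n) :
    radialExt f (-x) = radialExt f x := by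
  by_cases hx : x = 0
  · simp [hx]
  rw [radialExt_of_ne f hx, radialExt_of_ne f (neg_ne_zero.2 hx), ← hf]
  congr 1
  ext1
  simp [sphereProj]

theorem contDiffOn_radialExt {f : Sph n → ℂ} (hf : ContMDiff (𝓡 n) 𝓘(ℝ, ℂ) ∞ f) :
    ContDiffOn ℝ ∞ (radialExt f) {0}ᶜ := by
  let U : TopologicalSpace.Opens (Eucl n) := ⟨{0}ᶜ, isOpen_compl_singleton⟩
  have h1 : ContMDiff 𝓘(ℝ, Eucl n) 𝓘(ℝ, Eucl n) ∞ (fun x : U => ‖(x : Eucl n)‖⁻¹ • (x : Eucl n)) := by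
    intro x
    rw [contMDiffAt_subtype_iff (f := fun x : Eucl n => ‖x‖⁻¹ • x), contMDiffAt_iff_contDiffAt]
    have hx : (x : Eucl n) ≠ 0 := x.2
    exact ((contDiffAt_norm ℝ hx).inv (norm_ne_zero_iff.2 hx)).smul contDiffAt_id
  have h2 : ContMDiff 𝓘(ℝ, Eucl n) (𝓡 n) ∞ (fun x : U => sphereProj (x : Eucl n) x.2) :=
    h1.codRestrict_sphere _
  have h3 := hf.comp h2
  intro x hx
  refine ContDiffAt.contDiffWithinAt ?_
  rw [← contMDiffAt_iff_contDiffAt, ← contMDiffAt_subtype_iff (U := U) (x := ⟨x, hx⟩)]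
  refine (h3 ⟨x, hx⟩).congr_of_eventuallyEq (Eventually.of_forall fun y => ?_)
  exact radialExt_of_ne f y.2

theorem contMDiff_coe_of_contDiffOn {g : Eucl n → ℂ} (hg : ContDiffOn ℝ ∞ g {0}ᶜ) :
    ContMDiff (𝓡 n) 𝓘(ℝ, ℂ) ∞ (fun w : Sph n => g w) := by
  intro w
  have h1 : ContMDiffAt 𝓘(ℝ, Eucl n) 𝓘(ℝ, ℂ) ∞ g (w : Eucl n) :=
    contMDiffAt_iff_contDiffAt.2
      (hg.contDiffAt (isOpen_compl_singleton.mem_nhds (sphere_ne_zero w)))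
  exact h1.comp w (contMDiff_coe_sphere w)

namespace evenTest

/-- The restriction to the sphere of a function, as a smooth even function. -/
def ofFun (g : Eucl n → ℂ) (hg : ContDiffOn ℝ ∞ g {0}ᶜ) (he : ∀ w : Sph n, g (-w) = g w) :
    (evenTest n).Space :=
  ⟨⟨fun w => g w, (contMDiff_coe_of_contDiffOn hg).continuous⟩,
    contMDiff_coe_of_contDiffOn hg, fun w => he w⟩

@[simp] theorem ofFun_apply (g : Eucl n → ℂ) (hg he) (w : Sph n) :
    (ofFun g hg he : (evenTest n).Space) w = g w := rfl

theorem smooth (f : (evenTest n).Space) : ContDiffOn ℝ ∞ (radialExt (f : Sph n → ℂ)) {0}ᶜ :=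
  contDiffOn_radialExt f.2.1

theorem even (f : (evenTest n).Space) (w : Sph n) : f (-w) = f w := f.2.2 w

theorem continuous_fn (f : (evenTest n).Space) : Continuous (f : Sph n → ℂ) := f.1.continuous

@[ext] theorem ext {f g : (evenTest n).Space} (h : ∀ w : Sph n, f w = g w) : f = g :=
  Subtype.ext (ContinuousMap.ext h)

theorem contDiffAt (f : (evenTest n).Space) {x : Eucl n} (hx : x ≠ 0) :
    ContDiffAt ℝ ∞ (radialExt (f : Sph n → ℂ)) x :=
  (smooth f).contDiffAt (isOpen_compl_singleton.mem_nhds hx)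

theorem radialExt_add (f g : (evenTest n).Space) :
    radialExt ((f + g : (evenTest n).Space) : Sph n → ℂ) = radialExt f + radialExt g := by
  ext x
  by_cases hx : x = 0
  · simp [radialExt, hx]
  · simp only [Pi.add_apply, radialExt_of_ne _ hx]; rfl

theorem radialExt_const_smul (a : ℂ) (f : (evenTest n).Space) :
    radialExt ((a • f : (evenTest n).Space) : Sph n → ℂ) = a • radialExt f := by
  ext x
  by_cases hx : x = 0
  · simp [radialExt, hx]
  · simp only [Pi.smul_apply, radialExt_of_ne _ hx]; rfl

/-- The `k`-th derivative of the radial extension on the sphere. -/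
noncomputable def derivMap (n k : ℕ) : (evenTest n).Space →ₗ[ℂ]
    BoundedContinuousFunction (Sph n) (ContinuousMultilinearMap ℝ (fun _ : Fin k => Eucl n) ℂ) where
  toFun f := BoundedContinuousFunction.mkOfCompact
    ⟨fun w => iteratedFDeriv ℝ k (radialExt (f : Sph n → ℂ)) w, by
      rw [continuous_iff_continuousAt]
      intro w
      have h := (contDiffAt f (sphere_ne_zero w)).continuousAt_iteratedFDeriv (k := k)
        (mod_cast le_top)
      exact ContinuousAt.comp (f := ((↑) : Sph n → Eucl n)) h continuous_subtype_val.continuousAt⟩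
  map_add' f g := by
    ext1 w
    have h1 := (contDiffAt f (sphere_ne_zero w)).of_le (m := k) (mod_cast le_top)
    have h2 := (contDiffAt g (sphere_ne_zero w)).of_le (m := k) (mod_cast le_top)
    simp only [BoundedContinuousFunction.mkOfCompact_apply, ContinuousMap.coe_mk,
      BoundedContinuousFunction.coe_add, Pi.add_apply, radialExt_add]
    exact iteratedFDeriv_add_apply h1 h2
  map_smul' a f := by
    ext1 w
    have h1 := (contDiffAt f (sphere_ne_zero w)).of_le (m := k) (mod_cast le_top)
    simp only [BoundedContinuousFunction.mkOfCompact_apply, ContinuousMap.coe_mk,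
      BoundedContinuousFunction.coe_smul, radialExt_const_smul, RingHom.id_apply]
    exact iteratedFDeriv_const_smul_apply h1

/-- On the compact sphere the derivatives are bounded continuous functions, whose norm topology is
that of uniform convergence. The test space thereby becomes a space with countably many seminorms.
-/
theorem topology_eq : (evenTest n).instTopologicalSpaceSpace =
    ⨅ k : ℕ, TopologicalSpace.induced (derivMap n k) inferInstance := by
  change (⨅ k : ℕ, _) = _
  refine iInf_congr fun k => ?_
  rw [BoundedContinuousFunction.isInducing_coeFn.eq_induced, induced_compose]
  rfl

/-- The supremum over the sphere of the `k`-th derivative of the radial extension. -/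
noncomputable def derivNorm (n k : ℕ) : Seminorm ℂ (evenTest n).Space :=
  (normSeminorm ℂ (BoundedContinuousFunction (Sph n)
    (ContinuousMultilinearMap ℝ (fun _ : Fin k => Eucl n) ℂ))).comp (derivMap n k)

theorem norm_iteratedFDeriv_coe_le (k : ℕ) (f : (evenTest n).Space) (w : Sph n) :
    ‖iteratedFDeriv ℝ k (radialExt (f : Sph n → ℂ)) w‖ ≤ derivNorm n k f :=
  BoundedContinuousFunction.norm_coe_le_norm (derivMap n k f) w

theorem derivNorm_le (k : ℕ) (f : (evenTest n).Space) {C : ℝ} (hC : 0 ≤ C)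
    (h : ∀ w : Sph n, ‖iteratedFDeriv ℝ k (radialExt (f : Sph n → ℂ)) w‖ ≤ C) :
    derivNorm n k f ≤ C :=
  (BoundedContinuousFunction.norm_le (f := derivMap n k f) hC).2 h

theorem withSeminorms_derivNorm :
    WithSeminorms (fun i : (_ : ℕ) × Fin 1 => derivNorm n i.1) := by
  rw [topology_eq]
  refine withSeminorms_iInf (E := (evenTest n).Space) (p := fun k (_ : Fin 1) => derivNorm n k)
    fun k => ?_
  exact LinearMap.withSeminorms_induced (norm_withSeminorms ℂ (BoundedContinuousFunction (Sph n)
    (ContinuousMultilinearMap ℝ (fun _ : Fin k => Eucl n) ℂ))) (derivMap n k)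

instance : IsTopologicalAddGroup (evenTest n).Space :=
  withSeminorms_derivNorm.topologicalAddGroup

instance : ContinuousSMul ℂ (evenTest n).Space :=
  withSeminorms_derivNorm.continuousSMul

theorem continuous_derivNorm (k : ℕ) : Continuous (derivNorm n k) :=
  withSeminorms_derivNorm.continuous_seminorm ⟨k, 0⟩

theorem continuous_of_derivNorm {X : Type*} [AddCommGroup X] [Module ℂ X] [TopologicalSpace X]
    [IsTopologicalAddGroup X] (F : X →ₗ[ℂ] (evenTest n).Space)
    (h : ∀ k, Continuous ((derivNorm n k).comp F)) : Continuous F :=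
  WithSeminorms.continuous_of_continuous_comp withSeminorms_derivNorm F fun i => h i.1

end evenTest

end Radial

/-! ### Radial bump functions with prescribed Mellin transform. -/

section RadialBump

/-- A smooth bump function supported in `[1, 3]`. -/
noncomputable def lineBump : ContDiffBump (2 : ℝ) := ⟨1 / 2, 1, by norm_num, by norm_num⟩

theorem lineBump_eq_zero {r : ℝ} (hr : r ≤ 1 ∨ 3 ≤ r) : lineBump r = 0 := by
  refine lineBump.zero_of_le_dist ?_
  rw [Real.dist_eq]
  change (1 : ℝ) ≤ _
  rcases hr with h | h
  · rw [abs_of_nonpos (by linarith)]; linarith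
  · rw [abs_of_nonneg (by linarith)]; linarith

/-- The mass of the bump function with respect to the measure `r ^ a dr`. -/
noncomputable def bumpMass (a : ℝ) : ℝ := ∫ r in Ioi (0 : ℝ), r ^ a * lineBump r

theorem integrableOn_rpow_mul_lineBump (a : ℝ) :
    IntegrableOn (fun r : ℝ => r ^ a * lineBump r) (Ioi 0) := by
  have h0 : IntegrableOn (fun r : ℝ => r ^ a * lineBump r) (Icc 1 3) := by
    refine ContinuousOn.integrableOn_Icc (ContinuousOn.mul ?_ lineBump.continuous.continuousOn)
    exact fun r hr => (Real.continuousAt_rpow_const _ _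
      (Or.inl (by linarith [hr.1] : (0 : ℝ) < r).ne')).continuousWithinAt
  have h1 : IntegrableOn (fun r : ℝ => r ^ a * lineBump r) (Icc 1 3 ∪ (Icc 1 3)ᶜ) := by
    refine h0.union ?_
    refine (integrableOn_zero).congr_fun (fun r hr => ?_) measurableSet_Icc.compl
    have : lineBump r = 0 := lineBump_eq_zero (by
      simp only [mem_compl_iff, mem_Icc, not_and_or, not_le] at hr
      exact hr.imp le_of_lt le_of_lt)
    simp [this]
  rw [union_compl_self] at h1
  exact h1.mono_set (subset_univ _)

theorem bumpMass_pos (a : ℝ) : 0 < bumpMass a := by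
  have hnn : ∀ r ∈ Ioi (0 : ℝ), 0 ≤ r ^ a * lineBump r := fun r hr =>
    mul_nonneg (Real.rpow_nonneg (le_of_lt hr) _) lineBump.nonneg
  rw [bumpMass, setIntegral_pos_iff_support_of_nonneg_ae
    ((ae_restrict_mem measurableSet_Ioi).mono hnn) (integrableOn_rpow_mul_lineBump a)]
  have : Ioo (1 : ℝ) 3 ⊆ Function.support (fun r : ℝ => r ^ a * lineBump r) ∩ Ioi 0 := by
    intro r hr
    have hr0 : 0 < r := by linarith [hr.1]
    refine ⟨?_, hr0⟩
    refine (mul_pos (Real.rpow_pos_of_pos hr0 _) (lineBump.pos_of_mem_ball ?_)).ne'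
    rw [Metric.mem_ball, Real.dist_eq, abs_lt]
    change -(1 : ℝ) < _ ∧ _ < (1 : ℝ)
    constructor <;> linarith [hr.1, hr.2]
  refine lt_of_lt_of_le ?_ (measure_mono this)
  simp

/-- A smooth function on the line supported in `[1, 3]` whose Mellin transform is `1` at `s`. -/
noncomputable def radialBump (s : ℂ) (r : ℝ) : ℂ :=
  ((bumpMass (-1) : ℝ) : ℂ)⁻¹ * ((lineBump r : ℂ) * (r : ℂ) ^ (-s))

theorem radialBump_eq_zero (s : ℂ) {r : ℝ} (hr : r ≤ 1 ∨ 3 ≤ r) : radialBump s r = 0 := by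
  simp [radialBump, lineBump_eq_zero hr]

theorem contDiff_radialBump (s : ℂ) : ContDiff ℝ ∞ (radialBump s) := by
  rw [contDiff_iff_contDiffAt]
  intro r
  rcases lt_or_ge r 1 with hr | hr
  · refine (contDiffAt_const (c := (0 : ℂ))).congr_of_eventuallyEq ?_
    filter_upwards [Iio_mem_nhds hr] with t ht
    exact radialBump_eq_zero s (Or.inl (le_of_lt ht))
  · have hr0 : 0 < r := by linarith
    have h1 : ContDiffAt ℝ ∞ (fun t : ℝ => Complex.exp (((Real.log t : ℝ) : ℂ) * (-s))) r := by
      refine ContDiffAt.cexp (ContDiffAt.mul ?_ contDiffAt_const)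
      exact Complex.ofRealCLM.contDiff.contDiffAt.comp r (Real.contDiffAt_log.2 hr0.ne')
    have h2 : ContDiffAt ℝ ∞ (fun t : ℝ => (t : ℂ) ^ (-s)) r := by
      refine h1.congr_of_eventuallyEq ?_
      filter_upwards [Ioi_mem_nhds hr0] with t ht
      have ht' : (0 : ℝ) < t := ht
      rw [Complex.cpow_def_of_ne_zero (Complex.ofReal_ne_zero.2 ht'.ne'), Complex.ofReal_log ht'.le]
    exact contDiffAt_const.mul ((Complex.ofRealCLM.contDiff.contDiffAt.comp r
      lineBump.contDiffAt).mul h2)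

theorem mellin_radialBump (s : ℂ) : mellin (radialBump s) s = 1 := by
  have h : mellin (radialBump s) s = ∫ r : ℝ in Ioi 0,
      ((bumpMass (-1) : ℝ) : ℂ)⁻¹ * ((r ^ (-1 : ℝ) * lineBump r : ℝ) : ℂ) := by
    refine setIntegral_congr_fun measurableSet_Ioi fun r hr => ?_
    have hr' : (0 : ℝ) < r := hr
    have hr0 : (r : ℂ) ≠ 0 := Complex.ofReal_ne_zero.2 hr'.ne'
    simp only [radialBump, smul_eq_mul]
    have : (r : ℂ) ^ (s - 1) * (r : ℂ) ^ (-s) = ((r ^ (-1 : ℝ) : ℝ) : ℂ) := by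
      rw [← Complex.cpow_add _ _ hr0, Complex.ofReal_cpow hr'.le]
      congr 1; push_cast; ring
    push_cast [← this]
    ring
  rw [h, integral_const_mul, integral_complex_ofReal]
  exact inv_mul_cancel₀ (Complex.ofReal_ne_zero.2 (bumpMass_pos _).ne')

theorem differentiable_mellin_radialBump (s : ℂ) : Differentiable ℂ (mellin (radialBump s)) := by
  intro z
  refine mellin_differentiableAt_of_isBigO_rpow (a := z.re + 1) (b := z.re - 1)
    ((contDiff_radialBump s).continuous.locallyIntegrable.locallyIntegrableOn _) ?_
    (by linarith) ?_ (by linarith)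
  · refine (Asymptotics.isBigO_zero _ _).congr' ?_ EventuallyEq.rfl
    filter_upwards [eventually_ge_atTop 3] with r hr
    exact (radialBump_eq_zero s (Or.inr hr)).symm
  · refine (Asymptotics.isBigO_zero _ _).congr' ?_ EventuallyEq.rfl
    filter_upwards [nhdsWithin_le_nhds (Iio_mem_nhds one_pos)] with r hr
    exact (radialBump_eq_zero s (Or.inl (le_of_lt hr))).symm

end RadialBump

theorem Seminorm.continuous_of_le_of_continuous {X : Type*} [AddCommGroup X] [Module ℂ X]
    [TopologicalSpace X] [IsTopologicalAddGroup X] {p : Seminorm ℂ X} {R : X → ℝ}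
    (hR : Continuous R) (h0 : R 0 = 0) (h : ∀ x, p x ≤ R x) : Continuous p := by
  refine Seminorm.continuous_of_continuousAt_zero ?_
  rw [ContinuousAt, map_zero]
  refine squeeze_zero (fun x => apply_nonneg p x) h ?_
  simpa [h0] using hR.tendsto 0

/-! ### Lifting test functions to Schwartz functions. -/

namespace evenTest
open SchwartzMap

variable {n : ℕ}

theorem contDiff_radialBump_norm (s : ℂ) :
    ContDiff ℝ ∞ (fun x : Eucl n => radialBump s ‖x‖) := by
  rw [contDiff_iff_contDiffAt]
  intro x
  by_cases hx : x = 0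
  · refine (contDiffAt_const (c := (0 : ℂ))).congr_of_eventuallyEq ?_
    filter_upwards [Metric.ball_mem_nhds x one_pos] with t ht
    refine radialBump_eq_zero s (Or.inl ?_)
    rw [hx, mem_ball_zero_iff] at ht
    exact ht.le
  · exact (contDiff_radialBump s).contDiffAt.comp x (contDiffAt_norm ℝ hx)

theorem tsupport_subset_annulus {g : Eucl n → ℂ} (s : ℂ) :
    tsupport (fun x => radialBump s ‖x‖ * g x) ⊆ {x | 1 ≤ ‖x‖ ∧ ‖x‖ ≤ 3} := by
  refine closure_minimal ?_ ?_
  · intro x hx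
    by_contra hx'
    simp only [mem_ofPred_eq, not_and_or, not_le] at hx'
    refine hx ?_
    simp only
    rw [radialBump_eq_zero s (hx'.imp le_of_lt le_of_lt), zero_mul]
  · exact (isClosed_le continuous_const continuous_norm).inter
      (isClosed_le continuous_norm continuous_const)

theorem isCompact_annulus : IsCompact {x : Eucl n | 1 ≤ ‖x‖ ∧ ‖x‖ ≤ 3} := by
  refine (isCompact_closedBall (0 : Eucl n) 3).of_isClosed_subset
    ((isClosed_le continuous_const continuous_norm).inter
      (isClosed_le continuous_norm continuous_const)) fun x hx => ?_
  simpa using hx.2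

theorem hasCompactSupport_bump_mul (s : ℂ) (g : Eucl n → ℂ) :
    HasCompactSupport (fun x => radialBump s ‖x‖ * g x) :=
  isCompact_annulus.of_isClosed_subset (isClosed_tsupport _) (tsupport_subset_annulus s)

theorem contDiff_bump_mul (s : ℂ) (f : (evenTest n).Space) :
    ContDiff ℝ ∞ (fun x : Eucl n => radialBump s ‖x‖ * radialExt (f : Sph n → ℂ) x) := by
  rw [contDiff_iff_contDiffAt]
  intro x
  by_cases hx : x = 0
  · refine (contDiffAt_const (c := (0 : ℂ))).congr_of_eventuallyEq ?_
    filter_upwards [Metric.ball_mem_nhds x one_pos] with t ht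
    rw [radialBump_eq_zero s (Or.inl ?_), zero_mul]
    rw [hx, mem_ball_zero_iff] at ht
    exact ht.le
  · exact (contDiff_radialBump_norm s).contDiffAt.mul (contDiffAt f hx)

/-- The Schwartz function `x ↦ h (‖x‖) * f (x / ‖x‖)`, with a bump function `h` whose Mellin
transform is `1` at `s`. -/
noncomputable def cutoff (n : ℕ) (s : ℂ) : (evenTest n).Space →ₗ[ℂ] 𝓢(Eucl n, ℂ) where
  toFun f := (hasCompactSupport_bump_mul s (radialExt (f : Sph n → ℂ))).toSchwartzMap
    (contDiff_bump_mul s f)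
  map_add' f g := by
    ext x
    simp [radialExt_add, mul_add]
  map_smul' a f := by
    ext x
    simp [radialExt_const_smul]
    ring

@[simp] theorem cutoff_apply (s : ℂ) (f : (evenTest n).Space) (x : Eucl n) :
    cutoff n s f x = radialBump s ‖x‖ * radialExt (f : Sph n → ℂ) x := rfl

/-- The radial extension has degree 0, so its j-th derivative has degree -j and does not grow away
from the unit sphere. -/
theorem norm_iteratedFDeriv_radialExt_le (f : (evenTest n).Space) (j : ℕ) {x : Eucl n}
    (hx : 1 ≤ ‖x‖) :
    ‖iteratedFDeriv ℝ j (radialExt (f : Sph n → ℂ)) x‖ ≤ derivNorm n j f := by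
  have hx0 : x ≠ 0 := by rintro rfl; norm_num at hx
  have ha : 0 < ‖x‖⁻¹ := by positivity
  set L : Eucl n ≃L[ℝ] Eucl n := ContinuousLinearEquiv.smulLeft (Units.mk0 ‖x‖⁻¹ ha.ne')
  have hL : ∀ y, L y = ‖x‖⁻¹ • y := fun y => rfl
  have hL1 : ‖(L : Eucl n →L[ℝ] Eucl n)‖ ≤ 1 := by
    refine ContinuousLinearMap.opNorm_le_bound _ zero_le_one fun y => ?_
    rw [ContinuousLinearEquiv.coe_coe, hL, norm_smul, Real.norm_of_nonneg ha.le]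
    gcongr
    exact inv_le_one_of_one_le₀ hx
  have h1 : radialExt (f : Sph n → ℂ) ∘ L = radialExt (f : Sph n → ℂ) := by
    ext y
    simp only [Function.comp_apply, hL]
    exact radialExt_smul _ ha y
  have h2 := L.iteratedFDerivWithin_comp_right (radialExt (f : Sph n → ℂ)) uniqueDiffOn_univ
    (mem_univ (L x)) j
  rw [preimage_univ, iteratedFDerivWithin_univ, iteratedFDerivWithin_univ, h1] at h2
  rw [h2]
  refine (ContinuousMultilinearMap.norm_compContinuousLinearMap_le _ _).trans ?_
  have h3 : L x = (sphereProj x hx0 : Eucl n) := rfl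
  rw [h3]
  calc _ ≤ derivNorm n j f * 1 := by
        refine mul_le_mul (norm_iteratedFDeriv_coe_le j f _)
          (Finset.prod_le_one (fun _ _ => norm_nonneg _) fun _ _ => hL1)
          (Finset.prod_nonneg fun _ _ => norm_nonneg _) (apply_nonneg _ _)
    _ = _ := mul_one _

theorem norm_iteratedFDeriv_mul_le_of_isOpen {g h : Eucl n → ℂ} {U : Set (Eucl n)} (hU : IsOpen U)
    (hg : ContDiffOn ℝ ∞ g U) (hh : ContDiffOn ℝ ∞ h U) {x : Eucl n} (hx : x ∈ U) (k : ℕ) :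
    ‖iteratedFDeriv ℝ k (fun y => g y * h y) x‖ ≤ ∑ i ∈ Finset.range (k + 1),
      (k.choose i : ℝ) * ‖iteratedFDeriv ℝ i g x‖ * ‖iteratedFDeriv ℝ (k - i) h x‖ := by
  have := norm_iteratedFDerivWithin_mul_le (n := k) hg hh hU.uniqueDiffOn hx (mod_cast le_top)
  simpa only [iteratedFDerivWithin_of_isOpen _ hU hx] using this

theorem continuous_cutoff (s : ℂ) : Continuous (cutoff n s) := by
  refine WithSeminorms.continuous_of_continuous_comp (schwartz_withSeminorms ℂ (Eucl n) ℂ) _ ?_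
  rintro ⟨m, k⟩
  have hb : ∀ i : ℕ, ∃ B : ℝ, ∀ x : Eucl n,
      ‖iteratedFDeriv ℝ i (fun x : Eucl n => radialBump s ‖x‖) x‖ ≤ B := fun i => by
    have h1 := (hasCompactSupport_bump_mul s (fun _ : Eucl n => 1)).iteratedFDeriv (𝕜 := ℝ) i
    simp only [mul_one] at h1
    exact (((contDiff_radialBump_norm s).of_le (mod_cast le_top)).continuous_iteratedFDeriv
      (m := i) le_rfl).bounded_above_of_compact_support h1
  choose B hB using hb
  have hB0 : ∀ i, 0 ≤ B i := fun i => (norm_nonneg _).trans (hB i 0)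
  -- The support lies in 1 ≤ ‖x‖ ≤ 3: there ‖x‖^m ≤ 3^m, and the Leibniz formula gives the sum.
  refine Seminorm.continuous_of_le_of_continuous (R := fun f => 3 ^ m *
    ∑ i ∈ Finset.range (k + 1), (k.choose i : ℝ) * B i * derivNorm n (k - i) f) ?_ (by simp) ?_
  · refine continuous_const.mul (continuous_finsetSum _ fun i _ => continuous_const.mul ?_)
    exact continuous_derivNorm _
  · intro f
    have hS : 0 ≤ ∑ i ∈ Finset.range (k + 1), (k.choose i : ℝ) * B i * derivNorm n (k - i) f :=
      Finset.sum_nonneg fun i _ =>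
        mul_nonneg (mul_nonneg (Nat.cast_nonneg _) (hB0 i)) (apply_nonneg _ _)
    refine SchwartzMap.seminorm_le_bound ℂ m k _ (mul_nonneg (by positivity) hS) fun x => ?_
    by_cases hx : 1 ≤ ‖x‖ ∧ ‖x‖ ≤ 3
    · have hx0 : x ∈ ({0}ᶜ : Set (Eucl n)) := by
        rintro rfl; norm_num at hx
      refine mul_le_mul (pow_le_pow_left₀ (norm_nonneg _) hx.2 m) ?_ (norm_nonneg _) (by positivity)
      refine (norm_iteratedFDeriv_mul_le_of_isOpen isOpen_compl_singleton
        (contDiff_radialBump_norm s).contDiffOn (smooth f) hx0 k).trans ?_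
      refine Finset.sum_le_sum fun i _ => ?_
      exact mul_le_mul (mul_le_mul_of_nonneg_left (hB i x) (Nat.cast_nonneg _))
        (norm_iteratedFDeriv_radialExt_le f _ hx.1) (norm_nonneg _)
        (mul_nonneg (Nat.cast_nonneg _) (hB0 i))
    · have : iteratedFDeriv ℝ k (cutoff n s f) x = 0 := by
        by_contra hne
        exact hx (tsupport_subset_annulus s (support_iteratedFDeriv_subset k hne))
      rw [this, norm_zero, mul_zero]
      exact mul_nonneg (by positivity) hS

/-- Along a ray the cutoff is the bump times a constant. At z = s the factor is 1, so f is
recovered. -/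
theorem rayMellin_cutoff (s z : ℂ) (f : (evenTest n).Space) (w : Sph n) :
    rayMellin z (cutoff n s f) w = mellin (radialBump s) z * f w := by
  rw [rayMellin, mellin, ← integral_mul_const]
  refine setIntegral_congr_fun measurableSet_Ioi fun r hr => ?_
  have hr' : (0 : ℝ) < r := hr
  simp only [cutoff_apply, smul_eq_mul]
  rw [radialExt_smul _ hr', radialExt_coe, norm_smul, norm_sphere, mul_one,
    Real.norm_of_nonneg hr'.le, mul_assoc]

theorem cutoff_neg (s : ℂ) (f : (evenTest n).Space) (x : Eucl n) :
    cutoff n s f (-x) = cutoff n s f x := by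
  rw [cutoff_apply, cutoff_apply, norm_neg, radialExt_neg (even f)]

end evenTest

/-! ### The Fourier transform of homogeneous functions. -/

namespace evenTest
open SchwartzMap

variable {n : ℕ}

/-- The even part of a Schwartz function. -/
noncomputable def symmetrize (n : ℕ) : 𝓢(Eucl n, ℂ) →L[ℂ] 𝓢(Eucl n, ℂ) :=
  (1 / 2 : ℂ) • (ContinuousLinearMap.id ℂ _ +
    compCLMOfContinuousLinearEquiv ℂ (ContinuousLinearEquiv.neg ℝ (M := Eucl n)))

theorem symmetrize_apply (g : 𝓢(Eucl n, ℂ)) (x : Eucl n) :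
    symmetrize n g x = 1 / 2 * (g x + g (-x)) := rfl

theorem symmetrize_of_even {g : 𝓢(Eucl n, ℂ)} (hg : ∀ x, g (-x) = g x) : symmetrize n g = g := by
  ext x
  rw [symmetrize_apply, hg]
  ring

theorem rayMellin_neg (s : ℂ) {g : Eucl n → ℂ} (hg : ∀ x, g (-x) = g x) (x : Eucl n) :
    rayMellin s g (-x) = rayMellin s g x := by
  simp only [rayMellin, smul_neg, hg]

theorem symmetrize_neg (g : 𝓢(Eucl n, ℂ)) (x : Eucl n) :
    symmetrize n g (-x) = symmetrize n g x := by
  rw [symmetrize_apply, symmetrize_apply, neg_neg, add_comm]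

/-- The Mellin transform of the even part of a Schwartz function along the rays from the origin. -/
noncomputable def rayMap (n : ℕ) (s : ℂ) (hs : 0 < s.re) :
    𝓢(Eucl n, ℂ) →ₗ[ℂ] (evenTest n).Space where
  toFun g := ofFun (rayMellin s (symmetrize n g)) (contDiffOn_rayMellin _ hs)
    fun w => rayMellin_neg s (symmetrize_neg g) w
  map_add' g h := by
    ext w
    rw [TestAlgebra.add_apply]
    simp only [ofFun_apply, map_add]
    exact rayMellin_add _ _ (sphere_ne_zero w) hs
  map_smul' a g := by
    ext w
    rw [RingHom.id_apply, TestAlgebra.smul_apply]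
    simp only [ofFun_apply, map_smul, rayMellin_eq_mellin]
    exact mellin_const_smul _ _ a

theorem rayMap_apply {s : ℂ} (hs : 0 < s.re) (g : 𝓢(Eucl n, ℂ)) (w : Sph n) :
    rayMap n s hs g w = rayMellin s (symmetrize n g) w := rfl

theorem radialExt_rayMap {s : ℂ} (hs : 0 < s.re) (g : 𝓢(Eucl n, ℂ)) {x : Eucl n} (hx : x ≠ 0) :
    radialExt (rayMap n s hs g : Sph n → ℂ) x =
      ((‖x‖ : ℝ) : ℂ) ^ s * rayMellin s (symmetrize n g) x := by
  have hx0 : 0 < ‖x‖ := norm_pos_iff.2 hx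
  rw [radialExt_of_ne _ hx, rayMap_apply]
  have h := rayMellin_smul s (symmetrize n g) hx0 (sphereProj x hx : Eucl n)
  have hx' : ‖x‖ • (sphereProj x hx : Eucl n) = x := by
    simp [sphereProj, smul_smul, hx0.ne']
  rw [hx'] at h
  rw [h, ← mul_assoc, ← Complex.cpow_add _ _ (Complex.ofReal_ne_zero.2 hx0.ne'), add_neg_cancel,
    Complex.cpow_zero, one_mul]

theorem contDiffOn_norm_cpow (s : ℂ) :
    ContDiffOn ℝ ∞ (fun x : Eucl n => ((‖x‖ : ℝ) : ℂ) ^ s) {0}ᶜ := by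
  intro x hx
  have hx0 : 0 < ‖x‖ := norm_pos_iff.2 hx
  have h1 : ContDiffAt ℝ ∞ (fun y : Eucl n => Complex.exp (((Real.log ‖y‖ : ℝ) : ℂ) * s)) x := by
    refine ContDiffAt.cexp (ContDiffAt.mul ?_ contDiffAt_const)
    exact Complex.ofRealCLM.contDiff.contDiffAt.comp x
      ((Real.contDiffAt_log.2 hx0.ne').comp x (contDiffAt_norm ℝ hx))
  refine (h1.congr_of_eventuallyEq ?_).contDiffWithinAt
  filter_upwards [isOpen_compl_singleton.mem_nhds hx] with t ht
  rw [Complex.cpow_def_of_ne_zero (Complex.ofReal_ne_zero.2 (norm_ne_zero_iff.2 ht)),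
    Complex.ofReal_log (norm_nonneg _)]

/-- The seminorms involve the extension of degree 0, while `rayMellin` has degree -s. The two differ
by ‖x‖^s, which is smooth near the sphere, so the Leibniz formula reduces the claim to the Schwartz
bounds. -/
theorem continuous_rayMap {s : ℂ} (hs : 0 < s.re) : Continuous (rayMap n s hs) := by
  refine continuous_of_derivNorm _ fun k => ?_
  have hb : ∀ i : ℕ, ∃ B : ℝ, ∀ x ∈ Metric.sphere (0 : Eucl n) 1,
      ‖iteratedFDeriv ℝ i (fun x : Eucl n => ((‖x‖ : ℝ) : ℂ) ^ s) x‖ ≤ B := fun i => by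
    refine (isCompact_sphere (0 : Eucl n) 1).exists_bound_of_continuousOn fun x hx => ?_
    have hx0 : x ≠ 0 := sphere_ne_zero ⟨x, hx⟩
    exact (((contDiffOn_norm_cpow s).contDiffAt (isOpen_compl_singleton.mem_nhds hx0)
      ).continuousAt_iteratedFDeriv (k := i) (mod_cast le_top)).continuousWithinAt
  choose B hB using hb
  have hB0 : ∀ i, 0 ≤ max (B i) 0 := fun i => le_max_right _ _
  choose q hq hqb using fun i : ℕ =>
    exists_norm_iteratedFDeriv_rayMellin_le (E := Eucl n) i ℂ hs
  refine Seminorm.continuous_of_le_of_continuous (R := fun g =>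
    ∑ i ∈ Finset.range (k + 1), (k.choose i : ℝ) * max (B i) 0 * q (k - i) (symmetrize n g))
    ?_ (by simp) fun g => ?_
  · exact continuous_finsetSum _ fun i _ => continuous_const.mul
      ((hq _).comp (symmetrize n).continuous)
  · refine derivNorm_le k _ (Finset.sum_nonneg fun i _ =>
      mul_nonneg (mul_nonneg (Nat.cast_nonneg _) (hB0 i)) (apply_nonneg _ _)) fun w => ?_
    have h1 : radialExt (rayMap n s hs g : Sph n → ℂ) =ᶠ[𝓝 (w : Eucl n)] fun x =>
        ((‖x‖ : ℝ) : ℂ) ^ s * rayMellin s (symmetrize n g) x := by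
      filter_upwards [isOpen_compl_singleton.mem_nhds (sphere_ne_zero w)] with x hx
      exact radialExt_rayMap hs g hx
    rw [(h1.iteratedFDeriv ℝ k).eq_of_nhds]
    refine (norm_iteratedFDeriv_mul_le_of_isOpen isOpen_compl_singleton
      (contDiffOn_norm_cpow s) (contDiffOn_rayMellin _ hs) (sphere_ne_zero w) k).trans ?_
    refine Finset.sum_le_sum fun i _ => ?_
    exact mul_le_mul (mul_le_mul_of_nonneg_left ((hB i _ w.2).trans (le_max_left _ _))
      (Nat.cast_nonneg _)) (hqb _ _ _ (norm_sphere w)) (norm_nonneg _)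
      (mul_nonneg (Nat.cast_nonneg _) (hB0 i))

/-- `rayMap` as a continuous linear map; it is zero unless `0 < re s`. -/
noncomputable def rayCLM (n : ℕ) (s : ℂ) : 𝓢(Eucl n, ℂ) →L[ℂ] (evenTest n).Space :=
  open Classical in
  if hs : 0 < s.re then ⟨rayMap n s hs, continuous_rayMap hs⟩ else 0

theorem rayCLM_apply {s : ℂ} (hs : 0 < s.re) {g : 𝓢(Eucl n, ℂ)} (hg : ∀ x, g (-x) = g x)
    (w : Sph n) : rayCLM n s g w = rayMellin s g w := by
  rw [rayCLM, dif_pos hs]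
  change rayMap n s hs g w = _
  rw [rayMap_apply, symmetrize_of_even hg]

/-- The Fourier transform of the homogeneous extension of degree `-s` of an even function on the
sphere, restricted to the sphere. -/
noncomputable def homFourier (n : ℕ) (s : ℂ) : (evenTest n).Space →L[ℂ] (evenTest n).Space :=
  (rayCLM n ((n : ℂ) + 1 - s)).comp
    ((fourierTransformCLM ℂ).comp ⟨cutoff n s, continuous_cutoff s⟩)

theorem homFourier_eq (s : ℂ) (f : (evenTest n).Space) :
    homFourier n s f = rayCLM n ((n : ℂ) + 1 - s) (FourierTransform.fourier (cutoff n s f)) := rfl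

theorem fourier_neg_of_even {g : 𝓢(Eucl n, ℂ)} (hg : ∀ x, g (-x) = g x) (x : Eucl n) :
    FourierTransform.fourier g (-x) = FourierTransform.fourier g x := by
  rw [fourier_coe, Real.fourier_eq', Real.fourier_eq', ← integral_neg_eq_self]
  simp [hg]

theorem fourier_fourier_of_even {g : 𝓢(Eucl n, ℂ)} (hg : ∀ x, g (-x) = g x) :
    FourierTransform.fourier (FourierTransform.fourier g) = g := by
  ext x
  have h1 := congrArg (fun h : 𝓢(Eucl n, ℂ) => h (-x)) (FourierTransform.fourierInv_fourier_eq (F := 𝓢(Eucl n, ℂ)) g)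
  simp only [hg] at h1
  rw [← h1, fourierInv_coe, fourier_coe (FourierTransform.fourier g),
    Real.fourierInv_eq_fourier_neg, neg_neg]

theorem re_sub {s : ℂ} (hs' : s.re < n + 1) : 0 < ((n : ℂ) + 1 - s).re := by
  simp; linarith

theorem integral_rayCLM_mul {ψ κ : 𝓢(Eucl n, ℂ)} (hψ : ∀ x, ψ (-x) = ψ x)
    (hκ : ∀ x, κ (-x) = κ x) {s : ℂ} (hs : 0 < s.re) (hs' : s.re < n + 1) :
    ∫ w, rayCLM n s ψ w * rayCLM n ((n : ℂ) + 1 - s) (FourierTransform.fourier κ) w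
      ∂(sphereMeasure n) =
    ∫ w, rayCLM n ((n : ℂ) + 1 - s) (FourierTransform.fourier ψ) w * rayCLM n s κ w
      ∂(sphereMeasure n) := by
  have h := ψ.integral_rayMellin_fourier κ hs (by simpa using hs')
  simp only [finrank_eucl, Nat.cast_add, Nat.cast_one] at h
  simp only [rayCLM_apply hs hψ, rayCLM_apply hs hκ,
    rayCLM_apply (re_sub hs') (fourier_neg_of_even hψ),
    rayCLM_apply (re_sub hs') (fourier_neg_of_even hκ)]
  exact h

theorem rayCLM_cutoff {s : ℂ} (hs : 0 < s.re) (f : (evenTest n).Space) :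
    rayCLM n s (cutoff n s f) = f := by
  ext w
  rw [rayCLM_apply hs (cutoff_neg s f), rayMellin_cutoff, mellin_radialBump, one_mul]

theorem integral_homFourier_mul {s : ℂ} (hs : 0 < s.re) (hs' : s.re < n + 1)
    (f g : (evenTest n).Space) :
    ∫ w, homFourier n s f w * g w ∂(sphereMeasure n) =
      ∫ w, f w * homFourier n s g w ∂(sphereMeasure n) := by
  have h := integral_rayCLM_mul (cutoff_neg s f) (cutoff_neg s g) hs hs'
  rw [rayCLM_cutoff hs, rayCLM_cutoff hs] at h
  exact h.symm

instance : IsFiniteMeasure (sphereMeasure n) := by rw [sphereMeasure]; infer_instance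

instance : (sphereMeasure n).IsOpenPosMeasure := by rw [sphereMeasure]; infer_instance

theorem integrable_mul (f g : (evenTest n).Space) :
    Integrable (fun w => f w * g w) (sphereMeasure n) :=
  ((continuous_fn f).mul (continuous_fn g)).integrable_of_hasCompactSupport
    (HasCompactSupport.of_compactSpace _)

/-- Testing with u = conj (f - g) makes the integral of |f - g|² vanish; the measure charges open
sets. -/
theorem eq_of_integral_mul_eq {f g : (evenTest n).Space}
    (h : ∀ u : (evenTest n).Space,
      ∫ w, f w * u w ∂(sphereMeasure n) = ∫ w, g w * u w ∂(sphereMeasure n)) : f = g := by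
  have h1 : ∫ w, ((‖f w - g w‖ ^ 2 : ℝ) : ℂ) ∂(sphereMeasure n) = 0 := by
    have h2 := sub_eq_zero.2 (h (star (f + (-1 : ℂ) • g)))
    rw [← integral_sub (integrable_mul _ _) (integrable_mul _ _)] at h2
    rw [← h2]
    refine integral_congr_ae (Eventually.of_forall fun w => ?_)
    simp only [TestAlgebra.star_apply, TestAlgebra.add_apply, TestAlgebra.smul_apply]
    rw [← sub_mul, neg_one_mul, ← sub_eq_add_neg, Complex.mul_conj, Complex.normSq_eq_norm_sq]
  rw [integral_complex_ofReal, Complex.ofReal_eq_zero] at h1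
  have hc : Continuous fun w => ‖f w - g w‖ ^ 2 :=
    ((continuous_fn f).sub (continuous_fn g)).norm.pow 2
  ext w
  by_contra hne
  have h3 := hc.integral_pos_of_hasCompactSupport_nonneg_nonzero (μ := sphereMeasure n) (x := w)
    (HasCompactSupport.of_compactSpace _) (fun w => by positivity)
    (pow_ne_zero 2 (norm_ne_zero_iff.2 (sub_ne_zero.2 hne)))
  exact h3.ne' h1

/-- The operator does not depend on the Schwartz function that represents the homogeneous extension.
Tested against any u, both sides agree by the Parseval formula for ψ and the cutoff of u. This
permits a second application of `homFourier`, whose argument comes from a Fourier transform and not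
from a cutoff. -/
theorem homFourier_rayCLM {ψ : 𝓢(Eucl n, ℂ)} (hψ : ∀ x, ψ (-x) = ψ x) {s : ℂ} (hs : 0 < s.re)
    (hs' : s.re < n + 1) :
    homFourier n s (rayCLM n s ψ) =
      rayCLM n ((n : ℂ) + 1 - s) (FourierTransform.fourier ψ) := by
  refine eq_of_integral_mul_eq fun u => ?_
  rw [integral_homFourier_mul hs hs', homFourier_eq,
    integral_rayCLM_mul hψ (cutoff_neg s u) hs hs', rayCLM_cutoff hs]

theorem homFourier_homFourier {s : ℂ} (hs : 0 < s.re) (hs' : s.re < n + 1)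
    (f : (evenTest n).Space) : homFourier n ((n : ℂ) + 1 - s) (homFourier n s f) = f := by
  have h2 : ((n : ℂ) + 1 - s).re < n + 1 := by simpa using hs
  rw [homFourier_eq s, homFourier_rayCLM (fourier_neg_of_even (cutoff_neg s f)) (re_sub hs') h2,
    fourier_fourier_of_even (cutoff_neg s f), sub_sub_cancel, rayCLM_cutoff hs]

theorem conj_radialBump (s : ℂ) {r : ℝ} (hr : 0 ≤ r) :
    conj (radialBump s r) = radialBump (conj s) r := by
  simp only [radialBump, map_mul, map_inv₀, Complex.conj_ofReal]
  congr 2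
  rw [← map_neg, Complex.cpow_conj _ _ (by rw [Complex.arg_ofReal_of_nonneg hr]; exact
    Real.pi_ne_zero.symm), Complex.conj_ofReal]

theorem conj_cutoff (s : ℂ) (f : (evenTest n).Space) (x : Eucl n) :
    conj (cutoff n s f x) = cutoff n (conj s) (star f) x := by
  rw [cutoff_apply, cutoff_apply, map_mul, conj_radialBump s (norm_nonneg x)]
  congr 1
  by_cases hx : x = 0
  · simp [radialExt, hx]
  · rw [radialExt_of_ne _ hx, radialExt_of_ne _ hx, TestAlgebra.star_apply]

theorem conj_rayMellin (s : ℂ) (g : Eucl n → ℂ) (x : Eucl n) :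
    conj (rayMellin s g x) = rayMellin (conj s) (fun x => conj (g x)) x := by
  rw [rayMellin, ← integral_conj]
  refine setIntegral_congr_fun measurableSet_Ioi fun r hr => ?_
  have hr' : (0 : ℝ) < r := hr
  simp only [smul_eq_mul, map_mul]
  congr 1
  have h1 : conj s - 1 = conj (s - 1) := by simp
  rw [h1, Complex.cpow_conj _ _ (by rw [Complex.arg_ofReal_of_nonneg hr'.le]; exact
    Real.pi_ne_zero.symm), Complex.conj_ofReal]

theorem conj_fourier_cutoff (s : ℂ) (f : (evenTest n).Space) (x : Eucl n) :
    conj (FourierTransform.fourier (cutoff n s f) x) =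
      FourierTransform.fourier (cutoff n (conj s) (star f)) x := by
  rw [← fourier_neg_of_even (cutoff_neg _ _) x, fourier_coe, fourier_coe, Real.fourier_eq',
    Real.fourier_eq', ← integral_conj]
  refine integral_congr_ae (Eventually.of_forall fun v => ?_)
  simp only [smul_eq_mul, map_mul, conj_cutoff, ← Complex.exp_conj, Complex.conj_ofReal,
    Complex.conj_I, inner_neg_right]
  congr 2
  push_cast
  ring

/-- Conjugating a Fourier transform reflects its argument, which evenness undoes; in the bump and in
the Mellin integral conjugation only conjugates the exponent. -/
theorem star_homFourier {s : ℂ} (hs' : s.re < n + 1) (f : (evenTest n).Space) :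
    star (homFourier n s f) = homFourier n (conj s) (star f) := by
  ext w
  rw [TestAlgebra.star_apply, homFourier_eq, homFourier_eq,
    rayCLM_apply (re_sub hs') (fourier_neg_of_even (cutoff_neg _ _)),
    rayCLM_apply (re_sub (by simpa using hs')) (fourier_neg_of_even (cutoff_neg _ _)),
    conj_rayMellin]
  simp only [conj_fourier_cutoff]
  congr 1
  simp

end evenTest

/-! ### The surface measure as the image of a product measure. -/

section Slice

variable {n : ℕ}

/-- Coordinates of an orthonormal basis whose first vector is ξ: t is the coordinate along ξ and y
describes the orthogonal complement. -/
theorem exists_slicing (ξ : Sph n) : ∃ e : (ℝ × EuclideanSpace ℝ (Fin n)) →L[ℝ] Eucl n,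
    MeasurePreserving e (volume.prod volume) volume ∧
    (∀ t y, ‖e (t, y)‖ ^ 2 = t ^ 2 + ‖y‖ ^ 2) ∧ ∀ t y, ⟪(ξ : Eucl n), e (t, y)⟫ = t := by
  obtain ⟨b, hb⟩ : ∃ b : OrthonormalBasis (Fin (n + 1)) ℝ (Eucl n), b 0 = ξ := by
    have hv : Orthonormal ℝ (({0} : Set (Fin (n + 1))).domRestrict fun _ => (ξ : Eucl n)) := by
      refine ⟨fun i => norm_sphere ξ, fun i j hij => ?_⟩
      exact absurd (Subsingleton.elim i j) hij
    obtain ⟨b, hb⟩ := hv.exists_orthonormalBasis_extension_of_card_eq (by simp)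
    exact ⟨b, hb 0 rfl⟩
  let L : (ℝ × EuclideanSpace ℝ (Fin n)) →ₗ[ℝ] Eucl n :=
    { toFun := fun p => b.repr.symm (WithLp.toLp 2 (Fin.cons p.1 p.2.ofLp : Fin (n + 1) → ℝ))
      map_add' := fun p q => by
        rw [← map_add]
        congr 1
        ext i
        refine Fin.cases ?_ (fun j => ?_) i <;> simp
      map_smul' := fun a p => by
        rw [RingHom.id_apply, ← map_smul]
        congr 1
        ext i
        refine Fin.cases ?_ (fun j => ?_) i <;> simp }
  have hL : ∀ t y, L (t, y) = b.repr.symm (WithLp.toLp 2 (Fin.cons t y.ofLp : Fin (n + 1) → ℝ)) :=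
    fun _ _ => rfl
  refine ⟨LinearMap.toContinuousLinearMap L, ?_, fun t y => ?_, fun t y => ?_⟩
  · have h1 : MeasurePreserving (Prod.map id (fun y : EuclideanSpace ℝ (Fin n) => y.ofLp))
        (volume.prod volume) ((volume : Measure ℝ).prod (volume : Measure (Fin n → ℝ))) :=
      (MeasurePreserving.id _).prod (PiLp.volume_preserving_ofLp (Fin n))
    have h2 := (volume_preserving_piFinSuccAbove (fun _ : Fin (n + 1) => ℝ) 0).symm
    have h3 := b.measurePreserving_repr_symm.comp
      ((PiLp.volume_preserving_toLp (Fin (n + 1))).comp (h2.comp h1))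
    have h4 : (LinearMap.toContinuousLinearMap L : _ → Eucl n) = b.repr.symm ∘ WithLp.toLp 2 ∘
        (MeasurableEquiv.piFinSuccAbove (fun _ => ℝ) 0).symm ∘
        Prod.map id (fun y : EuclideanSpace ℝ (Fin n) => y.ofLp) := by
      ext1 p
      change b.repr.symm (WithLp.toLp 2 (Fin.cons p.1 p.2.ofLp : Fin (n + 1) → ℝ)) =
        b.repr.symm (WithLp.toLp 2 (Fin.insertNth (0 : Fin (n + 1)) (α := fun _ => ℝ) p.1 p.2.ofLp))
      rw [Fin.insertNth_zero]
      rfl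
    rw [h4]
    exact h3
  · change ‖L (t, y)‖ ^ 2 = _
    rw [hL, LinearIsometryEquiv.norm_map, EuclideanSpace.norm_sq_eq, EuclideanSpace.norm_sq_eq,
      Fin.sum_univ_succ]
    simp
  · change ⟪(ξ : Eucl n), L (t, y)⟫ = _
    rw [hL, ← hb, ← b.repr_apply_apply, LinearIsometryEquiv.apply_symm_apply]
    simp

/-- The distance of `x` from the line spanned by `ξ`. -/
noncomputable def axisDist (ξ : Sph n) (x : Eucl n) : ℝ := √(‖x‖ ^ 2 - ⟪(ξ : Eucl n), x⟫ ^ 2)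

theorem axisDist_slicing {ξ : Sph n} {e : (ℝ × EuclideanSpace ℝ (Fin n)) →L[ℝ] Eucl n}
    (he : ∀ t y, ‖e (t, y)‖ ^ 2 = t ^ 2 + ‖y‖ ^ 2) (hξ : ∀ t y, ⟪(ξ : Eucl n), e (t, y)⟫ = t)
    (t : ℝ) (y : EuclideanSpace ℝ (Fin n)) : axisDist ξ (e (t, y)) = ‖y‖ := by
  rw [axisDist, he, hξ, add_sub_cancel_left, Real.sqrt_sq (norm_nonneg _)]

theorem axisDist_smul (ξ : Sph n) {r : ℝ} (hr : 0 ≤ r) (x : Eucl n) :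
    axisDist ξ (r • x) = r * axisDist ξ x := by
  rw [axisDist, axisDist, norm_smul, inner_smul_right, Real.norm_of_nonneg hr,
    mul_pow, mul_pow, ← mul_sub, Real.sqrt_mul (by positivity), Real.sqrt_sq hr]

theorem continuous_axisDist (ξ : Sph n) : Continuous (axisDist ξ) := by
  unfold axisDist
  fun_prop

theorem axisDist_nonneg (ξ : Sph n) (x : Eucl n) : 0 ≤ axisDist ξ x := Real.sqrt_nonneg _

theorem ae_axisDist_ne_zero (hn : 1 ≤ n) (ξ : Sph n) :
    ∀ᵐ w : Sph n ∂(sphereMeasure n), axisDist ξ (w : Eucl n) ≠ 0 := by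
  obtain ⟨e, hm, he, hξ⟩ := exists_slicing ξ
  have : NeZero n := ⟨by omega⟩
  have hs : MeasurableSet {x : Eucl n | axisDist ξ x = 0} :=
    (isClosed_eq (continuous_axisDist ξ) continuous_const).measurableSet
  have h0 : (volume : Measure (Eucl n)) {x | axisDist ξ x = 0} = 0 := by
    rw [← hm.measure_preimage hs.nullMeasurableSet]
    have : e ⁻¹' {x | axisDist ξ x = 0} = univ ×ˢ {0} := by
      ext ⟨t, y⟩
      simp [axisDist_slicing he hξ]
    rw [this, Measure.prod_prod]
    simp
  have hs' : MeasurableSet {w : Sph n | axisDist ξ (w : Eucl n) = 0} :=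
    measurable_subtype_coe hs
  rw [ae_iff]
  simp only [not_not]
  rw [sphereMeasure, Measure.toSphere_apply' _ hs', mul_eq_zero]
  right
  refine measure_mono_null ?_ h0
  rintro _ ⟨r, hr, _, ⟨w, hw, rfl⟩, rfl⟩
  simp only [mem_ofPred_eq] at hw ⊢
  rw [axisDist_smul ξ hr.1.le, hw, mul_zero]

/-- The central projection to the sphere, with the value `ξ` at the origin. -/
noncomputable def sphereProjAt (ξ : Sph n) (x : Eucl n) : Sph n :=
  open Classical in if hx : x ≠ 0 then sphereProj x hx else ξ

theorem sphereProjAt_of_ne (ξ : Sph n) {x : Eucl n} (hx : x ≠ 0) :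
    sphereProjAt ξ x = sphereProj x hx := by rw [sphereProjAt, dif_pos hx]

theorem coe_sphereProjAt (ξ : Sph n) {x : Eucl n} (hx : x ≠ 0) :
    (sphereProjAt ξ x : Eucl n) = ‖x‖⁻¹ • x := by rw [sphereProjAt_of_ne ξ hx]; rfl

theorem sphereProjAt_smul_coe (ξ : Sph n) {r : ℝ} (hr : 0 < r) (w : Sph n) :
    sphereProjAt ξ (r • (w : Eucl n)) = w := by
  ext1
  rw [coe_sphereProjAt ξ (smul_ne_zero hr.ne' (sphere_ne_zero w)), norm_smul, norm_sphere, mul_one,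
    Real.norm_of_nonneg hr.le, smul_smul, inv_mul_cancel₀ hr.ne', one_smul]

theorem sphereProjAt_smul (ξ : Sph n) {r : ℝ} (hr : 0 < r) (x : Eucl n) :
    sphereProjAt ξ (r • x) = sphereProjAt ξ x := by
  by_cases hx : x = 0
  · rw [hx, smul_zero]
  · ext1
    rw [coe_sphereProjAt ξ hx, coe_sphereProjAt ξ (smul_ne_zero hr.ne' hx), norm_smul,
      Real.norm_of_nonneg hr.le, smul_smul, mul_inv]
    congr 1
    field_simp

theorem measurable_sphereProjAt (ξ : Sph n) : Measurable (sphereProjAt ξ) := by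
  refine Measurable.subtype_mk (f := fun x => ((sphereProjAt ξ x : Sph n) : Eucl n)) ?_
    (h := fun x => (sphereProjAt ξ x).2)
  have : (fun x : Eucl n => (sphereProjAt ξ x : Eucl n)) =
      fun x => if x = 0 then (ξ : Eucl n) else ‖x‖⁻¹ • x := by
    ext1 x
    split_ifs with hx
    · rw [sphereProjAt, dif_neg (not_not.2 hx)]
    · exact coe_sphereProjAt ξ hx
  rw [this]
  exact Measurable.ite (measurableSet_singleton 0) measurable_const (by fun_prop)

/-- The map `(u, y) ↦ (u ξ + y / ‖y‖) / √(1 + u²)` to the sphere, in the coordinates `e`. -/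
noncomputable def sliceMap (ξ : Sph n) (e : (ℝ × EuclideanSpace ℝ (Fin n)) →L[ℝ] Eucl n)
    (p : ℝ × EuclideanSpace ℝ (Fin n)) : Sph n :=
  sphereProjAt ξ (e (p.1, ‖p.2‖⁻¹ • p.2))

theorem measurable_sliceMap (ξ : Sph n) (e : (ℝ × EuclideanSpace ℝ (Fin n)) →L[ℝ] Eucl n) :
    Measurable (sliceMap ξ e) :=
  (measurable_sphereProjAt ξ).comp (e.continuous.measurable.comp (by fun_prop))

theorem lintegral_mul_comp_mul_left (f : ℝ → ENNReal) {a : ℝ} (ha : 0 < a) (hf : Measurable f) :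
    ∫⁻ t, f t = ENNReal.ofReal a * ∫⁻ u, f (a * u) := by
  have h := Real.map_volume_mul_left ha.ne'
  have h1 : ∫⁻ u, f (a * u) = ENNReal.ofReal |a⁻¹| * ∫⁻ t, f t := by
    rw [← lintegral_map hf (measurable_const_mul a), h, lintegral_smul_measure, smul_eq_mul]
  rw [h1, ← mul_assoc, ← ENNReal.ofReal_mul ha.le, abs_of_pos (inv_pos.2 ha),
    mul_inv_cancel₀ ha.ne', ENNReal.ofReal_one, one_mul]

/-- The first factor of the measure on `ℝ × ℝ^n` that is mapped to the surface measure. -/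
noncomputable def sliceMeasureLine (n : ℕ) : Measure ℝ :=
  volume.withDensity fun u => ENNReal.ofReal ((√(1 + u ^ 2) ^ (n + 1))⁻¹)

/-- The second factor of the measure on `ℝ × ℝ^n` that is mapped to the surface measure. -/
noncomputable def sliceMeasureSpace (n : ℕ) : Measure (EuclideanSpace ℝ (Fin n)) :=
  volume.withDensity fun y => ENNReal.ofReal (‖y‖ * lineBump ‖y‖)

instance : SFinite (sliceMeasureLine n) := by rw [sliceMeasureLine]; infer_instance
instance : SFinite (sliceMeasureSpace n) := by rw [sliceMeasureSpace]; infer_instance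

/-- The power a^(n+1) is the Jacobian of q = r a for the measure r^n dr, so the result does not
depend on a. -/
theorem lintegral_bump_axisDist {a : ℝ} (ha : 0 < a) :
    ∫⁻ r in Ioi (0 : ℝ), ENNReal.ofReal (r ^ n) * ENNReal.ofReal (a ^ (n + 1) * lineBump (r * a)) =
      ENNReal.ofReal (bumpMass n) := by
  have hb : Continuous fun r => lineBump r := lineBump.continuous
  have h1 : ∫⁻ r in Ioi (0 : ℝ), ENNReal.ofReal (r ^ n) *
      ENNReal.ofReal (a ^ (n + 1) * lineBump (r * a)) =
      ENNReal.ofReal a * ∫⁻ r, (Ioi (0 : ℝ)).indicator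
        (fun q => ENNReal.ofReal (q ^ n * lineBump q)) (a * r) := by
    have hmi : Measurable fun r => (Ioi (0 : ℝ)).indicator
        (fun q => ENNReal.ofReal (q ^ n * lineBump q)) (a * r) :=
      (Measurable.indicator (f := fun q => ENNReal.ofReal (q ^ n * lineBump q)) (by fun_prop)
        measurableSet_Ioi).comp (measurable_const_mul a)
    rw [← lintegral_const_mul _ hmi, ← lintegral_indicator measurableSet_Ioi]
    refine lintegral_congr fun r => ?_
    by_cases hr : 0 < r
    · rw [indicator_of_mem (show r ∈ Ioi (0 : ℝ) from hr),
        indicator_of_mem (show a * r ∈ Ioi (0 : ℝ) from mul_pos ha hr),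
        ← ENNReal.ofReal_mul (by positivity), ← ENNReal.ofReal_mul ha.le, mul_comm r a]
      congr 1
      ring
    · rw [indicator_of_notMem (show r ∉ Ioi (0 : ℝ) from hr), indicator_of_notMem, mul_zero]
      simp only [mem_Ioi, not_lt] at hr ⊢
      exact mul_nonpos_of_nonneg_of_nonpos ha.le hr
  rw [h1, ← lintegral_mul_comp_mul_left _ ha (Measurable.indicator (by fun_prop)
    measurableSet_Ioi), lintegral_indicator measurableSet_Ioi, bumpMass,
    ofReal_integral_eq_lintegral_ofReal (integrableOn_rpow_mul_lineBump n)]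
  · simp only [Real.rpow_natCast]
  · filter_upwards [ae_restrict_mem measurableSet_Ioi] with r hr
    exact mul_nonneg (Real.rpow_nonneg (le_of_lt hr) _) lineBump.nonneg

/-- With d the distance to the axis ℝξ, integrate G(x/‖x‖) (d/‖x‖)^(n+1) bump(d) over ℝ^(n+1) in two
ways. In polar coordinates the radial integral is the constant `bumpMass n`, which leaves the
surface integral of G. In the coordinates (t, y) one has d = ‖y‖, and t = ‖y‖ u separates the
density into functions of u and of y. Integrating over y in ℝ^n, and not over a smaller sphere,
treats all n ≥ 1 alike. -/
theorem map_sliceMap (hn : 1 ≤ n) {ξ : Sph n}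
    {e : (ℝ × EuclideanSpace ℝ (Fin n)) →L[ℝ] Eucl n}
    (hm : MeasurePreserving e (volume.prod volume) volume)
    (he : ∀ t y, ‖e (t, y)‖ ^ 2 = t ^ 2 + ‖y‖ ^ 2) (hξ : ∀ t y, ⟪(ξ : Eucl n), e (t, y)⟫ = t) :
    ((sliceMeasureLine n).prod (sliceMeasureSpace n)).map (sliceMap ξ e) =
      ENNReal.ofReal (bumpMass n) • sphereMeasure n := by
  have hb : Continuous fun r => lineBump r := lineBump.continuous
  have hd := continuous_axisDist ξ
  refine Measure.ext_of_lintegral _ fun G hG => ?_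
  rw [lintegral_smul_measure, lintegral_map hG (measurable_sliceMap ξ e), smul_eq_mul]
  have hGp : Measurable fun x => G (sphereProjAt ξ x) := hG.comp (measurable_sphereProjAt ξ)
  have hdens : Measurable fun x : Eucl n => ENNReal.ofReal
      ((axisDist ξ x / ‖x‖) ^ (n + 1) * lineBump (axisDist ξ x)) := by
    refine ENNReal.measurable_ofReal.comp ?_
    refine Measurable.mul ?_ (hb.comp hd).measurable
    exact (hd.measurable.div measurable_norm).pow_const _
  have hF : Measurable fun x : Eucl n => G (sphereProjAt ξ x) *
      ENNReal.ofReal ((axisDist ξ x / ‖x‖) ^ (n + 1) * lineBump (axisDist ξ x)) := hGp.mul hdens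
  have hFe : Measurable fun p => G (sphereProjAt ξ (e p)) *
      ENNReal.ofReal ((axisDist ξ (e p) / ‖e p‖) ^ (n + 1) * lineBump (axisDist ξ (e p))) :=
    hF.comp hm.measurable
  have hGs : Measurable fun p => G (sliceMap ξ e p) := hG.comp (measurable_sliceMap ξ e)
  have h1 : ENNReal.ofReal (bumpMass n) * ∫⁻ w, G w ∂(sphereMeasure n) =
      ∫⁻ x : Eucl n, G (sphereProjAt ξ x) *
        ENNReal.ofReal ((axisDist ξ x / ‖x‖) ^ (n + 1) * lineBump (axisDist ξ x)) := by
    rw [lintegral_polar volume hF, finrank_eucl, add_tsub_cancel_right,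
      ← lintegral_const_mul _ hG]
    refine lintegral_congr_ae ?_
    filter_upwards [ae_axisDist_ne_zero hn ξ] with w hw
    have hw0 : 0 < axisDist ξ (w : Eucl n) := lt_of_le_of_ne (axisDist_nonneg ξ _) (Ne.symm hw)
    rw [← lintegral_bump_axisDist hw0, mul_comm, ← lintegral_const_mul _ (by fun_prop)]
    refine setLIntegral_congr_fun measurableSet_Ioi fun r hr => ?_
    have hr' : (0 : ℝ) < r := hr
    rw [sphereProjAt_smul_coe ξ hr', axisDist_smul ξ hr'.le, norm_smul, norm_sphere, mul_one,
      Real.norm_of_nonneg hr'.le, mul_div_cancel_left₀ _ hr'.ne']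
    ring
  rw [h1, ← hm.lintegral_comp hF, lintegral_prod_symm' _
    hFe, lintegral_prod_symm' _
    hGs, sliceMeasureSpace,
    lintegral_withDensity_eq_lintegral_mul _ (by fun_prop)
      (hGs.lintegral_prod_left')]
  refine lintegral_congr fun y => ?_
  simp only [Pi.mul_apply]
  by_cases hy : lineBump ‖y‖ = 0
  · simp [axisDist_slicing he hξ, hy]
  have hy0 : 0 < ‖y‖ := by
    refine lt_of_le_of_ne (norm_nonneg _) fun h => hy ?_
    rw [← h]
    exact lineBump_eq_zero (Or.inl zero_le_one)
  have hGy : Measurable fun u => G (sliceMap ξ e (u, y)) := hGs.comp measurable_prodMk_right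
  have hFy : Measurable fun u => G (sphereProjAt ξ (e (u, y))) *
      ENNReal.ofReal ((axisDist ξ (e (u, y)) / ‖e (u, y)‖) ^ (n + 1) *
        lineBump (axisDist ξ (e (u, y)))) := hFe.comp measurable_prodMk_right
  rw [sliceMeasureLine, lintegral_withDensity_eq_lintegral_mul _ (by fun_prop)
      hGy,
    lintegral_mul_comp_mul_left _ hy0
      hFy,
    ENNReal.ofReal_mul hy0.le, mul_assoc, ← lintegral_const_mul]
  · congr 1
    refine lintegral_congr fun u => ?_
    simp only [Pi.mul_apply]
    -- After t = ‖y‖ u the point is a positive multiple of the argument of the projection in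
    -- `sliceMap`, and d/‖x‖ becomes (1 + u²)^(-1/2).
    have h2 : e (‖y‖ * u, y) = ‖y‖ • e (u, ‖y‖⁻¹ • y) := by
      rw [← map_smul, Prod.smul_mk, smul_smul, mul_inv_cancel₀ hy0.ne', one_smul, smul_eq_mul]
    have h3 : ‖e (u, ‖y‖⁻¹ • y)‖ = √(1 + u ^ 2) := by
      rw [eq_comm, Real.sqrt_eq_iff_mul_self_eq (by positivity) (norm_nonneg _), ← sq, he,
        norm_smul, norm_inv, norm_norm, inv_mul_cancel₀ hy0.ne']
      ring
    rw [axisDist_slicing he hξ, h2, sphereProjAt_smul ξ hy0, norm_smul, norm_norm, h3, sliceMap,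
      ENNReal.ofReal_mul (by positivity)]
    have h4 : ‖y‖ / (‖y‖ * √(1 + u ^ 2)) = (√(1 + u ^ 2))⁻¹ := by
      have : 0 < √(1 + u ^ 2) := Real.sqrt_pos.2 (by positivity)
      field_simp
    rw [h4, inv_pow]
    ring
  · exact Measurable.mul (by fun_prop) hGy

end Slice

/-- The integral is the convolution of the constant 1 with y ↦ K(u, -y), evaluated at 0, so
smoothness of convolutions with a parameter applies. -/
theorem contDiff_integral_of_isCompact {G : Type} [NormedAddCommGroup G] [NormedSpace ℝ G]
    [FiniteDimensional ℝ G] [MeasurableSpace G] [BorelSpace G] (μ : Measure G) [μ.IsAddHaarMeasure]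
    {K : ℝ × G → ℂ} (hK : ContDiff ℝ ∞ K) {k : Set G} (hk : IsCompact k)
    (h0 : ∀ u, ∀ y ∉ k, K (u, y) = 0) : ContDiff ℝ ∞ fun u => ∫ y, K (u, y) ∂μ := by
  have h := contDiffOn_convolution_right_with_param (μ := μ) (n := ⊤) (f := fun _ : G => (1 : ℝ))
    (ContinuousLinearMap.lsmul ℝ ℝ) (g := fun u y => K (u, -y)) isOpen_univ hk.neg
    (fun u y _ hy => h0 u _ hy) (locallyIntegrable_const 1)
    (hK.comp (contDiff_fst.prodMk contDiff_snd.neg)).contDiffOn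
  rw [univ_prod_univ, contDiffOn_univ] at h
  have h1 : ContDiff ℝ ∞ fun u : ℝ => convolution (fun _ : G => (1 : ℝ)) (fun y => K (u, -y))
      (ContinuousLinearMap.lsmul ℝ ℝ) μ 0 :=
    h.comp (contDiff_id.prodMk (contDiff_const (c := (0 : G))))
  simpa [convolution] using h1

/-! ### The substitution t = u / √(1 + u²). -/

section Chord

/-- The map `u ↦ u / √(1 + u²)` of the line onto `(-1, 1)`. -/
noncomputable def chord (u : ℝ) : ℝ := u / √(1 + u ^ 2)

theorem sqrt_one_add_sq_pos (u : ℝ) : 0 < √(1 + u ^ 2) := Real.sqrt_pos.2 (by positivity)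

theorem sq_sqrt_one_add_sq (u : ℝ) : √(1 + u ^ 2) ^ 2 = 1 + u ^ 2 := Real.sq_sqrt (by positivity)

theorem sqrt_one_sub_chord_sq (u : ℝ) : √(1 - chord u ^ 2) = (√(1 + u ^ 2))⁻¹ := by
  rw [chord, div_pow, sq_sqrt_one_add_sq, ← Real.sqrt_inv]
  congr 1
  field_simp
  ring

theorem chord_div_sqrt (u : ℝ) : chord u / √(1 - chord u ^ 2) = u := by
  rw [sqrt_one_sub_chord_sq, chord]
  have := sqrt_one_add_sq_pos u
  field_simp

theorem chord_injective : Function.Injective chord :=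
  Function.LeftInverse.injective (g := fun t => t / √(1 - t ^ 2)) chord_div_sqrt

theorem chord_image : chord '' univ = Ioo (-1) 1 := by
  rw [image_univ]
  ext t
  constructor
  · rintro ⟨u, rfl⟩
    have h1 : |u| < √(1 + u ^ 2) := by
      rw [← Real.sqrt_sq_eq_abs]
      exact Real.sqrt_lt_sqrt (sq_nonneg u) (by linarith)
    rw [mem_Ioo, ← abs_lt, chord, abs_div, abs_of_pos (sqrt_one_add_sq_pos u),
      div_lt_one (sqrt_one_add_sq_pos u)]
    exact h1
  · intro ht
    have h1 : 0 < 1 - t ^ 2 := by nlinarith [ht.1, ht.2]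
    have h2 : 0 < √(1 - t ^ 2) := Real.sqrt_pos.2 h1
    refine ⟨t / √(1 - t ^ 2), ?_⟩
    have h3 : √(1 + (t / √(1 - t ^ 2)) ^ 2) = (√(1 - t ^ 2))⁻¹ := by
      rw [div_pow, Real.sq_sqrt h1.le, ← Real.sqrt_inv]
      congr 1
      field_simp
      ring
    rw [chord, h3]
    field_simp

theorem hasDerivAt_chord (u : ℝ) : HasDerivAt chord ((√(1 + u ^ 2) ^ 3)⁻¹) u := by
  have h1 : HasDerivAt (fun u : ℝ => √(1 + u ^ 2)) (2 * u / (2 * √(1 + u ^ 2))) u := by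
    refine HasDerivAt.sqrt ?_ (by positivity)
    simpa using (hasDerivAt_pow 2 u).const_add 1
  have h2 := (hasDerivAt_id u).div h1 (sqrt_one_add_sq_pos u).ne'
  refine h2.congr_deriv ?_
  have h3 := sqrt_one_add_sq_pos u
  have h4 := sq_sqrt_one_add_sq u
  simp only [id]
  field_simp
  rw [h4]
  ring

end Chord

/-! ### The smooth slice density. -/

namespace evenTest

variable {n : ℕ} {ξ : Sph n} {e : (ℝ × EuclideanSpace ℝ (Fin n)) →L[ℝ] Eucl n}

theorem slicing_ne_zero (he : ∀ t y, ‖e (t, y)‖ ^ 2 = t ^ 2 + ‖y‖ ^ 2) (u : ℝ)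
    {y : EuclideanSpace ℝ (Fin n)} (hy : y ≠ 0) : e (u, ‖y‖⁻¹ • y) ≠ 0 := by
  intro h
  have h1 := he u (‖y‖⁻¹ • y)
  rw [h, norm_smul, norm_inv, norm_norm, inv_mul_cancel₀ (norm_ne_zero_iff.2 hy)] at h1
  simp only [norm_zero] at h1
  nlinarith [sq_nonneg u]

theorem inner_sliceMap (he : ∀ t y, ‖e (t, y)‖ ^ 2 = t ^ 2 + ‖y‖ ^ 2)
    (hξ : ∀ t y, ⟪(ξ : Eucl n), e (t, y)⟫ = t) (u : ℝ)
    {y : EuclideanSpace ℝ (Fin n)} (hy : y ≠ 0) :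
    ⟪(ξ : Eucl n), (sliceMap ξ e (u, y) : Eucl n)⟫ = chord u := by
  have h3 : ‖e (u, ‖y‖⁻¹ • y)‖ = √(1 + u ^ 2) := by
    rw [eq_comm, Real.sqrt_eq_iff_mul_self_eq (by positivity) (norm_nonneg _), ← sq, he,
      norm_smul, norm_inv, norm_norm, inv_mul_cancel₀ (norm_ne_zero_iff.2 hy)]
    ring
  rw [sliceMap, coe_sphereProjAt ξ (slicing_ne_zero he u hy), inner_smul_right, hξ, h3, chord,
    inv_mul_eq_div]

/-- The integral of `f` over the slice with the parameter `u`. -/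
noncomputable def sliceAvg (ξ : Sph n) (e : (ℝ × EuclideanSpace ℝ (Fin n)) →L[ℝ] Eucl n)
    (f : Sph n → ℂ) (u : ℝ) : ℂ := ∫ y, f (sliceMap ξ e (u, y)) ∂(sliceMeasureSpace n)

/-- The weight ‖y‖ bump(‖y‖) vanishes near y = 0, the only place where y/‖y‖ is singular, and
outside a ball, so the integrand is smooth in (u, y) with compact support in y. -/
theorem contDiff_sliceAvg (he : ∀ t y, ‖e (t, y)‖ ^ 2 = t ^ 2 + ‖y‖ ^ 2)
    (f : (evenTest n).Space) : ContDiff ℝ ∞ (sliceAvg ξ e f) := by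
  let K : ℝ × EuclideanSpace ℝ (Fin n) → ℂ := fun p =>
    ((‖p.2‖ * lineBump ‖p.2‖ : ℝ) : ℂ) * radialExt f (e (p.1, ‖p.2‖⁻¹ • p.2))
  have hK : ContDiff ℝ ∞ K := by
    rw [contDiff_iff_contDiffAt]
    rintro ⟨u, y⟩
    by_cases hy : y = 0
    · refine (contDiffAt_const (c := (0 : ℂ))).congr_of_eventuallyEq ?_
      have : ∀ᶠ p : ℝ × EuclideanSpace ℝ (Fin n) in 𝓝 (u, y), ‖p.2‖ < 1 := by
        refine (continuous_snd.norm.tendsto (u, y)).eventually_lt_const ?_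
        simp [hy]
      filter_upwards [this] with p hp
      simp [K, lineBump_eq_zero (Or.inl hp.le)]
    · have h1 : ContDiffAt ℝ ∞ (fun p : ℝ × EuclideanSpace ℝ (Fin n) => ‖p.2‖) (u, y) :=
        (contDiffAt_norm ℝ hy).comp (u, y) contDiffAt_snd
      have h2 : ContDiffAt ℝ ∞ (fun p : ℝ × EuclideanSpace ℝ (Fin n) =>
          e (p.1, ‖p.2‖⁻¹ • p.2)) (u, y) :=
        e.contDiff.contDiffAt.comp (u, y) (contDiffAt_fst.prodMk
          ((h1.inv (norm_ne_zero_iff.2 hy)).smul contDiffAt_snd))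
      refine ContDiffAt.mul (Complex.ofRealCLM.contDiff.contDiffAt.comp (u, y)
        (h1.mul (lineBump.contDiff.contDiffAt.comp (u, y) h1))) ?_
      exact ContDiffAt.comp (u, y) (contDiffAt f (slicing_ne_zero he u hy)) h2
  have h := contDiff_integral_of_isCompact (volume : Measure (EuclideanSpace ℝ (Fin n))) hK
    (isCompact_closedBall 0 3) (fun u y hy => by
      simp only [Metric.mem_closedBall, dist_zero_right, not_le] at hy
      simp [K, lineBump_eq_zero (Or.inr hy.le)])
  convert h using 2 with u
  rw [sliceAvg, sliceMeasureSpace, integral_withDensity_eq_integral_toReal_smul (by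
    have := lineBump.continuous
    fun_prop) (Eventually.of_forall fun _ => ENNReal.ofReal_lt_top)]
  refine integral_congr_ae (Eventually.of_forall fun y => ?_)
  simp only [K]
  rw [ENNReal.toReal_ofReal (mul_nonneg (norm_nonneg _) lineBump.nonneg), Complex.real_smul]
  by_cases hy : y = 0
  · simp [hy]
  · rw [radialExt_of_ne _ (slicing_ne_zero he u hy), sliceMap,
      sphereProjAt_of_ne ξ (slicing_ne_zero he u hy)]

/-- The slice density of `f` with respect to the surface measure. -/
noncomputable def sliceDensity (ξ : Sph n) (e : (ℝ × EuclideanSpace ℝ (Fin n)) →L[ℝ] Eucl n)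
    (f : Sph n → ℂ) (t : ℝ) : ℂ :=
  (((bumpMass n)⁻¹ * (√(1 - t ^ 2) ^ (n + 1) / √(1 - t ^ 2) ^ 3) : ℝ) : ℂ) *
    sliceAvg ξ e f (t / √(1 - t ^ 2))

theorem contDiffOn_sliceDensity (he : ∀ t y, ‖e (t, y)‖ ^ 2 = t ^ 2 + ‖y‖ ^ 2)
    (f : (evenTest n).Space) : ContDiffOn ℝ ∞ (sliceDensity ξ e f) (Ioo (-1) 1) := by
  intro t ht
  have h1 : 0 < 1 - t ^ 2 := by nlinarith [ht.1, ht.2]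
  have h2 : √(1 - t ^ 2) ≠ 0 := (Real.sqrt_pos.2 h1).ne'
  have h3 : ContDiffAt ℝ ∞ (fun t : ℝ => √(1 - t ^ 2)) t :=
    ContDiffAt.sqrt (by fun_prop) h1.ne'
  refine ContDiffAt.contDiffWithinAt (ContDiffAt.mul ?_ ?_)
  · exact Complex.ofRealCLM.contDiff.contDiffAt.comp t (contDiffAt_const.mul
      ((h3.pow _).div (h3.pow _) (pow_ne_zero _ h2)))
  · exact (contDiff_sliceAvg he f).contDiffAt.comp t (contDiffAt_id.div h3 h2)

/-- The Jacobian of `chord` is (1 + u²)^(-3/2); the cube in the denominator of `sliceDensity`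
cancels it and leaves the density of `sliceMeasureLine`. -/
theorem abs_deriv_smul_sliceDensity (f : Sph n → ℂ) (g : ℝ → ℂ) (u : ℝ) :
    |(√(1 + u ^ 2) ^ 3)⁻¹| • (sliceDensity ξ e f (chord u) * g (chord u)) =
      (bumpMass n : ℂ)⁻¹ * ((√(1 + u ^ 2) ^ (n + 1))⁻¹ • (sliceAvg ξ e f u * g (chord u))) := by
  have h := sqrt_one_add_sq_pos u
  rw [abs_of_pos (by positivity), sliceDensity, chord_div_sqrt, sqrt_one_sub_chord_sq,
    Complex.real_smul, Complex.real_smul, inv_pow, inv_pow]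
  push_cast
  have h' : ((√(1 + u ^ 2) : ℝ) : ℂ) ≠ 0 := by exact_mod_cast h.ne'
  field_simp

/-- Integration over the sphere in slices. -/
theorem integral_mul_inner (hn : 1 ≤ n)
    (hm : MeasurePreserving e (volume.prod volume) volume)
    (he : ∀ t y, ‖e (t, y)‖ ^ 2 = t ^ 2 + ‖y‖ ^ 2) (hξ : ∀ t y, ⟪(ξ : Eucl n), e (t, y)⟫ = t)
    (f : (evenTest n).Space) {g : ℝ → ℂ} (hg : Measurable g)
    (hi : Integrable (fun w : Sph n => f w * g ⟪(ξ : Eucl n), w⟫) (sphereMeasure n)) :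
    IntegrableOn (fun t => sliceDensity ξ e f t * g t) (Ioo (-1) 1) ∧
    ∫ w : Sph n, f w * g ⟪(ξ : Eucl n), w⟫ ∂(sphereMeasure n) =
      ∫ t in Ioo (-1) 1, sliceDensity ξ e f t * g t := by
  have : NeZero n := ⟨by omega⟩
  have hM : 0 < bumpMass n := bumpMass_pos n
  set F : Sph n → ℂ := fun w => f w * g ⟪(ξ : Eucl n), w⟫ with hF
  have hFm : Measurable F := (continuous_fn f).measurable.mul
    (hg.comp (Continuous.measurable (by fun_prop)))
  have hmap := map_sliceMap hn hm he hξ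
  have h1 : Integrable (F ∘ sliceMap ξ e) ((sliceMeasureLine n).prod (sliceMeasureSpace n)) := by
    rw [← integrable_map_measure hFm.aestronglyMeasurable (measurable_sliceMap ξ e).aemeasurable,
      hmap]
    exact hi.smul_measure ENNReal.ofReal_ne_top
  have h2 : ∫ p, F (sliceMap ξ e p) ∂((sliceMeasureLine n).prod (sliceMeasureSpace n)) =
      bumpMass n • ∫ w, F w ∂(sphereMeasure n) := by
    rw [← integral_map (measurable_sliceMap ξ e).aemeasurable hFm.aestronglyMeasurable, hmap,
      integral_smul_measure, ENNReal.toReal_ofReal hM.le]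
  have hne : ∀ᵐ y ∂(sliceMeasureSpace n), y ≠ 0 :=
    (withDensity_absolutelyContinuous volume _).ae_le (Measure.ae_ne volume 0)
  have h3 : ∀ u, ∫ y, F (sliceMap ξ e (u, y)) ∂(sliceMeasureSpace n) =
      sliceAvg ξ e f u * g (chord u) := by
    intro u
    rw [sliceAvg, ← integral_mul_const]
    refine integral_congr_ae ?_
    filter_upwards [hne] with y hy
    simp only [hF]
    rw [inner_sliceMap he hξ u hy]
  have h4 := h1.integral_prod_left
  simp only [Function.comp_apply, h3] at h4
  rw [integral_prod (fun p => F (sliceMap ξ e p)) h1] at h2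
  simp only [h3] at h2
  have hdm : Measurable fun u : ℝ => ENNReal.ofReal ((√(1 + u ^ 2) ^ (n + 1))⁻¹) := by fun_prop
  have hlt : ∀ᵐ u : ℝ, ENNReal.ofReal ((√(1 + u ^ 2) ^ (n + 1))⁻¹) < ⊤ :=
    Eventually.of_forall fun _ => ENNReal.ofReal_lt_top
  have hto : ∀ u : ℝ, (ENNReal.ofReal ((√(1 + u ^ 2) ^ (n + 1))⁻¹)).toReal =
      (√(1 + u ^ 2) ^ (n + 1))⁻¹ := fun u => ENNReal.toReal_ofReal (by positivity)
  rw [sliceMeasureLine, integrable_withDensity_iff_integrable_smul' hdm hlt] at h4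
  rw [sliceMeasureLine, integral_withDensity_eq_integral_toReal_smul hdm hlt] at h2
  simp only [hto] at h2 h4
  have hd : ∀ u ∈ univ, HasDerivWithinAt chord ((√(1 + u ^ 2) ^ 3)⁻¹) univ u :=
    fun u _ => (hasDerivAt_chord u).hasDerivWithinAt
  rw [← chord_image, integrableOn_image_iff_integrableOn_abs_deriv_smul MeasurableSet.univ hd
    chord_injective.injOn, integral_image_eq_integral_abs_deriv_smul MeasurableSet.univ hd
    chord_injective.injOn]
  simp only [abs_deriv_smul_sliceDensity, integrableOn_univ, setIntegral_univ]
  refine ⟨h4.const_mul _, ?_⟩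
  rw [integral_const_mul, h2, Complex.real_smul, ← mul_assoc, inv_mul_cancel₀, one_mul]
  exact_mod_cast hM.ne'

end evenTest

/-! ### Integrability of powers of |⟨ξ,w⟩|. -/

section PowerInner

variable {n : ℕ}

theorem integrableOn_abs_rpow {a : ℝ} (ha : -1 < a) :
    IntegrableOn (fun t : ℝ => |t| ^ a) (Ioo (-1) 1) := by
  have h1 : IntervalIntegrable (fun t : ℝ => |t| ^ a) volume 0 1 := by
    refine (intervalIntegral.intervalIntegrable_rpow' ha).congr ?_
    intro t ht
    rw [uIoc_of_le zero_le_one] at ht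
    simp only [abs_of_pos ht.1]
  have h2 : IntervalIntegrable (fun t : ℝ => |t| ^ a) volume (-1) 0 := by
    have := h1.comp_sub_left 0
    simp only [zero_sub, abs_neg, neg_zero] at this
    simpa using this.symm
  have h3 := (h2.trans h1)
  rw [intervalIntegrable_iff_integrableOn_Ioo_of_le (by norm_num)] at h3
  exact h3

/-- The integral of |⟨ξ,x⟩|^a over the unit ball is finite, since the ball lies in a cylinder with
axis ξ. In polar coordinates it is the sphere integral times a nonzero radial factor, so the sphere
integral is finite too. -/
theorem integrable_abs_inner_rpow (ξ : Sph n) {a : ℝ} (ha : -1 < a) :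
    Integrable (fun w : Sph n => |⟪(ξ : Eucl n), w⟫| ^ a) (sphereMeasure n) := by
  obtain ⟨e, hm, he, hξ⟩ := exists_slicing ξ
  have hms : Measurable fun x : Eucl n => ENNReal.ofReal (|⟪(ξ : Eucl n), x⟫| ^ a) := by fun_prop
  have hmw : Measurable fun w : Sph n => ENNReal.ofReal (|⟪(ξ : Eucl n), w⟫| ^ a) :=
    hms.comp measurable_subtype_coe
  let B : Set (Eucl n) := Metric.ball 0 1
  have hBm : MeasurableSet B := measurableSet_ball
  have hfin : ∫⁻ x : Eucl n, B.indicator (fun x => ENNReal.ofReal (|⟪(ξ : Eucl n), x⟫| ^ a)) x < ⊤ := by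
    rw [← hm.lintegral_comp (hms.indicator hBm)]
    have hle : ∀ p : ℝ × EuclideanSpace ℝ (Fin n),
        B.indicator (fun x => ENNReal.ofReal (|⟪(ξ : Eucl n), x⟫| ^ a)) (e p) ≤
        (Ioo (-1 : ℝ) 1).indicator (fun t => ENNReal.ofReal (|t| ^ a)) p.1 *
          (Metric.ball (0 : EuclideanSpace ℝ (Fin n)) 1).indicator 1 p.2 := by
      rintro ⟨t, y⟩
      by_cases hp : e (t, y) ∈ B
      · have h1 : ‖e (t, y)‖ < 1 := by simpa [B] using hp
        have h2 : t ^ 2 + ‖y‖ ^ 2 < 1 := by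
          rw [← he]
          nlinarith [norm_nonneg (e (t, y))]
        have h3 : t ∈ Ioo (-1 : ℝ) 1 := by
          rw [mem_Ioo, ← abs_lt, ← sq_lt_one_iff_abs_lt_one]
          nlinarith [sq_nonneg ‖y‖]
        have h4 : y ∈ Metric.ball (0 : EuclideanSpace ℝ (Fin n)) 1 := by
          rw [Metric.mem_ball, dist_zero_right, ← sq_lt_one_iff₀ (norm_nonneg _)]
          nlinarith [sq_nonneg t]
        rw [indicator_of_mem hp, indicator_of_mem h3, indicator_of_mem h4, hξ]
        simp
      · rw [indicator_of_notMem hp]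
        exact zero_le
    refine (lintegral_mono hle).trans_lt ?_
    rw [lintegral_prod_mul (Measurable.aemeasurable (Measurable.indicator (by fun_prop)
      measurableSet_Ioo)) (Measurable.aemeasurable (measurable_one.indicator measurableSet_ball)),
      lintegral_indicator_one measurableSet_ball, lintegral_indicator measurableSet_Ioo]
    refine ENNReal.mul_lt_top ?_ measure_ball_lt_top
    rw [← ofReal_integral_eq_lintegral_ofReal (integrableOn_abs_rpow ha)
      (Eventually.of_forall fun _ => Real.rpow_nonneg (abs_nonneg _) _)]
    exact ENNReal.ofReal_lt_top
  rw [lintegral_polar volume (hms.indicator hBm)] at hfin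
  have hrad : ∀ w : Sph n, ∫⁻ r in Ioi (0 : ℝ),
      ENNReal.ofReal (r ^ (Module.finrank ℝ (Eucl n) - 1)) *
        B.indicator (fun x => ENNReal.ofReal (|⟪(ξ : Eucl n), x⟫| ^ a)) (r • (w : Eucl n)) =
      (∫⁻ r in Ioo (0 : ℝ) 1, ENNReal.ofReal (r ^ n * r ^ a)) *
        ENNReal.ofReal (|⟪(ξ : Eucl n), w⟫| ^ a) := by
    intro w
    rw [finrank_eucl, add_tsub_cancel_right, ← lintegral_mul_const _ (by fun_prop),
      ← lintegral_indicator measurableSet_Ioi, ← lintegral_indicator measurableSet_Ioo]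
    refine lintegral_congr fun r => ?_
    by_cases hr : 0 < r
    · rw [indicator_of_mem (show r ∈ Ioi (0 : ℝ) from hr)]
      have hB : r • (w : Eucl n) ∈ B ↔ r ∈ Ioo (0 : ℝ) 1 := by
        simp [B, norm_smul, abs_of_pos hr, hr]
      by_cases hr1 : r ∈ Ioo (0 : ℝ) 1
      · rw [indicator_of_mem hr1, indicator_of_mem (hB.2 hr1), inner_smul_right, abs_mul,
          abs_of_pos hr, Real.mul_rpow hr.le (abs_nonneg _), ENNReal.ofReal_mul (by positivity),
          ENNReal.ofReal_mul (by positivity), mul_assoc]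
      · rw [indicator_of_notMem hr1, indicator_of_notMem (mt hB.1 hr1), mul_zero]
    · rw [indicator_of_notMem (show r ∉ Ioi (0 : ℝ) from hr),
        indicator_of_notMem fun h => hr h.1]
  simp only [hrad] at hfin
  rw [lintegral_const_mul _ hmw] at hfin
  have hpos : ∫⁻ r in Ioo (0 : ℝ) 1, ENNReal.ofReal (r ^ n * r ^ a) ≠ 0 := by
    rw [← pos_iff_ne_zero, setLIntegral_pos_iff (by fun_prop)]
    have : Ioo (0 : ℝ) 1 ⊆ (Function.support fun r : ℝ => ENNReal.ofReal (r ^ n * r ^ a)) ∩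
        Ioo 0 1 := by
      intro r hr
      have := hr.1
      refine ⟨?_, hr⟩
      simp only [Function.mem_support, ne_eq, ENNReal.ofReal_eq_zero, not_le]
      positivity
    exact lt_of_lt_of_le (by simp) (measure_mono this)
  refine ⟨(Measurable.aestronglyMeasurable (by fun_prop)), ?_⟩
  rw [hasFiniteIntegral_iff_ofReal (Eventually.of_forall fun _ =>
    Real.rpow_nonneg (abs_nonneg _) _)]
  by_contra hcon
  rw [not_lt, top_le_iff] at hcon
  rw [← sphereMeasure, hcon, ENNReal.mul_top hpos] at hfin
  exact lt_irrefl _ hfin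

theorem norm_ofReal_cpow_le {x : ℝ} (hx : 0 ≤ x) (z : ℂ) : ‖(x : ℂ) ^ z‖ ≤ x ^ z.re := by
  rcases hx.eq_or_lt with rfl | hx
  · by_cases hz : z = 0
    · simp [hz]
    · simpa [Complex.zero_cpow hz] using Real.rpow_nonneg le_rfl _
  · rw [Complex.norm_cpow_eq_rpow_re_of_pos hx]

theorem integrable_mul_abs_inner_cpow (f : (evenTest n).Space) (ξ : Sph n) {z : ℂ}
    (hz : -1 < z.re) : Integrable (fun w : Sph n =>
      f w * (((|⟪(ξ : Eucl n), w⟫| : ℝ) : ℂ)) ^ z) (sphereMeasure n) := by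
  have h1 : Integrable (fun w : Sph n => (((|⟪(ξ : Eucl n), w⟫| : ℝ) : ℂ)) ^ z)
      (sphereMeasure n) := by
    refine (integrable_abs_inner_rpow ξ (a := z.re) hz).mono'
      (Measurable.aestronglyMeasurable (by fun_prop)) (Eventually.of_forall fun w => ?_)
    exact norm_ofReal_cpow_le (abs_nonneg _) z
  obtain ⟨C, hC⟩ := isCompact_univ.exists_bound_of_continuousOn
    (evenTest.continuous_fn f).continuousOn
  exact h1.bdd_mul (evenTest.continuous_fn f).aestronglyMeasurable
    (Eventually.of_forall fun w => hC w (mem_univ w))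

theorem integrable_sphereIntegrand (c : ℝ≥0) (f : (evenTest n).Space) (ξ : Sph n) {z : ℂ}
    (hz : -1 < z.re) : Integrable (sphereIntegrand f ξ z) (c • sphereMeasure n) := by
  refine Integrable.smul_measure_nnreal (((integrable_mul_abs_inner_cpow f ξ hz).div_const
    (Complex.Gamma ((z + 1) / 2))).congr (Eventually.of_forall fun w => ?_))
  exact mul_div_assoc _ _ _

end PowerInner

/-! ### Analytic continuation of ∫ φ(t) |t|^z dt / Γ((z+1)/2). -/

section Continuation

theorem isOpen_re_gt (a : ℝ) : IsOpen {z : ℂ | a < z.re} :=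
  isOpen_lt continuous_const Complex.continuous_re

theorem eqOn_re_gt {f g : ℂ → ℂ} {a b : ℝ} (hf : DifferentiableOn ℂ f {z | a < z.re})
    (hg : DifferentiableOn ℂ g {z | a < z.re}) (h : ∀ z : ℂ, b < z.re → f z = g z) :
    EqOn f g {z | a < z.re} := by
  refine (hf.analyticOnNhd (isOpen_re_gt a)).eqOn_of_preconnected_of_eventuallyEq
    (hg.analyticOnNhd (isOpen_re_gt a)) (convex_halfSpace_re_gt a).isPreconnected
    (z₀ := ((max a b + 1 : ℝ) : ℂ)) ?_ ?_
  · simp only [mem_ofPred_eq, Complex.ofReal_re]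
    linarith [le_max_left a b]
  · refine Filter.eventually_of_mem ((isOpen_re_gt b).mem_nhds ?_) h
    simp only [mem_ofPred_eq, Complex.ofReal_re]
    linarith [le_max_right a b]

/-- Gluing of analytic continuations to larger and larger half planes. -/
theorem exists_entire_of_re_gt {Ψ : ℕ → ℂ → ℂ} {a : ℕ → ℝ} (b : ℝ) (ha : Tendsto a atTop atBot)
    (hd : ∀ M, DifferentiableOn ℂ (Ψ M) {z | a M < z.re})
    (h : ∀ M z, b < z.re → Ψ M z = Ψ 0 z) :
    ∃ Φ : ℂ → ℂ, Differentiable ℂ Φ ∧ ∀ M z, a M < z.re → Φ z = Ψ M z := by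
  have hex : ∀ z : ℂ, ∃ M, a M < z.re := fun z => (ha.eventually_lt_atBot z.re).exists
  choose m hm using hex
  -- The arbitrary choice of m z is harmless: two of the functions agree for Re z > b, hence on the
  -- half plane where both are analytic.
  have key : ∀ M z, a M < z.re → Ψ (m z) z = Ψ M z := by
    intro M z hz
    refine eqOn_re_gt (a := max (a M) (a (m z))) (b := b) ((hd _).mono fun w hw => ?_)
      ((hd _).mono fun w hw => ?_) (fun w hw => by rw [h _ w hw, h M w hw]) ?_
    · exact lt_of_le_of_lt (le_max_right (a M) (a (m z))) hw
    · exact lt_of_le_of_lt (le_max_left (a M) (a (m z))) hw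
    · exact max_lt hz (hm z)
  refine ⟨fun z => Ψ (m z) z, fun z => ?_, key⟩
  have h1 : DifferentiableAt ℂ (Ψ (m z)) z :=
    (hd (m z)).differentiableAt ((isOpen_re_gt _).mem_nhds (hm z))
  refine h1.congr_of_eventuallyEq ?_
  exact Filter.eventually_of_mem ((isOpen_re_gt _).mem_nhds (hm z)) (key (m z))

theorem inv_Gamma_eq_prod (w : ℂ) (k : ℕ) :
    (Complex.Gamma w)⁻¹ = (∏ i ∈ Finset.range k, (w + i)) * (Complex.Gamma (w + k))⁻¹ := by
  induction k with
  | zero => simp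
  | succ k ih =>
    rw [ih, Complex.one_div_Gamma_eq_self_mul_one_div_Gamma_add_one (w + k),
      Finset.prod_range_succ]
    push_cast
    rw [add_assoc w, mul_assoc]

/-- The entire function `1 / ((s + 2 j) Γ(s / 2))`. -/
noncomputable def invGammaQuot (j : ℕ) (s : ℂ) : ℂ :=
  2⁻¹ * ((∏ i ∈ Finset.range j, (s / 2 + i)) * (Complex.Gamma (s / 2 + (j + 1 : ℕ)))⁻¹)

theorem differentiable_invGammaQuot (j : ℕ) : Differentiable ℂ (invGammaQuot j) := by
  unfold invGammaQuot
  refine (Differentiable.mul ?_ ?_).const_mul _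
  · fun_prop
  · exact Complex.differentiable_one_div_Gamma.comp (by fun_prop)

/-- Expanding 1/Γ(s/2) by j + 1 steps of the functional equation exhibits the factor s/2 + j = (s +
2j)/2, which removes the pole. -/
theorem invGammaQuot_eq (j : ℕ) {s : ℂ} (hs : s + (2 * j : ℕ) ≠ 0) :
    1 / (s + (2 * j : ℕ)) / Complex.Gamma (s / 2) = invGammaQuot j s := by
  rw [div_eq_mul_inv _ (Complex.Gamma (s / 2)), inv_Gamma_eq_prod (s / 2) (j + 1),
    Finset.prod_range_succ, invGammaQuot]
  have : s / 2 + j = (s + (2 * j : ℕ)) / 2 := by push_cast; ring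
  rw [this]
  field_simp

theorem prod_range_neg_add (k : ℕ) :
    ∏ i ∈ Finset.range k, (-(k : ℂ) + i) = (-1) ^ k * (k.factorial : ℂ) := by
  induction k with
  | zero => simp
  | succ k ih =>
    rw [Finset.prod_range_succ', Nat.factorial_succ]
    have : ∀ i ∈ Finset.range k, (-((k + 1 : ℕ) : ℂ) + ((i + 1 : ℕ) : ℂ)) = -(k : ℂ) + i := by
      intro i _
      push_cast
      ring
    rw [Finset.prod_congr rfl this, ih]
    push_cast
    ring

/-- For j < k the remaining factor 1/Γ still vanishes at the point; for j = k it is 1/Γ(1), and the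
product of the other factors is (-1)^k k!. The value 0 of `Complex.Gamma` at its poles, with 0⁻¹ =
0, is the correct value of 1/Γ. -/
theorem invGammaQuot_neg (k j : ℕ) (hj : j ≤ k) : invGammaQuot j (-(2 * k : ℂ)) =
    if j = k then 2⁻¹ * ((-1) ^ k * (k.factorial : ℂ)) else 0 := by
  have h2 : -(2 * k : ℂ) / 2 = -(k : ℂ) := by ring
  rw [invGammaQuot, h2]
  split_ifs with h
  · rw [h, prod_range_neg_add]
    push_cast
    simp
  · obtain ⟨l, rfl⟩ : ∃ l, k = j + 1 + l := ⟨k - (j + 1), by omega⟩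
    have : (-((j + 1 + l : ℕ) : ℂ) + (j + 1 : ℕ)) = -(l : ℂ) := by push_cast; ring
    rw [this, Complex.Gamma_neg_nat_eq_zero]
    simp

theorem sum_range_two_mul {M : Type*} [AddCommMonoid M] (F : ℕ → M) (k : ℕ) :
    ∑ m ∈ Finset.range (2 * k), F m = ∑ j ∈ Finset.range k, (F (2 * j) + F (2 * j + 1)) := by
  induction k with
  | zero => simp
  | succ k ih => rw [mul_add, mul_one, Finset.sum_range_succ, Finset.sum_range_succ, ih,
      Finset.sum_range_succ, add_assoc]

theorem setIntegral_Ioo_symm {h : ℝ → ℂ} (hi : IntegrableOn h (Ioo (-1) 1)) :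
    IntegrableOn (fun t => h t + h (-t)) (Ioc 0 1) ∧
    ∫ t in Ioo (-1) 1, h t = ∫ t in Ioc 0 1, (h t + h (-t)) := by
  have h1 : IntervalIntegrable h volume (-1) 1 := by
    rwa [intervalIntegrable_iff_integrableOn_Ioo_of_le (by norm_num)]
  have h2 : IntervalIntegrable h volume (-1) 0 := h1.mono_set (by
    rw [uIcc_of_le (by norm_num), uIcc_of_le (by norm_num)]
    exact Icc_subset_Icc le_rfl (by norm_num))
  have h3 : IntervalIntegrable h volume 0 1 := h1.mono_set (by
    rw [uIcc_of_le (by norm_num), uIcc_of_le (by norm_num)]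
    exact Icc_subset_Icc (by norm_num) le_rfl)
  have h4 : IntervalIntegrable (fun t => h (-t)) volume 0 1 := by
    have := h2.comp_sub_left 0
    simpa using this.symm
  refine ⟨?_, ?_⟩
  · rw [← intervalIntegrable_iff_integrableOn_Ioc_of_le zero_le_one]
    exact h3.add h4
  · rw [← integral_Ioc_eq_integral_Ioo, ← intervalIntegral.integral_of_le (by norm_num),
      ← intervalIntegral.integral_of_le zero_le_one, intervalIntegral.integral_add h3 h4,
      intervalIntegral.integral_comp_neg, neg_zero, add_comm,
      intervalIntegral.integral_add_adjacent_intervals h2 h3]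

variable {φ : ℝ → ℂ}

/-- The even part of the Taylor polynomial of degree `2 M - 1` at the origin, doubled. -/
noncomputable def evenTaylor (φ : ℝ → ℂ) (M : ℕ) (t : ℝ) : ℂ :=
  ∑ j ∈ Finset.range M,
    (2 * iteratedDeriv (2 * j) φ 0 / ((2 * j).factorial : ℂ)) * (t : ℂ) ^ ((2 * j : ℕ) : ℂ)

/-- In the Taylor polynomial of φ(t) + φ(-t) the odd terms cancel and the even ones double. -/
theorem isBigO_sub_evenTaylor (hφ : ContDiffOn ℝ ∞ φ (Ioo (-1) 1)) (M : ℕ) :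
    (fun t => φ t + φ (-t) - evenTaylor φ (M + 1) t) =O[𝓝 0] fun t => t ^ (2 * M + 1) := by
  have h0 : (0 : ℝ) ∈ Ioo (-1 : ℝ) 1 := by norm_num
  have h1 := (taylor_isLittleO (n := 2 * M + 1) (convex_Ioo (-1 : ℝ) 1) h0
    (contDiffOn_infty.1 hφ _)).isBigO
  rw [isOpen_Ioo.nhdsWithin_eq h0] at h1
  simp only [sub_zero] at h1
  have h2 : (fun t => φ (-t) - taylorWithinEval φ (2 * M + 1) (Ioo (-1) 1) 0 (-t)) =O[𝓝 0]
      fun t : ℝ => t ^ (2 * M + 1) := by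
    have hneg : Tendsto (fun t : ℝ => -t) (𝓝 0) (𝓝 0) := by
      simpa using (continuous_neg (G := ℝ)).tendsto 0
    refine (h1.comp_tendsto hneg).trans (Asymptotics.isBigO_of_le _ fun t => ?_)
    simp
  refine (h1.add h2).congr_left fun t => ?_
  have h3 : taylorWithinEval φ (2 * M + 1) (Ioo (-1) 1) 0 t +
      taylorWithinEval φ (2 * M + 1) (Ioo (-1) 1) 0 (-t) = evenTaylor φ (M + 1) t := by
    rw [taylor_within_apply, taylor_within_apply, ← Finset.sum_add_distrib,
      show 2 * M + 1 + 1 = 2 * (M + 1) by ring, sum_range_two_mul, evenTaylor]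
    refine Finset.sum_congr rfl fun j _ => ?_
    rw [iteratedDerivWithin_of_isOpen isOpen_Ioo h0, iteratedDerivWithin_of_isOpen isOpen_Ioo h0,
      Complex.cpow_natCast]
    simp only [sub_zero, Complex.real_smul]
    push_cast
    rw [Even.neg_pow (even_two_mul j), Odd.neg_pow (odd_two_mul_add_one j)]
    field_simp
    ring
  rw [← h3]
  ring

/-- The remainder of the Taylor expansion of `φ t + φ (-t)` on `(0, 1]`. -/
noncomputable def taylorRest (φ : ℝ → ℂ) (M : ℕ) : ℝ → ℂ :=
  (Ioc 0 1).indicator fun t => φ t + φ (-t) - evenTaylor φ M t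

theorem continuous_evenTaylor (φ : ℝ → ℂ) (M : ℕ) : Continuous (evenTaylor φ M) := by
  unfold evenTaylor
  simp only [Complex.cpow_natCast]
  fun_prop

theorem locallyIntegrableOn_taylorRest (hi : IntegrableOn φ (Ioo (-1) 1)) (M : ℕ) :
    LocallyIntegrableOn (taylorRest φ M) (Ioi 0) := by
  refine LocallyIntegrable.locallyIntegrableOn ?_ _
  refine Integrable.locallyIntegrable ?_
  rw [taylorRest, integrable_indicator_iff measurableSet_Ioc]
  refine (setIntegral_Ioo_symm hi).1.sub ?_
  exact ((continuous_evenTaylor φ M).continuousOn.integrableOn_Icc).mono_set Ioc_subset_Icc_self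

theorem taylorRest_isBigO_atTop (φ : ℝ → ℂ) (M : ℕ) (a : ℝ) :
    taylorRest φ M =O[atTop] fun t : ℝ => t ^ (-a) := by
  refine (Asymptotics.isBigO_zero _ _).congr' ?_ EventuallyEq.rfl
  filter_upwards [eventually_gt_atTop 1] with t ht
  rw [taylorRest, indicator_of_notMem fun h => absurd h.2 (not_le.2 ht)]

theorem taylorRest_isBigO_zero (hφ : ContDiffOn ℝ ∞ φ (Ioo (-1) 1)) (M : ℕ) :
    taylorRest φ (M + 1) =O[𝓝[>] 0] fun t : ℝ => t ^ (-(-(2 * M + 1) : ℝ)) := by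
  refine ((isBigO_sub_evenTaylor hφ M).mono nhdsWithin_le_nhds).congr' ?_ ?_
  · filter_upwards [Ioc_mem_nhdsGT (zero_lt_one (α := ℝ))] with t ht
    rw [taylorRest, indicator_of_mem ht]
  · filter_upwards with t
    rw [neg_neg, ← Real.rpow_natCast]
    push_cast
    rfl

theorem differentiableAt_mellin_taylorRest (hφ : ContDiffOn ℝ ∞ φ (Ioo (-1) 1))
    (hi : IntegrableOn φ (Ioo (-1) 1)) (M : ℕ) {s : ℂ} (hs : -(2 * M + 1) < s.re) :
    DifferentiableAt ℂ (mellin (taylorRest φ (M + 1))) s :=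
  mellin_differentiableAt_of_isBigO_rpow (locallyIntegrableOn_taylorRest hi _)
    (taylorRest_isBigO_atTop φ _ (s.re + 1)) (by linarith) (taylorRest_isBigO_zero hφ M) hs

theorem mellinConvergent_taylorRest (hφ : ContDiffOn ℝ ∞ φ (Ioo (-1) 1))
    (hi : IntegrableOn φ (Ioo (-1) 1)) (M : ℕ) {s : ℂ} (hs : -(2 * M + 1) < s.re) :
    MellinConvergent (taylorRest φ (M + 1)) s :=
  mellinConvergent_of_isBigO_rpow (locallyIntegrableOn_taylorRest hi _)
    (taylorRest_isBigO_atTop φ _ (s.re + 1)) (by linarith) (taylorRest_isBigO_zero hφ M) hs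

theorem hasMellin_evenTaylor (φ : ℝ → ℂ) (M : ℕ) {s : ℂ} (hs : 0 < s.re) :
    HasMellin ((Ioc 0 1).indicator (evenTaylor φ M)) s (∑ j ∈ Finset.range M,
      (2 * iteratedDeriv (2 * j) φ 0 / ((2 * j).factorial : ℂ)) * (1 / (s + (2 * j : ℕ)))) := by
  induction M with
  | zero =>
    have : (Ioc (0 : ℝ) 1).indicator (evenTaylor φ 0) = fun _ => 0 := by
      ext t
      simp [evenTaylor, indicator]
    rw [this]
    simp [HasMellin, MellinConvergent, mellin]
  | succ M ih =>
    have h1 := hasMellin_cpow_Ioc ((2 * M : ℕ) : ℂ) (s := s) (by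
      rw [Complex.natCast_re]; positivity)
    have h2 := hasMellin_const_smul h1.1
      (2 * iteratedDeriv (2 * M) φ 0 / ((2 * M).factorial : ℂ))
    have h3 := hasMellin_add ih.1 h2.1
    rw [ih.2, h2.2, h1.2] at h3
    rw [Finset.sum_range_succ]
    convert h3 using 1
    · ext1 t
      by_cases ht : t ∈ Ioc (0 : ℝ) 1
      · simp [indicator_of_mem ht, evenTaylor, Finset.sum_range_succ]
      · simp [indicator_of_notMem ht]
    · rfl

/-- Folding (-1, 1) onto (0, 1] gives the Mellin transform at z + 1 of φ(t) + φ(-t). The Taylor part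
integrates to explicit simple fractions; the transform of the remainder converges further to the
left. -/
theorem integral_eq_mellin_taylorRest (hφ : ContDiffOn ℝ ∞ φ (Ioo (-1) 1))
    (hi : IntegrableOn φ (Ioo (-1) 1)) (M : ℕ) {z : ℂ} (hz : -1 < z.re)
    (hiz : IntegrableOn (fun t : ℝ => φ t * ((|t| : ℝ) : ℂ) ^ z) (Ioo (-1) 1)) :
    ∫ t in Ioo (-1 : ℝ) 1, φ t * ((|t| : ℝ) : ℂ) ^ z = mellin (taylorRest φ (M + 1)) (z + 1) +
      ∑ j ∈ Finset.range (M + 1), (2 * iteratedDeriv (2 * j) φ 0 / ((2 * j).factorial : ℂ)) *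
        (1 / (z + 1 + (2 * j : ℕ))) := by
  have hs : 0 < (z + 1).re := by simp only [Complex.add_re, Complex.one_re]; linarith
  have h1 := hasMellin_evenTaylor φ (M + 1) hs
  have h2 := hasMellin_add (mellinConvergent_taylorRest hφ hi M (s := z + 1) (by
    have : (0 : ℝ) ≤ 2 * M := by positivity
    linarith)) h1.1
  rw [← h1.2, ← h2.2, (setIntegral_Ioo_symm hiz).2, mellin, ← integral_indicator measurableSet_Ioc,
    ← integral_indicator measurableSet_Ioi]
  congr 1
  ext1 t
  by_cases ht : t ∈ Ioc (0 : ℝ) 1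
  · rw [indicator_of_mem ht, indicator_of_mem (show t ∈ Ioi (0 : ℝ) from ht.1), taylorRest,
      indicator_of_mem ht, indicator_of_mem ht, abs_neg, abs_of_pos ht.1, smul_eq_mul,
      add_sub_cancel_right]
    ring
  · rw [indicator_of_notMem ht]
    by_cases ht' : t ∈ Ioi (0 : ℝ)
    · rw [indicator_of_mem ht', taylorRest, indicator_of_notMem ht, indicator_of_notMem ht]
      simp
    · rw [indicator_of_notMem ht']

/-- The analytic continuation of `z ↦ ∫ φ t * |t| ^ z / Γ((z + 1) / 2)` and its values at the
points `-2 k - 1`. -/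
theorem exists_entire_integral_abs_cpow (hφ : ContDiffOn ℝ ∞ φ (Ioo (-1) 1))
    (hi : ∀ z : ℂ, -1 < z.re →
      IntegrableOn (fun t : ℝ => φ t * ((|t| : ℝ) : ℂ) ^ z) (Ioo (-1) 1)) :
    ∃ Φ : ℂ → ℂ, Differentiable ℂ Φ ∧
      (∀ z : ℂ, -1 < z.re → Φ z =
        (∫ t in Ioo (-1 : ℝ) 1, φ t * ((|t| : ℝ) : ℂ) ^ z) / Complex.Gamma ((z + 1) / 2)) ∧
      ∀ k : ℕ, Φ (-2 * (k : ℂ) - 1) =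
        (-1) ^ k * (k.factorial : ℂ) / ((2 * k).factorial : ℂ) * iteratedDeriv (2 * k) φ 0 := by
  have hi0 : IntegrableOn φ (Ioo (-1) 1) := by simpa using hi 0 (by simp)
  let Ψ : ℕ → ℂ → ℂ := fun M z =>
    mellin (taylorRest φ (M + 1)) (z + 1) * (Complex.Gamma ((z + 1) / 2))⁻¹ +
      ∑ j ∈ Finset.range (M + 1), (2 * iteratedDeriv (2 * j) φ 0 / ((2 * j).factorial : ℂ)) *
        invGammaQuot j (z + 1)
  have hΨ : ∀ M (z : ℂ), -1 < z.re → Ψ M z =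
      (∫ t in Ioo (-1 : ℝ) 1, φ t * ((|t| : ℝ) : ℂ) ^ z) / Complex.Gamma ((z + 1) / 2) := by
    intro M z hz
    rw [integral_eq_mellin_taylorRest hφ hi0 M hz (hi z hz), add_div, Finset.sum_div,
      div_eq_mul_inv (mellin _ _)]
    simp only [Ψ]
    congr 1
    refine Finset.sum_congr rfl fun j _ => ?_
    rw [mul_div_assoc _ (1 / _) (Complex.Gamma _), invGammaQuot_eq]
    intro h
    have h' := congrArg Complex.re h
    simp only [Complex.add_re, Complex.one_re, Complex.natCast_re, Complex.zero_re] at h'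
    have : (0 : ℝ) ≤ ((2 * j : ℕ) : ℝ) := by positivity
    linarith
  -- The remainder is O(t^(2M+1)), so its Mellin transform is analytic for Re (z + 1) > -(2M + 1).
  have hd : ∀ M, DifferentiableOn ℂ (Ψ M) {z | -(2 * (M : ℝ) + 2) < z.re} := by
    intro M z hz
    refine DifferentiableAt.differentiableWithinAt ?_
    refine DifferentiableAt.add (DifferentiableAt.mul ?_ ?_) ?_
    · have h := differentiableAt_mellin_taylorRest hφ hi0 M (s := z + 1) (by
        simp only [mem_ofPred_eq, Complex.add_re, Complex.one_re] at hz ⊢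
        linarith)
      exact DifferentiableAt.comp z (g := mellin (taylorRest φ (M + 1))) (f := fun z => z + 1) h
        (by fun_prop)
    · exact Complex.differentiable_one_div_Gamma.differentiableAt.comp z
        (f := fun z => (z + 1) / 2) (by fun_prop)
    · refine DifferentiableAt.fun_sum fun j _ => DifferentiableAt.const_mul ?_ _
      exact (differentiable_invGammaQuot j).differentiableAt.comp z (by fun_prop)
  have ha : Tendsto (fun M : ℕ => -(2 * (M : ℝ) + 2)) atTop atBot := by
    refine tendsto_neg_atTop_atBot.comp (tendsto_atTop_add_const_right _ _ ?_)
    exact tendsto_natCast_atTop_atTop.const_mul_atTop two_pos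
  obtain ⟨Φ, hΦ, hΦM⟩ := exists_entire_of_re_gt (-1) ha hd
    (fun M z hz => by rw [hΨ M z hz, hΨ 0 z hz])
  refine ⟨Φ, hΦ, fun z hz => ?_, fun k => ?_⟩
  · rw [hΦM 0 z (by simp; linarith), hΨ 0 z hz]
  -- The choice M = k is enough, as -2k - 1 > -(2k + 2). The remainder term carries the factor
  -- 1/Γ(-k) = 0, and only the summand j = k of the rest is nonzero.
  · rw [hΦM k _ (by simp; linarith)]
    have h1 : -2 * (k : ℂ) - 1 + 1 = -(2 * k : ℂ) := by ring
    have h2 : -(2 * k : ℂ) / 2 = -(k : ℂ) := by ring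
    simp only [Ψ]
    rw [h1, h2, Complex.Gamma_neg_nat_eq_zero, inv_zero, mul_zero, zero_add,
      Finset.sum_congr rfl fun j hj => by
        rw [invGammaQuot_neg k j (Nat.lt_succ_iff.1 (Finset.mem_range.1 hj))]]
    rw [Finset.sum_range_succ, Finset.sum_eq_zero, zero_add, if_pos rfl]
    · field_simp
    · intro j hj
      rw [if_neg (Finset.mem_range.1 hj).ne, mul_zero]

end Continuation

/-! ### Uniqueness of slice density and continuation; locality. -/

section SliceUnique

theorem integrable_mul_of_tsupport_subset {φ g : ℝ → ℂ} {U : Set ℝ} (hU : IsOpen U)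
    (hφ : ContinuousOn φ U) (hg : Continuous g) (hc : HasCompactSupport g) (hs : tsupport g ⊆ U) :
    Integrable fun t => φ t * g t := by
  refine Continuous.integrable_of_hasCompactSupport ?_ hc.mul_left
  refine continuous_iff_continuousAt.2 fun t => ?_
  by_cases ht : t ∈ tsupport g
  · exact (hφ.continuousAt (hU.mem_nhds (hs ht))).mul hg.continuousAt
  · refine (continuousAt_const (y := (0 : ℂ))).congr ?_
    filter_upwards [notMem_tsupport_iff_eventuallyEq.1 ht] with u hu
    rw [hu, Pi.zero_apply, mul_zero]

theorem eqOn_zero_of_integral_mul_eq_zero {φ : ℝ → ℂ} {U : Set ℝ} (hU : IsOpen U)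
    (hφ : ContinuousOn φ U)
    (h : ∀ g : ℝ → ℂ, Continuous g → HasCompactSupport g → tsupport g ⊆ U → ∫ t, φ t * g t = 0) :
    EqOn φ 0 U := by
  refine Measure.eqOn_open_of_ae_eq (μ := volume) ?_ hU hφ continuousOn_const
  rw [EventuallyEq, ae_restrict_iff' hU.measurableSet]
  refine hU.ae_eq_zero_of_integral_contDiff_smul_eq_zero
    (hφ.locallyIntegrableOn hU.measurableSet) fun g hg hc hs => ?_
  have hsub : tsupport (fun t => ((g t : ℝ) : ℂ)) ⊆ tsupport g :=
    closure_mono fun t ht hgt => ht (by simp [hgt])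
  rw [← h (fun t => ((g t : ℝ) : ℂ)) (Complex.continuous_ofReal.comp hg.continuous)
    (hc.comp_left Complex.ofReal_zero) (hsub.trans hs)]
  refine integral_congr_ae (Eventually.of_forall fun t => ?_)
  simp only
  rw [Complex.real_smul, mul_comm]

variable {n : ℕ} {μ : Measure (Sph n)} {f : Sph n → ℂ} {ξ : Sph n}

theorem IsSliceDensity.eqOn {φ ψ : ℝ → ℂ} (hφ : IsSliceDensity μ f ξ φ)
    (hψ : IsSliceDensity μ f ξ ψ) : EqOn φ ψ (Ioo (-1) 1) := by
  have h := eqOn_zero_of_integral_mul_eq_zero (φ := fun t => φ t - ψ t) (U := Ioo (-1) 1)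
    isOpen_Ioo (hφ.1.continuousOn.sub hψ.1.continuousOn) fun g hg hc hs => by
      simp only [sub_mul]
      rw [integral_sub (integrable_mul_of_tsupport_subset isOpen_Ioo hφ.1.continuousOn hg hc hs)
        (integrable_mul_of_tsupport_subset isOpen_Ioo hψ.1.continuousOn hg hc hs),
        ← hφ.2 g hg hc hs, ← hψ.2 g hg hc hs, sub_self]
  exact fun t ht => sub_eq_zero.1 (h ht)

theorem deltaTransform_eq {φ : ℝ → ℂ} (hφ : IsSliceDensity μ f ξ φ) (m : ℕ) :
    deltaTransform μ m f ξ = (-1) ^ m * iteratedDeriv m φ 0 := by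
  have h : ∃ φ : ℝ → ℂ, IsSliceDensity μ f ξ φ := ⟨φ, hφ⟩
  rw [deltaTransform, dif_pos h]
  congr 1
  refine Filter.EventuallyEq.iteratedDeriv_eq _ ?_
  exact Filter.eventually_of_mem (Ioo_mem_nhds (by norm_num) (by norm_num))
    (h.choose_spec.eqOn hφ)

/-- The complement of V is compact, so ⟨ξ,·⟩ maps it to a closed set that misses 0. Test functions
supported near 0 therefore see only points where f vanishes. -/
theorem IsSliceDensity.eventually_eq_zero {φ : ℝ → ℂ} (hφ : IsSliceDensity μ f ξ φ)
    {V : Set (Sph n)} (hV : IsOpen V) (hξ : {w : Sph n | ⟪(ξ : Eucl n), w⟫ = 0} ⊆ V)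
    (h0 : ∀ w ∈ V, f w = 0) : φ =ᶠ[𝓝 0] 0 := by
  let p : Sph n → ℝ := fun w => ⟪(ξ : Eucl n), w⟫
  have hp : Continuous p := by fun_prop
  let U : Set ℝ := (p '' Vᶜ)ᶜ ∩ Ioo (-1) 1
  have hU : IsOpen U :=
    (hV.isClosed_compl.isCompact.image hp).isClosed.isOpen_compl.inter isOpen_Ioo
  have hmem : (0 : ℝ) ∈ U := by
    refine ⟨?_, by norm_num⟩
    rintro ⟨w, hw, hw0⟩
    exact hw (hξ hw0)
  refine Filter.eventually_of_mem (hU.mem_nhds hmem) ?_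
  refine eqOn_zero_of_integral_mul_eq_zero hU (hφ.1.continuousOn.mono inter_subset_right)
    fun g hg hc hs => ?_
  rw [← hφ.2 g hg hc (hs.trans inter_subset_right)]
  refine integral_eq_zero_of_ae (Eventually.of_forall fun w => ?_)
  by_cases hw : w ∈ V
  · simp [h0 w hw]
  · have : g (p w) = 0 := by
      by_contra hne
      exact (hs (subset_tsupport g hne)).1 ⟨w, hw, rfl⟩
    simp only [p] at this
    simp [this]

theorem deltaTransform_eq_zero (hex : ∃ φ, IsSliceDensity μ f ξ φ) (m : ℕ)
    {V : Set (Sph n)} (hV : IsOpen V) (hξ : {w : Sph n | ⟪(ξ : Eucl n), w⟫ = 0} ⊆ V)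
    (h0 : ∀ w ∈ V, f w = 0) : deltaTransform μ m f ξ = 0 := by
  obtain ⟨φ, hφ⟩ := hex
  rw [deltaTransform_eq hφ, (hφ.eventually_eq_zero hV hξ h0).iteratedDeriv_eq m]
  have : (0 : ℝ → ℂ) = fun _ => 0 := rfl
  rw [this, iteratedDeriv_const]
  simp

theorem sphereTransform_eq {Φ : ℂ → ℂ} (hΦ : IsSphereContinuation μ f ξ Φ) (z : ℂ) :
    sphereTransform μ z f ξ = Φ z := by
  have h : ∃ Φ : ℂ → ℂ, IsSphereContinuation μ f ξ Φ := ⟨Φ, hΦ⟩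
  rw [sphereTransform, dif_pos h]
  refine eqOn_re_gt (a := z.re - 1) (b := -1) h.choose_spec.1.differentiableOn
    hΦ.1.differentiableOn (fun w hw => ?_) (by simp)
  rw [h.choose_spec.2 w hw, hΦ.2 w hw]

end SliceUnique

/-! ### Existence of slice density and continuation. -/

section SliceExistence

variable {n : ℕ}

theorem integral_nnreal_smul (c : ℝ≥0) (F : Sph n → ℂ) :
    ∫ w, F w ∂(c • sphereMeasure n) = (c : ℂ) * ∫ w, F w ∂(sphereMeasure n) := by
  rw [integral_smul_nnreal_measure, NNReal.smul_def, Complex.real_smul]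

/-- The slice density and the analytic continuation, and the values of the latter that are
derivatives of the former. -/
theorem exists_isSliceDensity_isSphereContinuation (hn : 1 ≤ n) (c : ℝ≥0)
    (f : (evenTest n).Space) (ξ : Sph n) :
    ∃ (φ : ℝ → ℂ) (Φ : ℂ → ℂ), IsSliceDensity (c • sphereMeasure n) f ξ φ ∧
      IsSphereContinuation (c • sphereMeasure n) f ξ Φ ∧
      ∀ k : ℕ, Φ (-2 * (k : ℂ) - 1) =
        (-1) ^ k * (k.factorial : ℂ) / ((2 * k).factorial : ℂ) * iteratedDeriv (2 * k) φ 0 := by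
  obtain ⟨e, hm, he, hξ⟩ := exists_slicing ξ
  set φ : ℝ → ℂ := fun t => (c : ℂ) * evenTest.sliceDensity ξ e f t with hφ
  have hsm : ContDiffOn ℝ ∞ φ (Ioo (-1) 1) :=
    contDiffOn_const.mul (evenTest.contDiffOn_sliceDensity he f)
  have hint : ∀ g : ℝ → ℂ, Measurable g →
      Integrable (fun w : Sph n => f w * g ⟪(ξ : Eucl n), w⟫) (sphereMeasure n) →
      IntegrableOn (fun t => φ t * g t) (Ioo (-1) 1) ∧
      ∫ w : Sph n, f w * g ⟪(ξ : Eucl n), w⟫ ∂(c • sphereMeasure n) =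
        ∫ t in Ioo (-1) 1, φ t * g t := by
    intro g hg hi
    obtain ⟨h1, h2⟩ := evenTest.integral_mul_inner hn hm he hξ f hg hi
    simp only [hφ, mul_assoc]
    refine ⟨h1.const_mul _, ?_⟩
    rw [integral_nnreal_smul, h2, integral_const_mul]
  have hpow : ∀ z : ℂ, -1 < z.re → Integrable (fun w : Sph n =>
      f w * (((|⟪(ξ : Eucl n), w⟫| : ℝ) : ℂ)) ^ z) (sphereMeasure n) :=
    fun z hz => integrable_mul_abs_inner_cpow f ξ hz
  have hmp : ∀ z : ℂ, Measurable fun t : ℝ => ((|t| : ℝ) : ℂ) ^ z := fun z => by fun_prop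
  obtain ⟨Φ, hΦ, hΦ1, hΦ2⟩ := exists_entire_integral_abs_cpow hsm
    fun z hz => (hint _ (hmp z) (hpow z hz)).1
  refine ⟨φ, Φ, ⟨hsm, fun g hg hc hs => ?_⟩, ⟨hΦ, fun z hz => ?_⟩, hΦ2⟩
  · have hi : Integrable (fun w : Sph n => f w * g ⟪(ξ : Eucl n), w⟫) (sphereMeasure n) := by
      have hcont : Continuous fun w : Sph n => f w * g ⟪(ξ : Eucl n), w⟫ :=
        (evenTest.continuous_fn f).mul (hg.comp (by fun_prop))
      exact hcont.integrable_of_hasCompactSupport (HasCompactSupport.of_compactSpace _)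
    rw [(hint g hg.measurable hi).2]
    refine setIntegral_eq_integral_of_forall_compl_eq_zero fun t ht => ?_
    rw [image_eq_zero_of_notMem_tsupport (mt (@hs t) ht), mul_zero]
  · rw [hΦ1 z hz, ← (hint _ (hmp z) (hpow z hz)).2, ← integral_div]
    refine integral_congr_ae (Eventually.of_forall fun w => ?_)
    simp only [sphereIntegrand]
    rw [mul_div_assoc]

end SliceExistence

/-! ### Mellin transforms of Gaussians. -/

section GaussianMellin

/-- Interchange of the Mellin transform with an integral. -/
theorem mellin_integral_swap {Y : Type*} [MeasurableSpace Y] {ν : Measure Y} [SFinite ν]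
    {K : ℝ → Y → ℂ} (hm : Measurable fun p : ℝ × Y => K p.1 p.2) (s : ℂ) {B : Y → ℝ}
    (hB : Integrable B ν) (h1 : ∀ᵐ y ∂ν, MellinConvergent (fun r => K r y) s)
    (h2 : ∀ᵐ y ∂ν, ∫ r in Ioi (0 : ℝ), ‖(r : ℂ) ^ (s - 1) * K r y‖ ≤ B y) :
    mellin (fun r => ∫ y, K r y ∂ν) s = ∫ y, mellin (fun r => K r y) s ∂ν := by
  have hm' : Measurable fun p : ℝ × Y => (p.1 : ℂ) ^ (s - 1) * K p.1 p.2 :=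
    ((measurable_ofReal_cpow (s - 1)).comp measurable_fst).mul hm
  have h : Integrable (fun p : ℝ × Y => (p.1 : ℂ) ^ (s - 1) * K p.1 p.2)
      ((volume.restrict (Ioi 0)).prod ν) := by
    rw [integrable_prod_iff' hm'.aestronglyMeasurable]
    refine ⟨h1, hB.mono' ?_ ?_⟩
    · exact (hm'.norm.aestronglyMeasurable
        (μ := (volume.restrict (Ioi 0)).prod ν)).prod_swap.integral_prod_right'
    · filter_upwards [h2] with y hy
      rwa [Real.norm_of_nonneg (integral_nonneg fun _ => norm_nonneg _)]
  simp only [mellin, smul_eq_mul, ← integral_const_mul]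
  exact integral_integral_swap h

theorem integral_rpow_mul_gaussian {a b : ℝ} (ha : 0 < a) (hb : 0 < b) :
    ∫ r in Ioi (0 : ℝ), r ^ (a - 1) * Real.exp (-b * r ^ 2) =
      b ^ (-a / 2) * (1 / 2) * Real.Gamma (a / 2) := by
  have h := integral_rpow_mul_exp_neg_mul_rpow (p := 2) (q := a - 1) two_pos (by linarith) hb
  simpa only [sub_add_cancel, Real.rpow_two] using h

theorem ofReal_cpow_sub_one {a r : ℝ} (hr : 0 < r) :
    (r : ℂ) ^ ((a : ℂ) - 1) = ((r ^ (a - 1) : ℝ) : ℂ) := by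
  rw [Complex.ofReal_cpow hr.le]
  push_cast
  rfl

theorem hasMellin_gaussian {a b : ℝ} (ha : 0 < a) (hb : 0 < b) :
    HasMellin (fun r : ℝ => ((Real.exp (-b * r ^ 2) : ℝ) : ℂ)) a
      ((b ^ (-a / 2) * (1 / 2) * Real.Gamma (a / 2) : ℝ) : ℂ) := by
  have heq : ∀ r ∈ Ioi (0 : ℝ), ((r ^ (a - 1) * Real.exp (-b * r ^ 2) : ℝ) : ℂ) =
      (r : ℂ) ^ ((a : ℂ) - 1) • ((Real.exp (-b * r ^ 2) : ℝ) : ℂ) := fun r hr => by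
    rw [ofReal_cpow_sub_one hr, smul_eq_mul, Complex.ofReal_mul]
  constructor
  · refine IntegrableOn.congr_fun ?_ heq measurableSet_Ioi
    exact (integrableOn_rpow_mul_exp_neg_mul_sq hb (by linarith)).ofReal
  · rw [mellin, ← setIntegral_congr_fun measurableSet_Ioi heq, integral_complex_ofReal,
      integral_rpow_mul_gaussian ha hb]

theorem integral_norm_cpow_mul_gaussian {a b : ℝ} (ha : 0 < a) (hb : 0 < b) (c : ℂ) :
    ∫ r in Ioi (0 : ℝ), ‖(r : ℂ) ^ ((a : ℂ) - 1) * (c * ((Real.exp (-b * r ^ 2) : ℝ) : ℂ))‖ =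
      ‖c‖ * (b ^ (-a / 2) * (1 / 2) * Real.Gamma (a / 2)) := by
  rw [← integral_rpow_mul_gaussian ha hb, ← integral_const_mul]
  refine setIntegral_congr_fun measurableSet_Ioi fun r hr => ?_
  have hr' : (0 : ℝ) < r := hr
  rw [ofReal_cpow_sub_one hr', norm_mul, norm_mul, Complex.norm_real, Complex.norm_real,
    Real.norm_of_nonneg (Real.rpow_nonneg hr'.le _), Real.norm_of_nonneg (Real.exp_pos _).le]
  ring

theorem pi_mul_sq_rpow {a : ℝ} (t : ℝ) :
    (Real.pi * t ^ 2) ^ (-a / 2) = Real.pi ^ (-a / 2) * |t| ^ (-a) := by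
  rw [Real.mul_rpow Real.pi_pos.le (sq_nonneg t), ← sq_abs, ← Real.rpow_natCast,
    ← Real.rpow_mul (abs_nonneg t)]
  congr 2
  push_cast
  ring

end GaussianMellin

/-! ### The Fourier transform of |⟨ξ,x⟩|^(-a) for 0 < a < 1. -/

section Strip
open SchwartzMap FourierTransform

variable {n : ℕ}

theorem ae_inner_ne_zero (ξ : Sph n) : ∀ᵐ x : Eucl n, ⟪(ξ : Eucl n), x⟫ ≠ 0 := by
  obtain ⟨e, hm, -, hξ⟩ := exists_slicing ξ
  have hs : MeasurableSet {x : Eucl n | ⟪(ξ : Eucl n), x⟫ = 0} :=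
    (isClosed_eq (by fun_prop) continuous_const).measurableSet
  rw [ae_iff]
  simp only [not_not]
  rw [← hm.measure_preimage hs.nullMeasurableSet]
  have : e ⁻¹' {x | ⟪(ξ : Eucl n), x⟫ = 0} = {0} ×ˢ univ := by
    ext ⟨t, y⟩
    simp [hξ]
  rw [this, Measure.prod_prod]
  simp

/-- The integral of `φ` against the Gaussian of the coordinate in the direction `ξ`. -/
noncomputable def gaussPairing (ξ : Sph n) (φ : Eucl n → ℂ) (r : ℝ) : ℂ :=
  ∫ x, φ x * ((Real.exp (-(Real.pi * ⟪(ξ : Eucl n), x⟫ ^ 2) * r ^ 2) : ℝ) : ℂ)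

/-- The power |⟨ξ,x⟩|^(-a) is a superposition of the Gaussians exp(-π⟨ξ,x⟩² r²) over r > 0, with a
Gamma factor. Pairing with Gaussians avoids the Fourier transform of a non-integrable function. -/
theorem mellin_gaussPairing (ξ : Sph n) {φ : Eucl n → ℂ} (hφ : Continuous φ) {a : ℝ} (ha : 0 < a)
    (hi : Integrable fun x => φ x * ((|⟪(ξ : Eucl n), x⟫| ^ (-a) : ℝ) : ℂ)) :
    mellin (gaussPairing ξ φ) a =
      ((Real.pi ^ (-a / 2) * (1 / 2) * Real.Gamma (a / 2) : ℝ) : ℂ) *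
        ∫ x, φ x * ((|⟪(ξ : Eucl n), x⟫| ^ (-a) : ℝ) : ℂ) := by
  have hb : ∀ x : Eucl n, ⟪(ξ : Eucl n), x⟫ ≠ 0 → 0 < Real.pi * ⟪(ξ : Eucl n), x⟫ ^ 2 :=
    fun x hx => by positivity
  unfold gaussPairing
  rw [mellin_integral_swap (B := fun x => ‖φ x * ((|⟪(ξ : Eucl n), x⟫| ^ (-a) : ℝ) : ℂ)‖ *
    (Real.pi ^ (-a / 2) * (1 / 2) * Real.Gamma (a / 2)))]
  · rw [← integral_const_mul]
    refine integral_congr_ae ?_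
    filter_upwards [ae_inner_ne_zero ξ] with x hx
    have h := hasMellin_const_smul (hasMellin_gaussian ha (hb x hx)).1 (φ x)
    simp only [smul_eq_mul] at h
    rw [h.2, (hasMellin_gaussian ha (hb x hx)).2, pi_mul_sq_rpow]
    push_cast
    ring
  · exact Measurable.mul (by fun_prop) (by fun_prop)
  · exact hi.norm.mul_const _
  · filter_upwards [ae_inner_ne_zero ξ] with x hx
    have h := hasMellin_const_smul (hasMellin_gaussian ha (hb x hx)).1 (φ x)
    exact h.1
  · filter_upwards [ae_inner_ne_zero ξ] with x hx
    rw [integral_norm_cpow_mul_gaussian ha (hb x hx), pi_mul_sq_rpow, norm_mul, Complex.norm_real,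
      Real.norm_of_nonneg (Real.rpow_nonneg (abs_nonneg _) _)]
    exact le_of_eq (by ring)

/-- The weight is the one-dimensional Fourier transform of exp(-π v²) at r⟨ξ,x⟩. The bilinear form r
v⟨ξ,x⟩ on ℝ × ℝ^(n+1) moves the transform onto φ, where it is evaluated only on the line ℝξ. -/
theorem gaussPairing_eq (ξ : Sph n) (φ : 𝓢(Eucl n, ℂ)) (r : ℝ) :
    gaussPairing ξ φ r =
      ∫ v : ℝ, 𝓕 φ (r • (v • (ξ : Eucl n))) * ((Real.exp (-Real.pi * v ^ 2) : ℝ) : ℂ) := by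
  let L : ℝ →ₗ[ℝ] Eucl n →ₗ[ℝ] ℝ :=
    LinearMap.mk₂ ℝ (fun v x => r * (v * ⟪(ξ : Eucl n), x⟫)) (by intros; ring)
      (by intros; simp only [smul_eq_mul]; ring) (by intros; rw [inner_add_right]; ring)
      (by intros; rw [inner_smul_right, smul_eq_mul]; ring)
  have hg : Integrable fun v : ℝ => ((Real.exp (-Real.pi * v ^ 2) : ℝ) : ℂ) :=
    (integrable_exp_neg_mul_sq Real.pi_pos).ofReal
  have h := VectorFourier.integral_fourierIntegral_smul_eq_flip (μ := (volume : Measure ℝ))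
    (ν := (volume : Measure (Eucl n))) (L := L) Real.continuous_fourierChar
    (by simp only [L, LinearMap.mk₂_apply]; fun_prop) hg φ.integrable
  have h1 : ∀ x : Eucl n, VectorFourier.fourierIntegral Real.fourierChar volume L
      (fun v : ℝ => ((Real.exp (-Real.pi * v ^ 2) : ℝ) : ℂ)) x =
      ((Real.exp (-(Real.pi * ⟪(ξ : Eucl n), x⟫ ^ 2) * r ^ 2) : ℝ) : ℂ) := by
    intro x
    have h2 := congrFun (fourier_gaussian_pi (b := 1) (by simp)) (r * ⟪(ξ : Eucl n), x⟫)
    rw [Real.fourier_eq] at h2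
    rw [VectorFourier.fourierIntegral]
    refine Eq.trans ?_ (h2.trans ?_)
    · refine integral_congr_ae (Eventually.of_forall fun v => ?_)
      simp only [L, LinearMap.mk₂_apply]
      congr 2
      · simp [mul_comm, mul_left_comm]
      · push_cast
        congr 1
        ring
    · push_cast
      rw [Complex.one_cpow, div_one, div_one, one_mul]
      congr 1
      ring
  have h3 : ∀ v : ℝ, VectorFourier.fourierIntegral Real.fourierChar volume L.flip φ v =
      𝓕 φ (r • (v • (ξ : Eucl n))) := by
    intro v
    rw [fourier_coe, Real.fourier_eq, VectorFourier.fourierIntegral]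
    refine integral_congr_ae (Eventually.of_forall fun x => ?_)
    simp only [L, LinearMap.flip_apply, LinearMap.mk₂_apply]
    rw [inner_smul_right, inner_smul_right, real_inner_comm]
  simp only [h1, h3, smul_eq_mul] at h
  rw [gaussPairing]
  simp only [mul_comm (φ _)]
  rw [h]
  simp only [mul_comm (𝓕 φ _)]

theorem integral_abs_rpow_mul_gaussian {a : ℝ} (ha : a < 1) :
    Integrable (fun v : ℝ => |v| ^ (-a) * Real.exp (-Real.pi * v ^ 2)) ∧
    ∫ v : ℝ, |v| ^ (-a) * Real.exp (-Real.pi * v ^ 2) =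
      Real.pi ^ (-(1 - a) / 2) * Real.Gamma ((1 - a) / 2) := by
  have h1 := integral_rpow_mul_gaussian (a := 1 - a) (by linarith) Real.pi_pos
  have h2 := integral_comp_abs (f := fun v : ℝ => v ^ (-a) * Real.exp (-Real.pi * v ^ 2))
  simp only [sq_abs] at h2
  refine ⟨?_, ?_⟩
  · have h3 := integrable_rpow_mul_exp_neg_mul_sq Real.pi_pos (s := -a) (by linarith)
    have h4 := integrableOn_rpow_mul_exp_neg_mul_sq Real.pi_pos (s := -a) (by linarith)
    have h5 : IntegrableOn (fun v : ℝ => |v| ^ (-a) * Real.exp (-Real.pi * v ^ 2)) (Ioi 0) :=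
      h4.congr_fun (fun v hv => by simp only [abs_of_pos (show (0 : ℝ) < v from hv)])
        measurableSet_Ioi
    rw [← integrableOn_univ, ← Iic_union_Ioi (a := (0 : ℝ))]
    refine IntegrableOn.union ?_ h5
    rw [integrableOn_Iic_iff_integrableOn_Iio]
    rw [← (Measure.measurePreserving_neg (volume : Measure ℝ)).integrableOn_comp_preimage
      (Homeomorph.neg ℝ).measurableEmbedding] at h5
    have h6 : Neg.neg ⁻¹' Ioi (0 : ℝ) = Iio 0 := by
      ext v
      simp
    rw [h6] at h5
    refine h5.congr_fun (fun v _ => ?_) measurableSet_Iio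
    simp only [Function.comp_apply, abs_neg, neg_sq]
  · rw [h2, show -a = 1 - a - 1 by ring, h1]
    ring

/-- For each v the Mellin transform in r is R_a ψ(vξ) = |v|^(-a) R_a ψ(ξ), by homogeneity and
evenness. The remaining integral of |v|^(-a) exp(-π v²) converges at 0 because a < 1 and is the
second Gamma factor. -/
theorem mellin_gaussPairing_eq_rayMellin (ξ : Sph n) (φ : 𝓢(Eucl n, ℂ))
    (hφ : ∀ x, φ (-x) = φ x) {ψ : 𝓢(Eucl n, ℂ)} (hψ : ψ = 𝓕 φ) {a : ℝ} (ha : 0 < a) (ha' : a < 1) :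
    mellin (gaussPairing ξ φ) a =
      ((Real.pi ^ (-(1 - a) / 2) * Real.Gamma ((1 - a) / 2) : ℝ) : ℂ) *
        rayMellin a ψ (ξ : Eucl n) := by
  have hψe : ∀ x, ψ (-x) = ψ x := by
    rw [hψ]
    exact evenTest.fourier_neg_of_even hφ
  have hre : 0 < (a : ℂ).re := by simpa using ha
  obtain ⟨D, hD, hb⟩ := SchwartzMap.exists_integral_norm_ray_le ψ hre
  have hne : ∀ v : ℝ, v ≠ 0 → v • (ξ : Eucl n) ≠ 0 := fun v hv => smul_ne_zero hv (sphere_ne_zero ξ)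
  have hae : ∀ᵐ v : ℝ, v ≠ 0 := Measure.ae_ne volume 0
  obtain ⟨hgi, hgv⟩ := integral_abs_rpow_mul_gaussian ha'
  have hray : ∀ v : ℝ, v ≠ 0 → rayMellin a ψ (v • (ξ : Eucl n)) =
      ((|v| ^ (-a) : ℝ) : ℂ) * rayMellin a ψ (ξ : Eucl n) := by
    intro v hv
    have h1 : rayMellin a ψ (v • (ξ : Eucl n)) = rayMellin a ψ (|v| • (ξ : Eucl n)) := by
      rcases abs_choice v with h | h
      · rw [h]
      · rw [h, neg_smul, evenTest.rayMellin_neg _ (hψe)]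
    rw [h1, rayMellin_smul _ _ (abs_pos.2 hv), Complex.ofReal_cpow (abs_nonneg v)]
    push_cast
    rfl
  have heq : gaussPairing ξ φ = fun r => ∫ v : ℝ, ψ (r • (v • (ξ : Eucl n))) *
      ((Real.exp (-Real.pi * v ^ 2) : ℝ) : ℂ) := by
    rw [hψ]
    exact funext (gaussPairing_eq ξ φ)
  have hcont := ψ.continuous
  rw [heq, mellin_integral_swap (B := fun v => D * (|v| ^ (-a) * Real.exp (-Real.pi * v ^ 2)))]
  · rw [← hgv, ← integral_complex_ofReal, ← integral_mul_const]
    refine integral_congr_ae ?_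
    filter_upwards [hae] with v hv
    have h2 : mellin (fun r => ψ (r • (v • (ξ : Eucl n))) *
        ((Real.exp (-Real.pi * v ^ 2) : ℝ) : ℂ)) a = rayMellin a ψ (v • (ξ : Eucl n)) *
        ((Real.exp (-Real.pi * v ^ 2) : ℝ) : ℂ) := by
      rw [rayMellin_eq_mellin, mellin, mellin, ← integral_mul_const]
      simp only [smul_eq_mul, mul_assoc]
    rw [h2, hray v hv]
    push_cast
    ring
  · exact Continuous.measurable (by fun_prop)
  · exact hgi.const_mul D
  · filter_upwards [hae] with v hv
    have h3 := ψ.mellinConvergent_ray (hne v hv) hre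
    simpa only [MellinConvergent, IntegrableOn, smul_eq_mul, mul_assoc] using
      h3.mul_const ((Real.exp (-Real.pi * v ^ 2) : ℝ) : ℂ)
  · filter_upwards [hae] with v hv
    simp only [← mul_assoc, norm_mul _ (((Real.exp (-Real.pi * v ^ 2) : ℝ) : ℂ))]
    rw [integral_mul_const, Complex.norm_real, Real.norm_of_nonneg (Real.exp_pos _).le]
    refine mul_le_mul_of_nonneg_right ?_ (Real.exp_pos _).le
    have h4 := hb _ (hne v hv)
    rwa [norm_smul, norm_sphere, mul_one, Real.norm_eq_abs] at h4

end Strip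

/-! ### The sphere transform as a multiple of `homFourier`. -/

namespace evenTest
open SchwartzMap FourierTransform

variable {n : ℕ}

theorem mellinConvergent_radialBump (s z : ℂ) : MellinConvergent (radialBump s) z := by
  refine mellinConvergent_of_isBigO_rpow (a := z.re + 1) (b := z.re - 1)
    ((contDiff_radialBump s).continuous.locallyIntegrable.locallyIntegrableOn _) ?_
    (by linarith) ?_ (by linarith)
  · refine (Asymptotics.isBigO_zero _ _).congr' ?_ EventuallyEq.rfl
    filter_upwards [eventually_ge_atTop 3] with r hr
    exact (radialBump_eq_zero s (Or.inr hr)).symm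
  · refine (Asymptotics.isBigO_zero _ _).congr' ?_ EventuallyEq.rfl
    filter_upwards [nhdsWithin_le_nhds (Iio_mem_nhds one_pos)] with r hr
    exact (radialBump_eq_zero s (Or.inl (le_of_lt hr))).symm

/-- In polar coordinates the integrand is a product: the radial part r^(n-a) times the bump gives
the Mellin transform at n + 1 - a, the angular part the sphere integral. -/
theorem integral_cutoff_mul_abs_inner (s : ℂ) (f : (evenTest n).Space) (ξ : Sph n) {a : ℝ}
    (ha : a < 1) :
    Integrable (fun x : Eucl n => cutoff n s f x * ((|⟪(ξ : Eucl n), x⟫| ^ (-a) : ℝ) : ℂ)) ∧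
    ∫ x : Eucl n, cutoff n s f x * ((|⟪(ξ : Eucl n), x⟫| ^ (-a) : ℝ) : ℂ) =
      mellin (radialBump s) ((n : ℂ) + 1 - a) *
        ∫ w : Sph n, f w * ((|⟪(ξ : Eucl n), w⟫| ^ (-a) : ℝ) : ℂ) ∂(sphereMeasure n) := by
  have hS : Integrable (fun w : Sph n => f w * ((|⟪(ξ : Eucl n), w⟫| ^ (-a) : ℝ) : ℂ))
      (sphereMeasure n) := by
    refine (integrable_mul_abs_inner_cpow f ξ (z := ((-a : ℝ) : ℂ)) (by simp; linarith)).congr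
      (Eventually.of_forall fun w => ?_)
    simp only
    rw [Complex.ofReal_cpow (abs_nonneg _)]
  have hpow : ∀ r ∈ Ioi (0 : ℝ), (r : ℂ) ^ ((n : ℂ) + 1 - a - 1) • radialBump s r =
      r ^ n • (((r ^ (-a) : ℝ) : ℂ) * radialBump s r) := by
    intro r hr
    have hr' : (0 : ℝ) < r := hr
    rw [Complex.real_smul, smul_eq_mul, ← mul_assoc, Complex.ofReal_pow,
      Complex.ofReal_cpow hr'.le, ← Complex.cpow_natCast,
      ← Complex.cpow_add _ _ (Complex.ofReal_ne_zero.2 hr'.ne')]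
    congr 2
    push_cast
    ring
  have hR : Integrable (fun r : ℝ => ((r ^ (-a) : ℝ) : ℂ) * radialBump s r) (radialMeasure n) := by
    rw [integrable_radialMeasure]
    exact (mellinConvergent_radialBump s ((n : ℂ) + 1 - a)).congr_fun hpow measurableSet_Ioi
  have hval : ∀ w : Sph n, ∀ r ∈ Ioi (0 : ℝ), cutoff n s f (r • (w : Eucl n)) *
      ((|⟪(ξ : Eucl n), r • (w : Eucl n)⟫| ^ (-a) : ℝ) : ℂ) =
      (f w * ((|⟪(ξ : Eucl n), w⟫| ^ (-a) : ℝ) : ℂ)) *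
        (((r ^ (-a) : ℝ) : ℂ) * radialBump s r) := by
    intro w r hr
    have hr' : (0 : ℝ) < r := hr
    rw [cutoff_apply, radialExt_smul _ hr', radialExt_coe, norm_smul, norm_sphere, mul_one,
      Real.norm_of_nonneg hr'.le, inner_smul_right, abs_mul, abs_of_pos hr',
      Real.mul_rpow hr'.le (abs_nonneg _)]
    push_cast
    ring
  have hI : Integrable (fun x : Eucl n =>
      cutoff n s f x * ((|⟪(ξ : Eucl n), x⟫| ^ (-a) : ℝ) : ℂ)) := by
    have hpres := measurePreserving_polar (volume : Measure (Eucl n))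
    have hc := (cutoff n s f).continuous
    rw [← hpres.integrable_comp (Measurable.aestronglyMeasurable (by fun_prop)), finrank_eucl,
      add_tsub_cancel_right]
    refine (hS.mul_prod hR).congr ?_
    have hpos : ∀ᵐ r ∂(radialMeasure n), r ∈ Ioi (0 : ℝ) :=
      (withDensity_absolutelyContinuous _ _).ae_le (ae_restrict_mem measurableSet_Ioi)
    filter_upwards [Measure.quasiMeasurePreserving_snd.ae hpos] with p hp
    exact (hval p.1 p.2 hp).symm
  refine ⟨hI, ?_⟩
  rw [integral_polar volume hI, ← integral_const_mul]
  refine integral_congr_ae (Eventually.of_forall fun w => ?_)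
  simp only
  rw [mellin, ← integral_mul_const, finrank_eucl, add_tsub_cancel_right]
  refine setIntegral_congr_fun measurableSet_Ioi fun r hr => ?_
  rw [hpow r hr, hval w r hr, Complex.real_smul, Complex.real_smul]
  ring

/-- The factor that relates the sphere transform to the Fourier transform of homogeneous
functions. -/
noncomputable def transformFactor (z : ℂ) : ℂ :=
  2 * (Real.pi : ℂ) ^ (-z - 1 / 2) / Complex.Gamma (-z / 2)

/-- Equate the two evaluations of the Mellin transform of `gaussPairing`; their ratio of Gamma
factors is `transformFactor`. The exponent s of the cutoff is independent of a, as the continuation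
in a requires. -/
theorem strip_identity (s : ℂ) (f : (evenTest n).Space) (ξ : Sph n) {a : ℝ} (ha : 0 < a)
    (ha' : a < 1) :
    mellin (radialBump s) ((n : ℂ) + 1 - a) *
      ((∫ w : Sph n, f w * ((|⟪(ξ : Eucl n), w⟫| ^ (-a) : ℝ) : ℂ) ∂(sphereMeasure n)) /
        Complex.Gamma ((-a + 1) / 2)) =
      transformFactor (-a) * rayMellin a (𝓕 (cutoff n s f) : 𝓢(Eucl n, ℂ)) (ξ : Eucl n) := by
  obtain ⟨h1, h2⟩ := integral_cutoff_mul_abs_inner s f ξ ha'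
  have h3 := mellin_gaussPairing ξ (cutoff n s f).continuous ha h1
  rw [mellin_gaussPairing_eq_rayMellin ξ (cutoff n s f) (cutoff_neg s f) rfl ha ha', h2] at h3
  have hG1 : (Real.Gamma ((1 - a) / 2) : ℂ) ≠ 0 := by
    exact_mod_cast (Real.Gamma_pos_of_pos (by linarith)).ne'
  have hG2 : (Real.Gamma (a / 2) : ℂ) ≠ 0 := by
    exact_mod_cast (Real.Gamma_pos_of_pos (by linarith)).ne'
  have e1 : Complex.Gamma ((-a + 1) / 2) = (Real.Gamma ((1 - a) / 2) : ℂ) := by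
    rw [← Complex.Gamma_ofReal]
    congr 1
    push_cast
    ring
  have e2 : Complex.Gamma (-(-a : ℂ) / 2) = (Real.Gamma (a / 2) : ℂ) := by
    rw [← Complex.Gamma_ofReal]
    congr 1
    push_cast
    ring
  have e3 : (Real.pi : ℂ) ^ (-(-a : ℂ) - 1 / 2) =
      ((Real.pi ^ (-(1 - a) / 2) / Real.pi ^ (-a / 2) : ℝ) : ℂ) := by
    rw [← Real.rpow_sub Real.pi_pos, Complex.ofReal_cpow Real.pi_pos.le]
    congr 1
    push_cast
    ring
  have hp : ((Real.pi ^ (-a / 2) : ℝ) : ℂ) ≠ 0 := by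
    exact_mod_cast (Real.rpow_pos_of_pos Real.pi_pos _).ne'
  rw [transformFactor, e1, e2, e3]
  simp only [Complex.ofReal_mul, Complex.ofReal_div, Complex.ofReal_one,
    Complex.ofReal_ofNat] at h3 ⊢
  generalize ((Real.pi ^ (-a / 2) : ℝ) : ℂ) = p at hp h3 ⊢
  generalize ((Real.pi ^ (-(1 - a) / 2) : ℝ) : ℂ) = q at h3 ⊢
  generalize (Real.Gamma (a / 2) : ℂ) = A at hG2 h3 ⊢
  generalize (Real.Gamma ((1 - a) / 2) : ℂ) = B at hG1 h3 ⊢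
  field_simp
  linear_combination -2 * h3

theorem isOpen_re_lt (a : ℝ) : IsOpen {z : ℂ | z.re < a} :=
  isOpen_lt Complex.continuous_re continuous_const

theorem differentiable_transformFactor : Differentiable ℂ transformFactor := by
  have h : transformFactor = fun z => 2 * (Real.pi : ℂ) ^ (-z - 1 / 2) *
      (Complex.Gamma (-z / 2))⁻¹ := funext fun z => div_eq_mul_inv _ _
  rw [h]
  refine Differentiable.mul ?_ (Complex.differentiable_one_div_Gamma.comp (by fun_prop))
  refine Differentiable.const_mul (fun z => ?_) _
  exact DifferentiableAt.const_cpow (by fun_prop) (Or.inl (by exact_mod_cast Real.pi_ne_zero))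

/-- The sphere transform in the half plane `Re z < 0`. -/
theorem continuation_eq_homFourier (c : ℝ≥0) (f : (evenTest n).Space) (ξ : Sph n) {Φ : ℂ → ℂ}
    (hΦ : IsSphereContinuation (c • sphereMeasure n) f ξ Φ) {z : ℂ} (hz : z.re < 0) :
    Φ z = (c : ℂ) * transformFactor z * homFourier n ((n : ℂ) + 1 + z) f ξ := by
  set s : ℂ := (n : ℂ) + 1 + z with hs
  set ψ : 𝓢(Eucl n, ℂ) := 𝓕 (cutoff n s f) with hψ
  let L : ℂ → ℂ := fun w => mellin (radialBump s) ((n : ℂ) + 1 + w) * Φ w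
  let R : ℂ → ℂ := fun w => (c : ℂ) * (transformFactor w * rayMellin (-w) ψ (ξ : Eucl n))
  have hL : DifferentiableOn ℂ L {w | w.re < 0} := by
    refine Differentiable.differentiableOn (Differentiable.mul ?_ hΦ.1)
    exact (differentiable_mellin_radialBump s).comp (by fun_prop)
  have hR : DifferentiableOn ℂ R {w | w.re < 0} := fun w hw => by
    refine DifferentiableAt.differentiableWithinAt (DifferentiableAt.const_mul
      (differentiable_transformFactor.differentiableAt.mul ?_) _)
    refine DifferentiableAt.comp w (g := fun s => rayMellin s ψ (ξ : Eucl n)) (f := fun w => -w)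
      (differentiableAt_rayMellin ψ (sphere_ne_zero ξ) ?_) (by fun_prop)
    simpa using hw
  have key : ∀ a : ℝ, 0 < a → a < 1 → L (-a) = R (-a) := by
    intro a ha ha'
    have h1 := strip_identity s f ξ ha ha'
    simp only [L, R]
    rw [hΦ.2 (-a) (by simp; linarith), integral_nnreal_smul, neg_neg, ← sub_eq_add_neg, ← h1]
    have h2 : ∀ w : Sph n, sphereIntegrand f ξ (-a) w =
        f w * ((|⟪(ξ : Eucl n), w⟫| ^ (-a) : ℝ) : ℂ) / Complex.Gamma ((-a + 1) / 2) := by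
      intro w
      rw [sphereIntegrand, Complex.ofReal_cpow (abs_nonneg _), mul_div_assoc]
      push_cast
      rfl
    simp only [h2]
    rw [integral_div]
    ring
  -- The identity is known only on the real segment (-1, 0), which accumulates at its midpoint; that
  -- suffices for the identity theorem.
  have hfreq : ∃ᶠ w in 𝓝[≠] (-(1 / 2 : ℝ) : ℂ), L w = R w := by
    have ht : Tendsto (fun a : ℝ => -(a : ℂ)) (𝓝[≠] (1 / 2)) (𝓝[≠] (-(1 / 2 : ℝ) : ℂ)) := by
      refine tendsto_nhdsWithin_iff.2 ⟨?_, ?_⟩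
      · exact tendsto_nhdsWithin_of_tendsto_nhds (Continuous.tendsto (by fun_prop) _)
      · filter_upwards [self_mem_nhdsWithin] with a ha
        simpa [neg_inj, ← Complex.ofReal_inj] using ha
    refine ht.frequently (Eventually.frequently ?_)
    filter_upwards [nhdsWithin_le_nhds (Ioo_mem_nhds (by norm_num : (0 : ℝ) < 1 / 2)
      (by norm_num : (1 / 2 : ℝ) < 1))] with a ha
    exact key a ha.1 ha.2
  have h := (hL.analyticOnNhd (isOpen_re_lt 0)).eqOn_of_preconnected_of_frequently_eq
    (hR.analyticOnNhd (isOpen_re_lt 0)) (convex_halfSpace_re_lt 0).isPreconnected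
    (by simp) hfreq hz
  simp only [L, R] at h
  rw [← hs, mellin_radialBump, one_mul] at h
  rw [h, homFourier_eq, rayCLM_apply (by simpa [hs] using hz)
    (fourier_neg_of_even (cutoff_neg s f)), hs, sub_add_cancel_left, mul_assoc]

end evenTest

/-! ### The antipodal map and density of the smooth even functions in L². -/

section Antipode

variable {n : ℕ}

open scoped Pointwise in
theorem measurePreserving_antipode (n : ℕ) :
    MeasurePreserving (fun w : Sph n => -w) (sphereMeasure n) (sphereMeasure n) := by
  have hm : Measurable fun w : Sph n => -w := continuous_neg.measurable
  refine ⟨hm, Measure.ext fun s hs => ?_⟩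
  rw [Measure.map_apply hm hs, sphereMeasure, Measure.toSphere_apply' _ (hm hs),
    Measure.toSphere_apply' _ hs]
  congr 1
  rw [← Measure.measure_neg volume (Ioo (0 : ℝ) 1 • ((↑) '' s : Set (Eucl n)))]
  congr 1
  ext x
  simp only [Set.mem_smul, mem_image, mem_preimage, Set.mem_neg]
  constructor
  · rintro ⟨r, hr, _, ⟨w, hw, rfl⟩, rfl⟩
    exact ⟨r, hr, _, ⟨-w, hw, rfl⟩, by simp⟩
  · rintro ⟨r, hr, _, ⟨w, hw, rfl⟩, h⟩
    exact ⟨r, hr, _, ⟨-w, by simpa using hw, rfl⟩, by simp [h]⟩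

/-- The algebra of smooth functions on the sphere. -/
noncomputable def smoothAlg (n : ℕ) : StarSubalgebra ℂ C(Sph n, ℂ) where
  carrier := {f | ContMDiff (𝓡 n) 𝓘(ℝ, ℂ) ∞ (f : Sph n → ℂ)}
  mul_mem' hf hg := (contDiff_mul (𝕜 := ℝ) (𝔸 := ℂ)).contMDiff.comp (hf.prodMk_space hg)
  add_mem' hf hg := hf.add hg
  algebraMap_mem' _ := contMDiff_const
  star_mem' hf := Complex.conjCLE.contDiff.contMDiff.comp hf

theorem separatesPoints_smoothAlg (n : ℕ) : (smoothAlg n).SeparatesPoints := by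
  intro w w' hne
  obtain ⟨i, hi⟩ : ∃ i, (w : Eucl n) i ≠ (w' : Eucl n) i := by
    by_contra h
    push Not at h
    exact hne (Subtype.ext (PiLp.ext h))
  have hs : ContMDiff (𝓡 n) 𝓘(ℝ, ℂ) ∞ fun w : Sph n => (((w : Eucl n) i : ℝ) : ℂ) := by
    have h1 : ContDiff ℝ ∞ fun x : Eucl n => ((x i : ℝ) : ℂ) := by
      refine Complex.ofRealCLM.contDiff.comp ?_
      exact (EuclideanSpace.proj (𝕜 := ℝ) i).contDiff
    exact h1.contMDiff.comp contMDiff_coe_sphere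
  refine ⟨_, ⟨⟨fun w => (((w : Eucl n) i : ℝ) : ℂ), hs.continuous⟩, hs, rfl⟩, ?_⟩
  simpa using hi

variable {μ : Measure (Sph n)}

theorem ae_antipode (hμ : MeasurePreserving (fun w : Sph n => -w) μ μ) {u g : Sph n → ℂ}
    (h : u =ᵐ[μ] g) : (fun w => u (-w)) =ᵐ[μ] fun w => g (-w) :=
  hμ.quasiMeasurePreserving.ae_eq_comp h

/-- The antipodal map on `L²`. -/
noncomputable def antipodeLp (hμ : MeasurePreserving (fun w : Sph n => -w) μ μ) :
    Lp ℂ 2 μ →ₗᵢ[ℂ] Lp ℂ 2 μ :=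
  Lp.compMeasurePreservingₗᵢ ℂ _ hμ

theorem coeFn_antipodeLp (hμ : MeasurePreserving (fun w : Sph n => -w) μ μ) (u : Lp ℂ 2 μ) :
    (antipodeLp hμ u : Sph n → ℂ) =ᵐ[μ] fun w => (u : Sph n → ℂ) (-w) :=
  Lp.coeFn_compMeasurePreserving u hμ

theorem mem_evenL2_iff (hμ : MeasurePreserving (fun w : Sph n => -w) μ μ) (u : Lp ℂ 2 μ) :
    u ∈ evenL2 n μ ↔ antipodeLp hμ u = u := by
  constructor
  · rintro ⟨g, hg, hu⟩
    refine Lp.ext ((coeFn_antipodeLp hμ u).trans ((ae_antipode hμ hu).trans ?_))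
    simp only [hg]
    exact hu.symm
  · intro h
    have h1 := coeFn_antipodeLp hμ u
    rw [h] at h1
    refine ⟨fun w => ((u : Sph n → ℂ) w + (u : Sph n → ℂ) (-w)) / 2, fun w => ?_, ?_⟩
    · simp only [neg_neg, add_comm]
    · filter_upwards [h1] with w hw
      rw [← hw]
      ring

theorem isClosed_evenL2 (hμ : MeasurePreserving (fun w : Sph n => -w) μ μ) :
    IsClosed (evenL2 n μ : Set (Lp ℂ 2 μ)) := by
  have : (evenL2 n μ : Set (Lp ℂ 2 μ)) = {u | antipodeLp hμ u = u} :=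
    Set.ext fun u => mem_evenL2_iff hμ u
  rw [this]
  exact isClosed_eq (antipodeLp hμ).continuous continuous_id

theorem evenTest.memLp [IsFiniteMeasure μ] (f : (evenTest n).Space) :
    MemLp (f : Sph n → ℂ) 2 μ := by
  obtain ⟨C, hC⟩ := isCompact_univ.exists_bound_of_continuousOn
    (evenTest.continuous_fn f).continuousOn
  exact MemLp.of_bound (evenTest.continuous_fn f).aestronglyMeasurable C
    (Eventually.of_forall fun w => hC w (mem_univ w))

/-- Smooth functions are dense by Stone–Weierstrass. The continuous averaging P = (1 + antipode)/2
sends them to smooth even functions and fixes every even class. -/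
theorem dense_evenTest [IsFiniteMeasure μ]
    (hμ : MeasurePreserving (fun w : Sph n => -w) μ μ) :
    closure {u : Lp ℂ 2 μ | ∃ f : (evenTest n).Space, (u : Sph n → ℂ) =ᵐ[μ] (f : Sph n → ℂ)} =
      (evenL2 n μ : Set (Lp ℂ 2 μ)) := by
  set D := {u : Lp ℂ 2 μ | ∃ f : (evenTest n).Space, (u : Sph n → ℂ) =ᵐ[μ] (f : Sph n → ℂ)}
  refine Subset.antisymm (closure_minimal ?_ (isClosed_evenL2 hμ)) fun u hu => ?_
  · rintro u ⟨f, hf⟩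
    exact ⟨f, evenTest.even f, hf⟩
  let P : Lp ℂ 2 μ → Lp ℂ 2 μ := fun v => (2⁻¹ : ℂ) • (v + antipodeLp hμ v)
  have hP : Continuous P := by
    have := (antipodeLp hμ).continuous
    fun_prop
  let ι : C(Sph n, ℂ) →L[ℂ] Lp ℂ 2 μ := ContinuousMap.toLp 2 μ ℂ
  have hdense : Dense (ι '' (smoothAlg n : Set C(Sph n, ℂ))) := by
    refine (ContinuousMap.toLp_denseRange ℂ μ ℂ (by norm_num)).dense_image ι.continuous ?_
    have h := ContinuousMap.starSubalgebra_topologicalClosure_eq_top_of_separatesPoints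
      (smoothAlg n) (separatesPoints_smoothAlg n)
    intro f
    have hf : f ∈ (smoothAlg n).topologicalClosure := by
      rw [h]
      trivial
    exact hf
  have hmaps : MapsTo P (ι '' (smoothAlg n : Set C(Sph n, ℂ))) D := by
    rintro _ ⟨g, hg, rfl⟩
    have hg' : ContMDiff (𝓡 n) 𝓘(ℝ, ℂ) ∞ (g : Sph n → ℂ) := hg
    have hneg : ContMDiff (𝓡 n) 𝓘(ℝ, ℂ) ∞ fun w : Sph n => g (-w) :=
      hg'.comp contMDiff_neg_sphere
    have hsum : ContMDiff (𝓡 n) 𝓘(ℝ, ℂ) ∞ fun w : Sph n => (2⁻¹ : ℂ) * (g w + g (-w)) :=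
      (((contDiff_const (𝕜 := ℝ) (c := (2⁻¹ : ℂ))).mul contDiff_id).contMDiff.comp
        (hg'.add hneg))
    refine ⟨⟨⟨_, hsum.continuous⟩, hsum, fun w => ?_⟩, ?_⟩
    · simp only [ContinuousMap.coe_mk, neg_neg]
      rw [add_comm]
    · have h1 : (ι g : Sph n → ℂ) =ᵐ[μ] g := ContinuousMap.coeFn_toLp μ g
      have h2 := (coeFn_antipodeLp hμ (ι g)).trans (ae_antipode hμ h1)
      filter_upwards [Lp.coeFn_smul (2⁻¹ : ℂ) (ι g + antipodeLp hμ (ι g)),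
        Lp.coeFn_add (ι g) (antipodeLp hμ (ι g)), h1, h2] with w h3 h4 h5 h6
      rw [h3, Pi.smul_apply, h4, Pi.add_apply, h5, h6]
      rfl
  have hPu : P u = u := by
    simp only [P]
    rw [(mem_evenL2_iff hμ u).1 hu, ← two_smul ℂ u, smul_smul]
    norm_num
  rw [← hPu]
  exact map_mem_closure hP (hdense u) hmaps

end Antipode

/-! ### A continuous even function that is not smooth. -/

section Proper

variable {n : ℕ}

/-- The function `w ↦ |w₀|`. -/
noncomputable def absCoord (n : ℕ) : C(Sph n, ℂ) :=
  ⟨fun w => ((|(w : Eucl n) 0| : ℝ) : ℂ), by fun_prop⟩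

/-- On the line e_i + t e_0 with i ≠ 0, the radial extension times the norm is |t|. The hypothesis n
≥ 1 supplies the second coordinate. -/
theorem absCoord_notMem (hn : 1 ≤ n) : absCoord n ∉ (evenTest n).carrier := by
  rintro ⟨h, -⟩
  have hs := contDiffOn_radialExt h
  let i : Fin (n + 1) := ⟨1, by omega⟩
  have hi : i ≠ 0 := by
    intro h
    exact one_ne_zero (congrArg Fin.val h)
  let γ : ℝ → Eucl n := fun t => EuclideanSpace.single i 1 + t • EuclideanSpace.single 0 1
  have hγ0 : ∀ t, γ t 0 = t := fun t => by simp [γ, hi.symm]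
  have hγi : ∀ t, γ t i = 1 := fun t => by simp [γ, hi]
  have hne : ∀ t, γ t ≠ 0 := fun t h0 => by
    have := hγi t
    rw [h0] at this
    simp at this
  have hγ : DifferentiableAt ℝ γ 0 := by
    simp only [γ]
    fun_prop
  have h1 : DifferentiableAt ℝ (radialExt (absCoord n)) (γ 0) :=
    (hs.contDiffAt (isOpen_compl_singleton.mem_nhds (hne 0))).differentiableAt (by simp)
  have h2 : DifferentiableAt ℝ (fun t => radialExt (absCoord n) (γ t) * ((‖γ t‖ : ℝ) : ℂ)) 0 := by
    refine (h1.comp (0 : ℝ) hγ).mul ?_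
    exact Complex.ofRealCLM.differentiableAt.comp (0 : ℝ)
      (((contDiffAt_norm ℝ (hne 0)).differentiableAt one_ne_zero).comp (0 : ℝ) hγ)
  refine not_differentiableAt_abs_zero ?_
  have h3 := Complex.reCLM.differentiableAt.comp (0 : ℝ) h2
  refine h3.congr_of_eventuallyEq (Eventually.of_forall fun t => ?_)
  have hpos : 0 < ‖γ t‖ := norm_pos_iff.2 (hne t)
  simp only [Function.comp_apply, Complex.reCLM_apply]
  rw [radialExt_of_ne _ (hne t)]
  simp only [absCoord, ContinuousMap.coe_mk, sphereProj]
  rw [← Complex.ofReal_mul, Complex.ofReal_re, PiLp.smul_apply, hγ0, smul_eq_mul, abs_mul,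
    abs_of_pos (inv_pos.2 hpos)]
  field_simp

theorem isDenseLineal_evenTest (hn : 1 ≤ n) {μ : Measure (Sph n)} [IsFiniteMeasure μ]
    (hμ : MeasurePreserving (fun w : Sph n => -w) μ μ) :
    (evenTest n).IsDenseLineal μ (evenL2 n μ) where
  topologicalAddGroup := inferInstance
  continuousSMul := inferInstance
  locallyConvex := evenTest.withSeminorms_derivNorm.toLocallyConvexSpace
  memLp := evenTest.memLp
  dense := dense_evenTest hμ
  proper := by
    have h := ContinuousMap.coeFn_toLp (p := 2) (𝕜 := ℂ) μ (absCoord n)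
    exact ⟨absCoord n, ⟨ContinuousMap.toLp 2 μ ℂ (absCoord n),
      ⟨absCoord n, fun w => by simp [absCoord], h⟩, h⟩, absCoord_notMem hn⟩

end Proper

/-! ### Verification of the GFT axioms on the critical line. -/

namespace evenTest

variable {n : ℕ}

theorem conj_eq_sub {s : ℂ} (hs : s.re = ((n : ℝ) + 1) / 2) : conj s = (n : ℂ) + 1 - s := by
  apply Complex.ext
  · simp only [Complex.conj_re, Complex.sub_re, Complex.add_re, Complex.natCast_re, Complex.one_re]
    rw [hs]
    ring
  · simp

theorem smul_homFourier_leftInverse {s : ℂ} (hs : 0 < s.re) (hs' : s.re < n + 1) {u : ℂ}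
    (hu : u ≠ 0) (f : (evenTest n).Space) :
    u⁻¹ • homFourier n ((n : ℂ) + 1 - s) (u • homFourier n s f) = f := by
  rw [map_smul, smul_smul, inv_mul_cancel₀ hu, one_smul, homFourier_homFourier hs hs']

/-- The transform `u • homFourier n s` of the test space, for `u ≠ 0`. -/
noncomputable def fourierEquiv (n : ℕ) {s : ℂ} (hs : s.re = ((n : ℝ) + 1) / 2) {u : ℂ}
    (hu : u ≠ 0) : (evenTest n).Space ≃L[ℂ] (evenTest n).Space :=
  ContinuousLinearEquiv.equivOfInverse (u • homFourier n s)
    (u⁻¹ • homFourier n ((n : ℂ) + 1 - s))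
    (fun f => smul_homFourier_leftInverse (by rw [hs]; positivity) (by rw [hs]; linarith) hu f)
    (fun f => by
      have hre : ((n : ℂ) + 1 - s).re = ((n : ℝ) + 1) / 2 := by
        simp only [Complex.sub_re, Complex.add_re, Complex.natCast_re, Complex.one_re]
        rw [hs]
        ring
      have h := smul_homFourier_leftInverse (s := (n : ℂ) + 1 - s) (by rw [hre]; positivity)
        (by rw [hre]; linarith) (inv_ne_zero hu) f
      rwa [sub_sub_cancel, inv_inv] at h)

theorem fourierEquiv_apply {s : ℂ} (hs : s.re = ((n : ℝ) + 1) / 2) {u : ℂ} (hu : u ≠ 0)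
    (f : (evenTest n).Space) : fourierEquiv n hs hu f = u • homFourier n s f := rfl

theorem fourierEquiv_symm_apply {s : ℂ} (hs : s.re = ((n : ℝ) + 1) / 2) {u : ℂ} (hu : u ≠ 0)
    (f : (evenTest n).Space) :
    (fourierEquiv n hs hu).symm f = u⁻¹ • homFourier n ((n : ℂ) + 1 - s) f := rfl

theorem star_smul_space (a : ℂ) (f : (evenTest n).Space) : star (a • f) = conj a • star f := by
  ext w
  simp only [TestAlgebra.star_apply, TestAlgebra.smul_apply, map_mul]

theorem star_star_space (f : (evenTest n).Space) : star (star f) = f := by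
  ext w
  simp only [TestAlgebra.star_apply, Complex.conj_conj]

/-- The only place where the critical line and |u| = 1 meet: conj s = n + 1 - s and conj u = u⁻¹, so
conjugation exchanges the transform with its inverse. -/
theorem star_fourierEquiv {s : ℂ} (hs : s.re = ((n : ℝ) + 1) / 2) {u : ℂ} (hu : u ≠ 0)
    (hu1 : ‖u‖ = 1) (f : (evenTest n).Space) :
    star (fourierEquiv n hs hu f) = (fourierEquiv n hs hu).symm (star f) := by
  rw [fourierEquiv_apply, fourierEquiv_symm_apply, star_smul_space,
    star_homFourier (by rw [hs]; linarith), conj_eq_sub hs, Complex.inv_eq_conj hu1]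

theorem integral_fourierEquiv_mul (c : ℝ≥0) {s : ℂ} (hs : s.re = ((n : ℝ) + 1) / 2) {u : ℂ}
    (hu : u ≠ 0) (f g : (evenTest n).Space) :
    ∫ w, (fourierEquiv n hs hu f) w * g w ∂(c • sphereMeasure n) =
      ∫ w, f w * (fourierEquiv n hs hu g) w ∂(c • sphereMeasure n) := by
  rw [integral_nnreal_smul, integral_nnreal_smul]
  simp only [fourierEquiv_apply, TestAlgebra.smul_apply, mul_assoc, mul_left_comm _ u]
  rw [integral_const_mul, integral_const_mul,
    integral_homFourier_mul (by rw [hs]; positivity) (by rw [hs]; linarith)]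

theorem norm_apply_le (f : (evenTest n).Space) (w : Sph n) : ‖f w‖ ≤ derivNorm n 0 f := by
  have h := norm_iteratedFDeriv_coe_le 0 f w
  rwa [norm_iteratedFDeriv_zero, radialExt_coe] at h

theorem continuous_of_norm_le (l : (evenTest n).Space →ₗ[ℂ] ℂ) (C : ℝ≥0)
    (h : ∀ f, ‖l f‖ ≤ C * derivNorm n 0 f) : Continuous l := by
  refine withSeminorms_derivNorm.continuous_of_isBounded (norm_withSeminorms ℂ ℂ) l
    fun _ => ⟨{⟨0, 0⟩}, C, fun f => ?_⟩
  rw [Finset.sup_singleton]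
  exact h f

/-- Evaluation at a point, as a generalized function. -/
noncomputable def evalCLM (w : Sph n) : (evenTest n).Space →L[ℂ] ℂ :=
  let l : (evenTest n).Space →ₗ[ℂ] ℂ :=
    { toFun := fun f => f w
      map_add' := fun _ _ => rfl
      map_smul' := fun _ _ => rfl }
  ⟨l, continuous_of_norm_le l 1 fun f => by
    rw [NNReal.coe_one, one_mul]
    exact norm_apply_le f w⟩

theorem integrable_mul_of_isFiniteMeasure (μ : Measure (Sph n)) [IsFiniteMeasure μ]
    (f g : (evenTest n).Space) : Integrable (fun w => f w * g w) μ :=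
  ((continuous_fn f).mul (continuous_fn g)).integrable_of_hasCompactSupport
    (HasCompactSupport.of_compactSpace _)

/-- Integration against a test function, as a generalized function. -/
noncomputable def integralCLM (μ : Measure (Sph n)) [IsFiniteMeasure μ] (f : (evenTest n).Space) :
    (evenTest n).Space →L[ℂ] ℂ :=
  let l : (evenTest n).Space →ₗ[ℂ] ℂ :=
    { toFun := fun h => ∫ w, h w * f w ∂μ
      map_add' := fun g h => by
        simp only [TestAlgebra.add_apply, add_mul]
        exact integral_add (integrable_mul_of_isFiniteMeasure μ g f)
          (integrable_mul_of_isFiniteMeasure μ h f)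
      map_smul' := fun a h => by
        simp only [TestAlgebra.smul_apply, mul_assoc, RingHom.id_apply, smul_eq_mul]
        exact integral_const_mul _ _ }
  ⟨l, continuous_of_norm_le l (derivNorm n 0 f * μ.real univ).toNNReal fun h => by
    have hf : 0 ≤ derivNorm n 0 f := apply_nonneg _ _
    rw [Real.coe_toNNReal _ (by positivity)]
    refine (norm_integral_le_of_norm_le_const (C := derivNorm n 0 h * derivNorm n 0 f)
      (Eventually.of_forall fun w => ?_)).trans (le_of_eq (by ring))
    rw [norm_mul]
    exact mul_le_mul (norm_apply_le h w) (norm_apply_le f w) (norm_nonneg _) (apply_nonneg _ _)⟩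

/-- The transposed map on generalized functions. -/
noncomputable def dualEquiv {V W : Type*} [AddCommGroup V] [Module ℂ V] [TopologicalSpace V]
    [AddCommGroup W] [Module ℂ W] [TopologicalSpace W] (F : W ≃L[ℂ] V) :
    WeakDual ℂ V ≃L[ℂ] WeakDual ℂ W where
  toFun m := ContinuousLinearMap.comp (m : V →L[ℂ] ℂ) (F : W →L[ℂ] V)
  invFun m := ContinuousLinearMap.comp (m : W →L[ℂ] ℂ) (F.symm : V →L[ℂ] W)
  map_add' _ _ := rfl
  map_smul' _ _ := rfl
  left_inv m := by
    refine ContinuousLinearMap.ext fun v => ?_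
    exact congrArg m (F.apply_symm_apply v)
  right_inv m := by
    refine ContinuousLinearMap.ext fun v => ?_
    exact congrArg m (F.symm_apply_apply v)
  continuous_toFun := WeakDual.continuous_of_continuous_eval fun w => WeakDual.eval_continuous (F w)
  continuous_invFun :=
    WeakDual.continuous_of_continuous_eval fun v => WeakDual.eval_continuous (F.symm v)

/-- The class in `L²` of a test function. -/
noncomputable def toEvenL2 (μ : Measure (Sph n)) [IsFiniteMeasure μ] :
    (evenTest n).Space →ₗ[ℂ] evenL2 n μ where
  toFun f := ⟨(evenTest.memLp (μ := μ) f).toLp, f, even f, (memLp f).coeFn_toLp⟩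
  map_add' _ _ := rfl
  map_smul' _ _ := rfl

theorem coeFn_toEvenL2 (μ : Measure (Sph n)) [IsFiniteMeasure μ] (f : (evenTest n).Space) :
    ((toEvenL2 μ f : Lp ℂ 2 μ) : Sph n → ℂ) =ᵐ[μ] (f : Sph n → ℂ) := (memLp f).coeFn_toLp

theorem denseRange_toEvenL2 {μ : Measure (Sph n)} [IsFiniteMeasure μ]
    (hμ : MeasurePreserving (fun w : Sph n => -w) μ μ) : DenseRange (toEvenL2 μ) := by
  intro u
  rw [closure_subtype]
  have h := u.2
  rw [← SetLike.mem_coe, ← dense_evenTest hμ] at h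
  refine closure_mono ?_ h
  rintro v ⟨f, hf⟩
  exact ⟨toEvenL2 μ f, ⟨f, rfl⟩, Lp.ext ((coeFn_toEvenL2 μ f).trans hf.symm)⟩

theorem norm_sq_toEvenL2 (μ : Measure (Sph n)) [IsFiniteMeasure μ] (f : (evenTest n).Space) :
    ((‖toEvenL2 μ f‖ ^ 2 : ℝ) : ℂ) = ∫ w, f w * conj (f w) ∂μ := by
  have h := inner_self_eq_norm_sq_to_K (𝕜 := ℂ) (toEvenL2 μ f : Lp ℂ 2 μ)
  rw [L2.inner_def] at h
  push_cast
  refine Eq.trans h.symm ?_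
  refine integral_congr_ae ?_
  filter_upwards [coeFn_toEvenL2 μ f] with w hw
  rw [hw]
  rfl

/-- All axioms follow from two facts about F = u H_s: it is symmetric for ∫ f g, and F(conj (F f)) =
conj f. The map on generalized functions is the transpose of F, which extends F because F is
symmetric; the L² isometry extends F by density. -/
theorem isSphereGFT_of_eq (hn : 1 ≤ n) {c : ℝ≥0} {s : ℂ} (hs : s.re = ((n : ℝ) + 1) / 2) {u : ℂ}
    (hu1 : ‖u‖ = 1) {J : (Sph n → ℂ) → Sph n → ℂ}
    (hJ : ∀ (f : (evenTest n).Space) (ξ : Sph n), J f ξ = u * homFourier n s f ξ) :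
    IsSphereGFT n (c • sphereMeasure n) J := by
  set μ := c • sphereMeasure n with hμdef
  have hu : u ≠ 0 := by
    rintro rfl
    simp at hu1
  have hμ : MeasurePreserving (fun w : Sph n => -w) μ μ :=
    (measurePreserving_antipode n).smul_measure c
  set F := fourierEquiv n hs hu with hF
  have hFJ : ∀ (f : (evenTest n).Space) (ξ : Sph n), J f ξ = F f ξ := hJ
  have hsym : ∀ f g : (evenTest n).Space, ∫ w, F f w * g w ∂μ = ∫ w, f w * F g w ∂μ :=
    integral_fourierEquiv_mul c hs hu
  have hstar : ∀ f : (evenTest n).Space, star (F f) = F.symm (star f) :=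
    star_fourierEquiv hs hu hu1
  have hstar' : ∀ f : (evenTest n).Space, F (star (F f)) = star f := fun f => by
    rw [hstar, F.apply_symm_apply]
  have hplanch : ∀ f g : (evenTest n).Space,
      ∫ w, f w * conj (g w) ∂μ = ∫ w, F f w * conj (F g w) ∂μ := by
    intro f g
    -- Symmetry moves F onto conj (F g), and F (conj (F g)) = conj g.
    have h := hsym f (star (F g))
    rw [hstar'] at h
    exact h.symm
  have hdl := isDenseLineal_evenTest hn hμ
  have hnorm : ∀ f, ‖toEvenL2 μ (F f)‖ = ‖toEvenL2 μ f‖ := by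
    intro f
    have h := hplanch f f
    rw [← norm_sq_toEvenL2, ← norm_sq_toEvenL2, Complex.ofReal_inj] at h
    exact ((sq_eq_sq₀ (norm_nonneg _) (norm_nonneg _)).1 h).symm
  have : CompleteSpace (evenL2 n μ) := (isClosed_evenL2 hμ).completeSpace_coe
  refine ⟨hdl, hdl, fun y => ⟨(evalCLM y).comp (F : (evenTest n).Space →L[ℂ] (evenTest n).Space), fun f => (hFJ f y).symm⟩,
    fun x => ⟨(evalCLM x).comp (F : (evenTest n).Space →L[ℂ] (evenTest n).Space), fun f => (hFJ f x).symm⟩, fun f g => ?_,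
    F.toLinearEquiv, fun f y => (hFJ f y).symm, ?_, hplanch, fun f x => ?_, dualEquiv F, ?_, ?_, ?_⟩
  · simp only [hFJ]
    exact hsym f g
  · refine ⟨F.toLinearEquiv.extendOfIsometry (toEvenL2 μ) (toEvenL2 μ) (denseRange_toEvenL2 hμ)
      (denseRange_toEvenL2 hμ) hnorm, fun f v hv => ?_⟩
    have hv' : v = toEvenL2 μ f := Subtype.ext (Lp.ext (hv.trans (coeFn_toEvenL2 μ f).symm))
    rw [hv', LinearEquiv.extendOfIsometry_eq]
    exact coeFn_toEvenL2 μ (F f)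
  · rw [hFJ]
    change f x = conj ((F (star (F f))) x)
    rw [hstar', TestAlgebra.star_apply, Complex.conj_conj]
  · intro f
    refine ⟨integralCLM μ f, fun h => rfl, fun g => ?_⟩
    change ∫ w, F g w * f w ∂μ = _
    exact hsym g f
  · exact fun x => ⟨evalCLM x, fun h => rfl, fun g => (hFJ g x).symm⟩
  · intro y
    refine ⟨(evalCLM y).comp (F.symm : (evenTest n).Space →L[ℂ] (evenTest n).Space), fun h => ?_, fun g => ?_⟩
    · change F.symm h y = conj (J (TestAlgebra.fn (star h)) y)
      rw [hFJ, ← TestAlgebra.star_apply, hstar, star_star_space]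
    · change F.symm (F g) y = g y
      rw [F.symm_apply_apply]

end evenTest

/-! ### Normalization of the measure and the theorem. -/

namespace evenTest

variable {n : ℕ}

theorem transformFactor_ne_zero {z : ℂ} (hz : z.re < 0) : transformFactor z ≠ 0 := by
  refine div_ne_zero (mul_ne_zero two_ne_zero ?_) (Complex.Gamma_ne_zero_of_re_pos ?_)
  · rw [Complex.cpow_def_of_ne_zero (by exact_mod_cast Real.pi_ne_zero)]
    exact Complex.exp_ne_zero _
  · have : (-z / 2).re = -z.re / 2 := by simp
    rw [this]
    linarith

theorem sphereTransform_eq_homFourier (hn : 1 ≤ n) (c : ℝ≥0) (f : (evenTest n).Space) (ξ : Sph n)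
    {z : ℂ} (hz : z.re < 0) : sphereTransform (c • sphereMeasure n) z f ξ =
      (c : ℂ) * transformFactor z * homFourier n ((n : ℂ) + 1 + z) f ξ := by
  obtain ⟨-, Φ, -, hΦ, -⟩ := exists_isSliceDensity_isSphereContinuation hn c f ξ
  rw [sphereTransform_eq hΦ, continuation_eq_homFourier c f ξ hΦ hz]

/-- A transform that is proportional to the sphere transform with `Re z = -(n + 1) / 2` is a GFT
for a suitable normalization of the measure. -/
theorem exists_isSphereGFT (hn : 1 ≤ n) {z : ℂ} (hz : z.re = -((n : ℝ) + 1) / 2) {b : ℂ}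
    (hb : b ≠ 0) (J : ℝ≥0 → (Sph n → ℂ) → Sph n → ℂ)
    (hJ : ∀ (c : ℝ≥0) (f : (evenTest n).Space) (ξ : Sph n),
      sphereTransform (c • sphereMeasure n) z f ξ = b * J c f ξ) :
    ∃ c : ℝ≥0, 0 < c ∧ IsSphereGFT n (c • sphereMeasure n) (J c) := by
  have hn0 : (0 : ℝ) ≤ n := Nat.cast_nonneg n
  have hz0 : z.re < 0 := by
    rw [hz]
    linarith
  set a : ℂ := b⁻¹ * transformFactor z with ha
  have ha0 : a ≠ 0 := mul_ne_zero (inv_ne_zero hb) (transformFactor_ne_zero hz0)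
  have ha1 : 0 < ‖a‖₊ := nnnorm_pos.2 ha0
  -- The transform J c is c a H_{n+1+z}, so c = 1/|a| leaves a constant of modulus 1.
  refine ⟨‖a‖₊⁻¹, inv_pos.2 ha1, isSphereGFT_of_eq hn (s := (n : ℂ) + 1 + z)
    (u := ((‖a‖₊⁻¹ : ℝ≥0) : ℂ) * a) ?_ ?_ fun f ξ => ?_⟩
  · simp only [Complex.add_re, Complex.natCast_re, Complex.one_re]
    rw [hz]
    ring
  · rw [norm_mul]
    have h : ‖((‖a‖₊⁻¹ : ℝ≥0) : ℂ)‖ = ‖a‖⁻¹ := by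
      simp
    rw [h]
    exact inv_mul_cancel₀ (norm_ne_zero_iff.2 ha0)
  · have h := hJ ‖a‖₊⁻¹ f ξ
    rw [sphereTransform_eq_homFourier hn _ f ξ hz0] at h
    have hba : b * a = transformFactor z := by rw [ha, mul_inv_cancel_left₀ hb]
    rw [← mul_right_inj' hb, ← h]
    generalize ((‖a‖₊⁻¹ : ℝ≥0) : ℂ) = q
    rw [← hba]
    ring

theorem sphereTransform_eq_deltaTransform (hn : 1 ≤ n) (c : ℝ≥0) (f : (evenTest n).Space)
    (ξ : Sph n) (k : ℕ) : sphereTransform (c • sphereMeasure n) (-2 * (k : ℂ) - 1) f ξ =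
      ((-1) ^ k * (k.factorial : ℂ) / ((2 * k).factorial : ℂ)) *
        deltaTransform (c • sphereMeasure n) (2 * k) f ξ := by
  obtain ⟨φ, Φ, hφ, hΦ, hval⟩ := exists_isSliceDensity_isSphereContinuation hn c f ξ
  rw [sphereTransform_eq hΦ, deltaTransform_eq hφ, hval, Even.neg_one_pow (even_two_mul k), one_mul]

end evenTest

theorem mainTheorem8 :
    -- the transforms `J_z` are well defined
    (∀ (n : ℕ), 1 ≤ n → ∀ (c : ℝ≥0) (f : (evenTest n).Space) (ξ : Sph n),
      (∀ z : ℂ, -1 < z.re → Integrable (sphereIntegrand f ξ z) (c • sphereMeasure n)) ∧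
      ∃ Φ : ℂ → ℂ, IsSphereContinuation (c • sphereMeasure n) f ξ Φ) ∧
    -- `J_z` is a GFT for `z = -(n + 1) / 2 + i ρ`
    (∀ (n : ℕ), 1 ≤ n → ∀ ρ : ℝ, ∃ c : ℝ≥0, 0 < c ∧
      IsSphereGFT n (c • sphereMeasure n)
        (sphereTransform (c • sphereMeasure n) (-((n : ℂ) + 1) / 2 + Complex.I * ρ))) ∧
    -- the local case
    (∀ (k : ℕ),
      (∃ c : ℝ≥0, 0 < c ∧
        IsSphereGFT (4 * k + 1) (c • sphereMeasure (4 * k + 1))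
          (sphereTransform (c • sphereMeasure (4 * k + 1)) (-2 * (k : ℂ) - 1))) ∧
      -- up to a constant factor, the kernel is `δ^(2k)`
      (∀ (c : ℝ≥0) (f : (evenTest (4 * k + 1)).Space) (ξ : Sph (4 * k + 1)),
        (∃ φ : ℝ → ℂ, IsSliceDensity (c • sphereMeasure (4 * k + 1)) f ξ φ) ∧
        sphereTransform (c • sphereMeasure (4 * k + 1)) (-2 * (k : ℂ) - 1) f ξ =
          ((-1) ^ k * (k.factorial : ℂ) / ((2 * k).factorial : ℂ)) *
            deltaTransform (c • sphereMeasure (4 * k + 1)) (2 * k) f ξ) ∧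
      -- the transform with the kernel `δ^(2k)` is a GFT
      (∃ c : ℝ≥0, 0 < c ∧
        IsSphereGFT (4 * k + 1) (c • sphereMeasure (4 * k + 1))
          (deltaTransform (c • sphereMeasure (4 * k + 1)) (2 * k))) ∧
      -- it is local
      (∀ (c : ℝ≥0) (f : (evenTest (4 * k + 1)).Space) (ξ : Sph (4 * k + 1))
        (V : Set (Sph (4 * k + 1))), IsOpen V →
        {w : Sph (4 * k + 1) | ⟪(ξ : EuclideanSpace ℝ (Fin (4 * k + 1 + 1))), w⟫ = 0} ⊆ V →
        (∀ w ∈ V, f w = 0) →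
        deltaTransform (c • sphereMeasure (4 * k + 1)) (2 * k) f ξ = 0)) := by
  -- The dimension n = 4k + 1 is the one for which the point -2k - 1, where the kernel is local,
  -- lies on the critical line.
  have hre : ∀ k : ℕ, (-2 * (k : ℂ) - 1).re = -(((4 * k + 1 : ℕ) : ℝ) + 1) / 2 := fun k => by
    simp
    ring
  have hfac : ∀ k : ℕ, ((-1) ^ k * (k.factorial : ℂ) / ((2 * k).factorial : ℂ)) ≠ 0 := fun k =>
    div_ne_zero (mul_ne_zero (pow_ne_zero _ (by norm_num)) (by exact_mod_cast k.factorial_ne_zero))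
      (by exact_mod_cast (2 * k).factorial_ne_zero)
  refine ⟨fun n hn c f ξ => ⟨fun z hz => integrable_sphereIntegrand c f ξ hz, ?_⟩,
    fun n hn ρ => ?_, fun k => ⟨?_, fun c f ξ => ⟨?_, ?_⟩, ?_, fun c f ξ V hV hξ h0 => ?_⟩⟩
  · obtain ⟨-, Φ, -, hΦ, -⟩ := exists_isSliceDensity_isSphereContinuation hn c f ξ
    exact ⟨Φ, hΦ⟩
  · refine evenTest.exists_isSphereGFT hn (z := -((n : ℂ) + 1) / 2 + Complex.I * ρ) ?_ one_ne_zero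
      (fun c => sphereTransform (c • sphereMeasure n) (-((n : ℂ) + 1) / 2 + Complex.I * ρ))
      fun c f ξ => (one_mul _).symm
    simp
  · exact evenTest.exists_isSphereGFT (by omega) (hre k) one_ne_zero
      (fun c => sphereTransform (c • sphereMeasure (4 * k + 1)) (-2 * (k : ℂ) - 1))
      fun c f ξ => (one_mul _).symm
  · obtain ⟨φ, -, hφ, -, -⟩ := exists_isSliceDensity_isSphereContinuation (by omega) c f ξ
    exact ⟨φ, hφ⟩
  · exact evenTest.sphereTransform_eq_deltaTransform (by omega) c f ξ k
  -- The factor (-1)^k k!/(2k)! is absorbed by another normalization of the measure.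
  · exact evenTest.exists_isSphereGFT (by omega) (hre k) (hfac k)
      (fun c => deltaTransform (c • sphereMeasure (4 * k + 1)) (2 * k))
      fun c f ξ => evenTest.sphereTransform_eq_deltaTransform (by omega) c f ξ k
  · obtain ⟨φ, -, hφ, -, -⟩ := exists_isSliceDensity_isSphereContinuation (by omega) c f ξ
    exact deltaTransform_eq_zero ⟨φ, hφ⟩ (2 * k) hV hξ h0
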